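/- Let $\alpha>0$. For every $n\in\mathbb N=\{1,2,\dots\}$ let $\Sigma_n$ be a real symmetric positive definite $n\times n$ matrix with $\Sigma_n(i,i)=1$ for all $i$ and $|\Sigma_n(i,j)|\le n^{-\alpha}$ for all $i\ne j$. Put $\Delta_n=n(n+1)/2$. On a probability space $(\Omega,\mathcal A,\mathbb P)$ let, for every $n\in\mathbb N$, $(Y^{(n)}_1,\dots,Y^{(n)}_{\Delta_n})\sim\mathcal N(0,\Sigma_{\Delta_n})$ be a Gaussian random vector (no assumption is made on the joint distribution of the vectors for different $n$). Let $\varphi_n:\{1,\dots,n\}^2\to\{1,\dots,\Delta_n\}$ be a map that restricts to a bijection on $\{(i,j): i\le j\}$ and satisfies $\varphi_n(i,j)=\varphi_n(j,i)$, and let $a_n$ be the random symmetric $n\times n$ matrix with entries $a_n(i,j)=Y^{(n)}_{\varphi_n(i,j)}$. Let $(b_n)_{n\in\mathbb N}$ be natural numbers such that, for each $n$, either $b_n$ is odd and $b_n<n$, or $b_n=n$; assume $b_n\to\infty$. Call $(i,j)\in\{1,\dots,n\}^2$ $b_n$-relevant if $b_n=n$, or $|i-j|\le\frac{b_n-1}2$,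 or $|i-j|\ge n-\frac{b_n-1}2$. Let $X_n$ be the $n\times n$ periodic band matrix with $X_n(i,j)=b_n^{-1/2}a_n(i,j)$ if $(i,j)$ is $b_n$-relevant and $X_n(i,j)=0$ otherwise. Let $\sigma_n=\frac1n\sum_{k=1}^n\delta_{\lambda_k}$ be the empirical spectral distribution of $X_n$, where $\lambda_1,\dots,\lambda_n$ are the eigenvalues of $X_n$ with multiplicity, and let $\sigma$ be the semicircle distribution, with Lebesgue density $\frac1{2\pi}\sqrt{4-x^2}\,\mathbf 1_{[-2,2]}(x)$. Then: 1. If $\alpha\ge\frac12$, the semicircle law holds in probability for $(X_n)_n$: for every bounded continuous $f:\mathbb R\to\mathbb R$, $\int f\,d\sigma_n\to\int f\,d\sigma$ in probability. 2. If $\alpha>\frac12$ and $\sum_n b_n^{-2}<\infty$, the semicircle law holds almost surely for $(X_n)_n$: for every bounded continuous $f:\mathbb R\to\mathbb R$, $\int f\,d\sigma_n\to\int f\,d\sigma$ almost surely. In particular, this holds for $\alpha>\frac12$ and full matrices, $b_n=n$ for all $n$. -/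

import Mathlib

open MeasureTheory ProbabilityTheory Filter Topology
open scoped BoundedContinuousFunction ENNReal

noncomputable section

/-- Sequences `(Σ_n)` of real `n × n` covariance matrices that are (symmetric) positive definite,
with unit diagonal and off-diagonal entries bounded in modulus by `n ^ (-α)`. For `n = 0` there is
no condition. -/
structure IsCovMatSeq (α : ℝ) (S : ∀ n : ℕ, Matrix (Fin n) (Fin n) ℝ) : Prop where
  diag : ∀ n (i : Fin n), S n i i = 1
  offDiag : ∀ n (i j : Fin n), i ≠ j → |S n i j| ≤ 1 / (n : ℝ) ^ α
  posDef : ∀ n, (S n).PosDef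

/-- The number of entries on and above the diagonal of an `n × n` matrix. -/
def triangleCard (n : ℕ) : ℕ := n * (n + 1) / 2

/-- `φ` is a symmetric map on index pairs that enumerates bijectively the pairs `(i, j)` with
`i ≤ j`. -/
structure IsTriangleEnumeration {n : ℕ} (φ : Fin n × Fin n → Fin (triangleCard n)) : Prop where
  bijOn : Set.BijOn φ {p | p.1 ≤ p.2} Set.univ
  symm : ∀ i j : Fin n, j < i → φ (i, j) = φ (j, i)

/-- The symmetric matrix with `(i, j)` entry `y (φ (i, j))`. -/
def filledMatrix {n : ℕ} (φ : Fin n × Fin n → Fin (triangleCard n))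
    (y : EuclideanSpace ℝ (Fin (triangleCard n))) : Matrix (Fin n) (Fin n) ℝ :=
  Matrix.of fun i j => y (φ (i, j))

/-- `b` is an `n`-bandwidth: either an odd number smaller than `n`, or `n` itself. -/
def IsBandwidth (n b : ℕ) : Prop := (Odd b ∧ b < n) ∨ b = n

/-- The index pair `(i, j)` is `b`-relevant, i.e. lies in the periodic band of width `b`. -/
def IsRelevant {n : ℕ} (b : ℕ) (i j : Fin n) : Prop :=
  b = n ∨ |(i : ℤ) - (j : ℤ)| ≤ ((b : ℤ) - 1) / 2 ∨
    (n : ℤ) - ((b : ℤ) - 1) / 2 ≤ |(i : ℤ) - (j : ℤ)|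

open Classical in
/-- The normalized periodic band matrix `b ^ (-1/2) a^b`, where `a^b` arises from `a` by setting
all entries that are not `b`-relevant to zero. -/
def periodicBandMatrix {n : ℕ} (b : ℕ) (a : Matrix (Fin n) (Fin n) ℝ) : Matrix (Fin n) (Fin n) ℝ :=
  Matrix.of fun i j => 1 / √(b : ℝ) * (if IsRelevant b i j then a i j else 0)

theorem filledMatrix_isHermitian {n : ℕ} {φ : Fin n × Fin n → Fin (triangleCard n)}
    (hφ : IsTriangleEnumeration φ) (y : EuclideanSpace ℝ (Fin (triangleCard n))) :
    (filledMatrix φ y).IsHermitian := by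
  ext i j
  simp only [filledMatrix, Matrix.conjTranspose_apply, Matrix.of_apply, star_trivial]
  rcases lt_trichotomy i j with h | h | h
  · rw [hφ.symm j i h]
  · rw [h]
  · rw [hφ.symm i j h]

theorem periodicBandMatrix_isHermitian {n : ℕ} (b : ℕ) {a : Matrix (Fin n) (Fin n) ℝ}
    (ha : a.IsHermitian) : (periodicBandMatrix b a).IsHermitian := by
  ext i j
  have h1 : a j i = a i j := by simpa using ha.apply i j
  have h2 : IsRelevant b j i ↔ IsRelevant b i j := by
    simp only [IsRelevant, abs_sub_comm (j : ℤ) (i : ℤ)]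
  simp only [periodicBandMatrix, Matrix.conjTranspose_apply, Matrix.of_apply, star_trivial, h1]
  by_cases h : IsRelevant b i j
  · rw [if_pos h, if_pos (h2.2 h)]
  · rw [if_neg h, if_neg (fun h' => h (h2.1 h'))]

/-- The empirical spectral distribution `n⁻¹ ∑ δ_{λ_i}` of a real symmetric `n × n` matrix, with
eigenvalues counted with multiplicity. -/
def empiricalSpectralDistribution {n : ℕ} {A : Matrix (Fin n) (Fin n) ℝ} (hA : A.IsHermitian) :
    Measure ℝ :=
  (n : ℝ≥0∞)⁻¹ • ∑ i, Measure.dirac (hA.eigenvalues i)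

/-- The semicircle distribution, with density `(2π)⁻¹ √(4 - x²)` on `[-2, 2]`. -/
def semicircleDistribution : Measure ℝ :=
  volume.withDensity fun x =>
    ENNReal.ofReal ((Set.Icc (-2 : ℝ) 2).indicator (fun x => 1 / (2 * Real.pi) * √(4 - x ^ 2)) x)

/-- The semicircle law in probability: the empirical spectral distributions of the random symmetric
matrices `X n` converge weakly in probability to the semicircle distribution. -/
def SemicircleLawInProbability {Ω : Type*} [MeasurableSpace Ω] (P : Measure Ω)
    {X : ∀ n : ℕ, Ω → Matrix (Fin n) (Fin n) ℝ} (hX : ∀ n ω, (X n ω).IsHermitian) : Prop :=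
  ∀ f : ℝ →ᵇ ℝ,
    TendstoInMeasure P (fun n ω => ∫ x, f x ∂(empiricalSpectralDistribution (hX n ω))) atTop
      (fun _ => ∫ x, f x ∂semicircleDistribution)

/-- The semicircle law almost surely: the empirical spectral distributions of the random symmetric
matrices `X n` converge weakly almost surely to the semicircle distribution. -/
def SemicircleLawAlmostSurely {Ω : Type*} [MeasurableSpace Ω] (P : Measure Ω)
    {X : ∀ n : ℕ, Ω → Matrix (Fin n) (Fin n) ℝ} (hX : ∀ n ω, (X n ω).IsHermitian) : Prop :=
  ∀ f : ℝ →ᵇ ℝ, ∀ᵐ ω ∂P,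
    Tendsto (fun n => ∫ x, f x ∂(empiricalSpectralDistribution (hX n ω))) atTop
      (𝓝 (∫ x, f x ∂semicircleDistribution))

end

/-! The proof is the method of moments, with Gaussian calculus on polynomials in place of path
counting. Let M be the band matrix, B the 0-1 matrix of its band, d = b_n the row sum of B, and n
the size. Entries are indexed by unordered pairs, and expectations are used only through
normalization, positivity and integration by parts (`IsGaussianFunctional`).

Suppose first that the covariance is I + ρ 11ᵀ with 0 ≤ ρ ≤ c/n. Integrating E tr M^(k+2) by parts
gives, for each p + q = k, a main term d⁻¹ ∑ B_ij E[(M^p)_jj (M^q)_ii], a transposed term of order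
n/d, and a correlation term (ρ/d) E tr(B M^p B M^q). The last is of order n/√d, because ∑ (B²)_ij² ≤
d³ n and ρ d ≤ c. Cyclic shifts preserve the band, so all diagonal entries of M^p have the same
mean; by the Gaussian Poincaré inequality (`IsGaussianFunctional.variance_le`) their variance is
O(1/√d), and the main term factorizes. The normalized moments therefore satisfy the Catalan
recursion of the semicircle moments up to O(1/√d) (`EquicorrelatedBand.abs_meanMoment_sub_le`).

For a general covariance with off-diagonal entries of modulus at most ρ, traces of powers have
nonnegative coefficients, and Wick's recursion shows that their expectations differ from the
independent case by no more than those of I + ρ 11ᵀ do (`IsGaussianFunctional.abs_sub_le`). Both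
comparison ensembles have the same limit. With ρ = Δ_n^(-α), of order n^(-2α), the condition ρ ≤ c/n
is supplied by α ≥ 1/2.

The Poincaré inequality for the true covariance bounds Var(tr M^k / n) by a constant times 1/(n d) +
ρ (`WeaklyCorrelatedBand.variance_trace_le`). This tends to 0 when α ≥ 1/2. It is summable when α >
1/2 and ∑ b_n⁻² < ∞, since n b_n ≥ b_n²; summing second moments needs no joint law for different n.
Finally `exists_moments_close` passes from finitely many moments to a bounded continuous test
function. -/

/-! ### Polynomials in Gaussian vectors -/

section GaussianFunctional

open MvPolynomial
open scoped MatrixOrder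

/-- A linear functional on polynomials that behaves as the expectation of a polynomial in a centred
Gaussian vector with covariance matrix `S`: it is normalized, nonnegative on nonnegative
polynomials, and satisfies Gaussian integration by parts. -/
structure IsGaussianFunctional {ι : Type*} [Fintype ι] (S : Matrix ι ι ℝ)
    (E : MvPolynomial ι ℝ →ₗ[ℝ] ℝ) : Prop where
  one : E 1 = 1
  ibp : ∀ k p, E (X k * p) = ∑ l, S k l * E (pderiv l p)
  nonneg : ∀ p, (∀ y, 0 ≤ eval y p) → 0 ≤ E p

theorem integrable_pow_gaussianReal (m : ℕ) :
    Integrable (fun x : ℝ => x ^ m) (gaussianReal 0 1) := by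
  rcases Nat.eq_zero_or_pos m with rfl | hm
  · simp
  · have h := (memLp_id_gaussianReal' (μ := 0) (v := 1) (m : ℝ≥0∞) (by simp)).integrable_norm_pow
      hm.ne'
    refine (integrable_norm_iff (by fun_prop)).1 ?_
    simpa [norm_pow] using h

theorem hasDerivAt_gaussianPDFReal (x : ℝ) :
    HasDerivAt (gaussianPDFReal 0 1) (-x * gaussianPDFReal 0 1 x) x := by
  have h : HasDerivAt (fun x : ℝ => (√(2 * Real.pi * (1 : NNReal)))⁻¹ *
      Real.exp (-(x - 0) ^ 2 / (2 * (1 : NNReal))))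
      ((√(2 * Real.pi * (1 : NNReal)))⁻¹ * (Real.exp (-(x - 0) ^ 2 / (2 * (1 : NNReal))) *
        (-x))) x := by
    refine HasDerivAt.const_mul _ (HasDerivAt.exp ?_)
    have := ((((hasDerivAt_id x).sub_const 0).pow 2).neg).div_const (2 * ((1 : NNReal) : ℝ))
    convert! this using 1
    simp
    ring
  have e : gaussianPDFReal 0 1 = fun x : ℝ => (√(2 * Real.pi * (1 : NNReal)))⁻¹ *
      Real.exp (-(x - 0) ^ 2 / (2 * (1 : NNReal))) := by
    rw [gaussianPDFReal_def]
  rw [e]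
  convert! h using 1
  ring

theorem integrable_pow_mul_gaussianPDFReal (m : ℕ) :
    Integrable (fun x : ℝ => x ^ m * gaussianPDFReal 0 1 x) := by
  have h := integrable_pow_gaussianReal m
  rw [gaussianReal_of_var_ne_zero _ one_ne_zero] at h
  have h2 := (integrable_withDensity_iff (measurable_gaussianPDF 0 1)
    (by simp [gaussianPDF])).1 h
  simpa [gaussianPDF, ENNReal.toReal_ofReal (gaussianPDFReal_nonneg 0 1 _)] using h2

/-- Integration by parts against the Gaussian density, whose derivative is `-x` times itself. At `m
= 0` the truncated exponent `m - 1` is harmless because of the factor `m`. -/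
theorem integral_pow_succ_gaussianReal (m : ℕ) :
    ∫ x, x ^ (m + 1) ∂gaussianReal 0 1 = m * ∫ x, x ^ (m - 1) ∂gaussianReal 0 1 := by
  simp_rw [integral_gaussianReal_eq_integral_smul (one_ne_zero : (1 : NNReal) ≠ 0), smul_eq_mul]
  have h := integral_mul_deriv_eq_deriv_mul_of_integrable
    (u := fun x : ℝ => x ^ m) (v := gaussianPDFReal 0 1) (u' := fun x => m * x ^ (m - 1))
    (v' := fun x => -x * gaussianPDFReal 0 1 x)
    (fun x _ => hasDerivAt_pow m x) (fun x _ => hasDerivAt_gaussianPDFReal x)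
    ?_ ?_ (integrable_pow_mul_gaussianPDFReal m)
  · have h1 : ∫ x : ℝ, gaussianPDFReal 0 1 x * x ^ (m + 1) =
        -∫ x : ℝ, x ^ m * (-x * gaussianPDFReal 0 1 x) := by
      rw [← integral_neg]
      congr 1
      ext x
      ring
    rw [h1, h, neg_neg, ← integral_const_mul]
    congr 1
    ext x
    ring
  · refine (integrable_pow_mul_gaussianPDFReal (m + 1)).neg.congr (Eventually.of_forall fun x => ?_)
    simp only [Pi.neg_apply, Pi.mul_apply]
    ring
  · refine ((integrable_pow_mul_gaussianPDFReal (m - 1)).const_mul m).congr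
      (Eventually.of_forall fun x => ?_)
    simp only [Pi.mul_apply]
    ring

variable {ι : Type*} [Fintype ι]

theorem eval_monomial_eq_prod (y : ι → ℝ) (m : ι →₀ ℕ) (a : ℝ) :
    eval y (monomial m a) = a * ∏ i, y i ^ m i := by
  rw [eval_monomial, Finsupp.prod_fintype _ _ (by simp)]

theorem integrable_eval_pi (p : MvPolynomial ι ℝ) :
    Integrable (fun g => eval g p) (Measure.pi fun _ : ι => gaussianReal 0 1) := by
  induction p using MvPolynomial.induction_on' with
  | monomial m a =>
    simp_rw [eval_monomial_eq_prod]
    exact (Integrable.fintype_prod (f := fun i x => x ^ m i)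
      fun i => integrable_pow_gaussianReal (m i)).const_mul a
  | add p q hp hq =>
    simp_rw [map_add]
    exact hp.add hq

theorem integral_monomial_pi (m : ι →₀ ℕ) (a : ℝ) :
    ∫ g, eval g (monomial m a) ∂(Measure.pi fun _ : ι => gaussianReal 0 1) =
      a * ∏ i, ∫ x, x ^ m i ∂gaussianReal 0 1 := by
  simp_rw [eval_monomial_eq_prod, integral_const_mul]
  congr 1
  exact integral_fintype_prod_eq_prod fun i (x : ℝ) => x ^ m i

theorem integral_X_mul_pi (k : ι) (p : MvPolynomial ι ℝ) :
    ∫ g, eval g (X k * p) ∂(Measure.pi fun _ : ι => gaussianReal 0 1) =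
      ∫ g, eval g (pderiv k p) ∂(Measure.pi fun _ : ι => gaussianReal 0 1) := by
  classical
  induction p using MvPolynomial.induction_on' with
  | monomial m a =>
    have h1 : X k * monomial m a = monomial (Finsupp.single k 1 + m) a := by
      rw [X, monomial_mul, one_mul]
    rw [h1, pderiv_monomial]
    rw [integral_monomial_pi, integral_monomial_pi,
      ← Finset.mul_prod_erase _ _ (Finset.mem_univ k),
      ← Finset.mul_prod_erase (a := k) (f := fun i => ∫ x, x ^ (m - Finsupp.single k 1 : ι →₀ ℕ) i
        ∂gaussianReal 0 1) _ (Finset.mem_univ k)]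
    have h2 : ∀ i ∈ Finset.univ.erase k, ∫ x, x ^ (Finsupp.single k 1 + m : ι →₀ ℕ) i ∂gaussianReal 0 1 =
        ∫ x, x ^ (m - Finsupp.single k 1 : ι →₀ ℕ) i ∂gaussianReal 0 1 := by
      intro i hi
      have : k ≠ i := (Finset.ne_of_mem_erase hi).symm
      simp [this]
    rw [Finset.prod_congr rfl h2]
    have h3 : ∫ x, x ^ (Finsupp.single k 1 + m : ι →₀ ℕ) k ∂gaussianReal 0 1 =
        m k * ∫ x, x ^ (m - Finsupp.single k 1 : ι →₀ ℕ) k ∂gaussianReal 0 1 := by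
      have := integral_pow_succ_gaussianReal (m k)
      simpa [add_comm] using this
    rw [h3]
    ring
  | add p q hp hq =>
    simp_rw [mul_add, map_add]
    rw [integral_add (integrable_eval_pi _) (integrable_eval_pi _),
      integral_add (integrable_eval_pi _) (integrable_eval_pi _), hp, hq]

/-- The chain rule, used to carry integration by parts from independent standard Gaussians through
the substitution `y = √S g`. -/
theorem pderiv_bind {κ : Type*} (f : ι → MvPolynomial κ ℝ) (j : κ) (p : MvPolynomial ι ℝ) :
    pderiv j (bind₁ f p) = ∑ l, bind₁ f (pderiv l p) * pderiv j (f l) := by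
  classical
  induction p using MvPolynomial.induction_on with
  | C a => simp
  | add p q hp hq => simp [hp, hq, add_mul, Finset.sum_add_distrib]
  | mul_X p i hp =>
    have h : ∑ l, bind₁ f ((Pi.single l 1 : ι → MvPolynomial ι ℝ) i) * pderiv j (f l) =
        pderiv j (f i) := by
      rw [Finset.sum_eq_single i]
      · simp
      · intro l _ hl
        rw [Pi.single_eq_of_ne hl.symm, map_zero, zero_mul]
      · simp
    have h2 : ∀ l, bind₁ f (pderiv l (p * X i)) * pderiv j (f l) =
        f i * (bind₁ f (pderiv l p) * pderiv j (f l)) +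
          bind₁ f p * (bind₁ f ((Pi.single l 1 : ι → MvPolynomial ι ℝ) i) * pderiv j (f l)) := by
      intro l
      rw [pderiv_mul, pderiv_X, map_add, map_mul, map_mul, bind₁_X_right]
      ring
    rw [Finset.sum_congr rfl fun l _ => h2 l, Finset.sum_add_distrib, ← Finset.mul_sum,
      ← Finset.mul_sum, h, map_mul, bind₁_X_right, pderiv_mul, hp]
    ring

theorem eval_mulVec (A : Matrix ι ι ℝ) (g : ι → ℝ) (p : MvPolynomial ι ℝ) :
    eval (A.mulVec g) p = eval g (bind₁ (fun i => ∑ j, C (A i j) * X j) p) := by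
  have h : eval g (bind₁ (fun i => ∑ j, C (A i j) * X j) p) =
      eval (fun i => eval g (∑ j, C (A i j) * X j)) p := by
    simp only [eval, eval₂Hom_bind₁]
  rw [h]
  congr 2
  ext i
  simp [Matrix.mulVec, dotProduct]

omit [Fintype ι] in
theorem measurable_eval (p : MvPolynomial ι ℝ) :
    Measurable fun y : EuclideanSpace ℝ ι => eval y.ofLp p := by
  induction p using MvPolynomial.induction_on with
  | C a => simp
  | add p q hp hq =>
    simp only [map_add]
    exact hp.add hq
  | mul_X p i hp =>
    simp only [map_mul, eval_X]
    exact hp.mul (by fun_prop)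

theorem measurable_toLp_mulVec (A : Matrix ι ι ℝ) :
    Measurable fun g : ι → ℝ => WithLp.toLp 2 (A.mulVec g) := by
  have : Continuous fun g : ι → ℝ => WithLp.toLp 2 (A.mulVec g) := by fun_prop
  exact this.measurable

variable [DecidableEq ι]

theorem multivariateGaussian_eq_map_pi (S : Matrix ι ι ℝ) :
    multivariateGaussian 0 S = (Measure.pi fun _ : ι => gaussianReal 0 1).map
      fun g => WithLp.toLp 2 ((CFC.sqrt S).mulVec g) := by
  rw [multivariateGaussian, ← map_pi_eq_stdGaussian, Measure.map_map (by fun_prop) (by fun_prop)]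
  congr 1
  ext g i
  simp

theorem integrable_eval_multivariateGaussian (S : Matrix ι ι ℝ) (p : MvPolynomial ι ℝ) :
    Integrable (fun y : EuclideanSpace ℝ ι => eval y.ofLp p) (multivariateGaussian 0 S) := by
  rw [multivariateGaussian_eq_map_pi, integrable_map_measure
    (measurable_eval p).aestronglyMeasurable (measurable_toLp_mulVec _).aemeasurable]
  simp only [Function.comp_def, eval_mulVec]
  exact integrable_eval_pi _

theorem integral_eval_multivariateGaussian (S : Matrix ι ι ℝ) (p : MvPolynomial ι ℝ) :
    ∫ y : EuclideanSpace ℝ ι, eval y.ofLp p ∂multivariateGaussian 0 S =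
      ∫ g, eval g (bind₁ (fun i => ∑ j, C (CFC.sqrt S i j) * X j) p)
        ∂(Measure.pi fun _ : ι => gaussianReal 0 1) := by
  rw [multivariateGaussian_eq_map_pi, integral_map (measurable_toLp_mulVec _).aemeasurable
    (measurable_eval p).aestronglyMeasurable]
  simp only [eval_mulVec]

/-- The expectation of a polynomial in a Gaussian vector with law `𝒩(0, S)`. -/
noncomputable def gaussianExpectation (S : Matrix ι ι ℝ) : MvPolynomial ι ℝ →ₗ[ℝ] ℝ where
  toFun p := ∫ y : EuclideanSpace ℝ ι, eval y.ofLp p ∂multivariateGaussian 0 S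
  map_add' p q := by
    simp_rw [map_add]
    exact integral_add (integrable_eval_multivariateGaussian S p)
      (integrable_eval_multivariateGaussian S q)
  map_smul' a p := by
    simp_rw [smul_eval, integral_const_mul]
    rfl

theorem gaussianExpectation_apply (S : Matrix ι ι ℝ) (p : MvPolynomial ι ℝ) :
    gaussianExpectation S p = ∫ y : EuclideanSpace ℝ ι, eval y.ofLp p ∂multivariateGaussian 0 S :=
  rfl

/-- Write the vector as `√S g` with `g` standard. Integrating by parts in `g` and applying the chain
rule produces `∑ j, √S k j * √S j l`, which is `S k l` since `√S` is symmetric with square `S`. No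
density is involved, so semidefinite `S` is allowed. -/
theorem isGaussianFunctional_gaussianExpectation {S : Matrix ι ι ℝ} (hS : S.PosSemidef) :
    IsGaussianFunctional S (gaussianExpectation S) where
  one := by simp [gaussianExpectation_apply]
  nonneg p hp := integral_nonneg fun y => hp _
  ibp k p := by
    have hA : CFC.sqrt S * CFC.sqrt S = S := CFC.sqrt_mul_sqrt_self S (Matrix.nonneg_iff_posSemidef.2 hS)
    have hsymm : ∀ i j, CFC.sqrt S i j = CFC.sqrt S j i := fun i j => by
      have h := (Matrix.nonneg_iff_posSemidef.1 (CFC.sqrt_nonneg S)).isHermitian.apply j i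
      simpa using h
    simp only [gaussianExpectation_apply, integral_eval_multivariateGaussian]
    generalize hf : (fun i => ∑ j, C (CFC.sqrt S i j) * X j : ι → MvPolynomial ι ℝ) = f
    have hfd : ∀ l j, pderiv j (f l) = C (CFC.sqrt S l j) := by
      intro l j
      rw [← hf]
      simp [pderiv_X, Pi.single_apply]
    have h1 : ∀ g, eval g (bind₁ f (X k * p)) =
        ∑ j, CFC.sqrt S k j * eval g (X j * bind₁ f p) := by
      intro g
      rw [← hf]
      simp [Finset.sum_mul, mul_assoc]
    simp_rw [h1]
    rw [integral_finsetSum _ fun j _ => (integrable_eval_pi _).const_mul _]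
    simp_rw [integral_const_mul, integral_X_mul_pi, pderiv_bind, hfd, map_sum, map_mul, eval_C]
    have h2 : ∀ j, ∫ g, ∑ l, eval g (bind₁ f (pderiv l p)) * CFC.sqrt S l j
          ∂(Measure.pi fun _ : ι => gaussianReal 0 1) =
        ∑ l, CFC.sqrt S j l * ∫ g, eval g (bind₁ f (pderiv l p))
          ∂(Measure.pi fun _ : ι => gaussianReal 0 1) := by
      intro j
      rw [integral_finsetSum _ fun l _ => (integrable_eval_pi _).mul_const _]
      refine Finset.sum_congr rfl fun l _ => ?_
      rw [integral_mul_const, mul_comm, hsymm l j]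
    simp_rw [h2, Finset.mul_sum]
    rw [Finset.sum_comm]
    refine Finset.sum_congr rfl fun l _ => ?_
    have h3 : S k l = ∑ j, CFC.sqrt S k j * CFC.sqrt S j l := by
      conv_lhs => rw [← hA]
      rw [Matrix.mul_apply]
    rw [h3, Finset.sum_mul]
    refine Finset.sum_congr rfl fun j _ => by ring

end GaussianFunctional

/-! ### Wick's recursion for moments; uniqueness and symmetries of Gaussian functionals. -/

section GaussianAlgebra

open MvPolynomial
open scoped MatrixOrder

variable {ι : Type*}

/-- Tailored to integration by parts: removing a factor `X k` leaves exponents `m - single l 1`.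
Truncated subtraction returns `m` itself if `l` does not occur in it, so the induction hypothesis
must include degree `m.degree`. -/
theorem monomial_degree_induction {Q : (ι →₀ ℕ) → Prop} (h0 : Q 0)
    (hs : ∀ k m, (∀ m', m'.degree ≤ m.degree → Q m') → Q (Finsupp.single k 1 + m)) (m : ι →₀ ℕ) :
    Q m := by
  classical
  suffices h : ∀ d (m : ι →₀ ℕ), m.degree ≤ d → Q m from h _ m le_rfl
  intro d
  induction d with
  | zero =>
    intro m hm
    rw [(Finsupp.degree_eq_zero_iff m).1 (Nat.le_zero.1 hm)]
    exact h0
  | succ d ih =>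
    intro m hm
    by_cases hm0 : m = 0
    · rw [hm0]
      exact h0
    obtain ⟨k, hk⟩ : ∃ k, m k ≠ 0 := by
      by_contra! h
      exact hm0 (Finsupp.ext h)
    have hle : Finsupp.single k 1 ≤ m := by
      rw [Finsupp.single_le_iff]
      omega
    have he : Finsupp.single k 1 + (m - Finsupp.single k 1) = m := add_tsub_cancel_of_le hle
    have hdeg : (m - Finsupp.single k 1).degree ≤ d := by
      have := congrArg Finsupp.degree he
      rw [map_add, Finsupp.degree_single] at this
      omega
    rw [← he]
    exact hs _ _ fun m' hm' => ih m' (hm'.trans hdeg)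

theorem degree_tsub_single_le (m : ι →₀ ℕ) (l : ι) :
    (m - Finsupp.single l 1).degree ≤ m.degree :=
  Finsupp.degree_mono tsub_le_self

theorem pderiv_commute (k l : ι) (p : MvPolynomial ι ℝ) :
    pderiv k (pderiv l p) = pderiv l (pderiv k p) := by
  classical
  have h : ⁅(pderiv k : Derivation ℝ (MvPolynomial ι ℝ) (MvPolynomial ι ℝ)),
      (pderiv l : Derivation ℝ (MvPolynomial ι ℝ) (MvPolynomial ι ℝ))⁆ = 0 := by
    refine derivation_ext fun i => ?_
    have h1 : ∀ a b : ι, pderiv a (pderiv b (X i : MvPolynomial ι ℝ)) = 0 := fun a b => by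
      rw [pderiv_X]
      rcases eq_or_ne i b with rfl | hb
      · rw [Pi.single_eq_same, pderiv_one]
      · rw [Pi.single_eq_of_ne hb, map_zero]
    rw [Derivation.commutator_apply, h1, h1, sub_zero, Derivation.coe_zero, Pi.zero_apply]
  have := congrArg (fun D => D p) h
  simpa [Derivation.commutator_apply, sub_eq_zero] using this

variable [Fintype ι] {S : Matrix ι ι ℝ} {E : MvPolynomial ι ℝ →ₗ[ℝ] ℝ}

namespace IsGaussianFunctional

theorem map_C (hE : IsGaussianFunctional S E) (a : ℝ) : E (C a) = a := by
  have : (C a : MvPolynomial ι ℝ) = a • 1 := by rw [smul_eq_C_mul, mul_one]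
  rw [this, map_smul, hE.one, smul_eq_mul, mul_one]

omit [Fintype ι] in
theorem map_C_mul (E : MvPolynomial ι ℝ →ₗ[ℝ] ℝ) (a : ℝ) (p : MvPolynomial ι ℝ) :
    E (C a * p) = a * E p := by
  rw [← smul_eq_C_mul, map_smul, smul_eq_mul]

theorem mono (hE : IsGaussianFunctional S E) {p q : MvPolynomial ι ℝ}
    (h : ∀ y, eval y p ≤ eval y q) : E p ≤ E q := by
  have := hE.nonneg (q - p) fun y => by simpa using h y
  rwa [map_sub, sub_nonneg] at this

theorem abs_le (hE : IsGaussianFunctional S E) {p q : MvPolynomial ι ℝ}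
    (h : ∀ y, |eval y p| ≤ eval y q) : |E p| ≤ E q := by
  rw [_root_.abs_le]
  constructor
  · rw [← map_neg]
    exact hE.mono fun y => by simpa using (_root_.abs_le.1 (h y)).1
  · exact hE.mono fun y => (_root_.abs_le.1 (h y)).2

/-- Wick's recursion. Wherever the coefficient `m l` is nonzero, the degree drops by two. -/
theorem monomial_single_add (hE : IsGaussianFunctional S E) (k : ι) (m : ι →₀ ℕ) :
    E (monomial (Finsupp.single k 1 + m) 1) =
      ∑ l, S k l * (m l * E (monomial (m - Finsupp.single l 1) 1)) := by
  have h1 : (monomial (Finsupp.single k 1 + m) 1 : MvPolynomial ι ℝ) = X k * monomial m 1 := by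
    rw [X, monomial_mul, one_mul]
  rw [h1, hE.ibp]
  refine Finset.sum_congr rfl fun l _ => ?_
  have h2 : (monomial (m - Finsupp.single l 1) (m l : ℝ) : MvPolynomial ι ℝ) =
      C (m l : ℝ) * monomial (m - Finsupp.single l 1) 1 := by
    rw [C_mul_monomial, mul_one]
  rw [pderiv_monomial, one_mul, h2, map_C_mul]

omit [Fintype ι] in
theorem apply_eq_sum (E : MvPolynomial ι ℝ →ₗ[ℝ] ℝ) (p : MvPolynomial ι ℝ) :
    E p = ∑ m ∈ p.support, p.coeff m * E (monomial m 1) := by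
  conv_lhs => rw [p.as_sum, map_sum]
  refine Finset.sum_congr rfl fun m _ => ?_
  rw [← map_C_mul, C_mul_monomial, mul_one]

/-- Wick's recursion computes every moment from `E 1 = 1`, so the covariance determines the
functional. This is how symmetries of the covariance become symmetries of expectations. -/
theorem unique {E' : MvPolynomial ι ℝ →ₗ[ℝ] ℝ} (hE : IsGaussianFunctional S E)
    (hE' : IsGaussianFunctional S E') : E = E' := by
  have h : ∀ m, E (monomial m 1) = E' (monomial m 1) := by
    refine monomial_degree_induction ?_ fun k m ih => ?_
    · change E 1 = E' 1
      rw [hE.one, hE'.one]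
    · rw [hE.monomial_single_add, hE'.monomial_single_add]
      refine Finset.sum_congr rfl fun l _ => ?_
      rw [ih _ (degree_tsub_single_le m l)]
  refine LinearMap.ext fun p => ?_
  rw [apply_eq_sum E, apply_eq_sum E']
  exact Finset.sum_congr rfl fun m _ => by rw [h]

theorem comp_rename {κ : Type*} [Fintype κ] (hE : IsGaussianFunctional S E) (e : κ ≃ ι) :
    IsGaussianFunctional (S.submatrix e e) (E ∘ₗ (rename e).toLinearMap) where
  one := by simp [hE.one]
  nonneg p hp := hE.nonneg _ fun y => by
    simpa [eval_rename] using hp (y ∘ e)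
  ibp k p := by
    simp only [LinearMap.comp_apply, AlgHom.toLinearMap_apply, map_mul, rename_X, hE.ibp,
      Matrix.submatrix_apply]
    rw [← e.sum_comp]
    refine Finset.sum_congr rfl fun l _ => ?_
    rw [pderiv_rename e.injective]

theorem apply_rename (hE : IsGaussianFunctional S E) (e : ι ≃ ι)
    (hS : ∀ i j, S (e i) (e j) = S i j) (p : MvPolynomial ι ℝ) : E (rename e p) = E p := by
  have h := hE.comp_rename e
  have hS' : S.submatrix e e = S := by
    ext i j
    exact hS i j
  rw [hS'] at h
  exact congrArg (fun F => F p) (h.unique hE)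

end IsGaussianFunctional

/-! ### Comparison of moments -/

/-- Polynomials all of whose coefficients are nonnegative. -/
def HasNonnegCoeffs {κ : Type*} (p : MvPolynomial κ ℝ) : Prop := ∀ m, 0 ≤ p.coeff m

namespace HasNonnegCoeffs

variable {p q : MvPolynomial ι ℝ}

omit [Fintype ι] in
theorem C {a : ℝ} (ha : 0 ≤ a) : HasNonnegCoeffs (C a : MvPolynomial ι ℝ) := fun m => by
  classical
  rw [coeff_C]
  split_ifs <;> simp [ha]

omit [Fintype ι] in
theorem X (i : ι) : HasNonnegCoeffs (X i : MvPolynomial ι ℝ) := fun m => by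
  classical
  rw [coeff_X]
  split_ifs <;> simp

omit [Fintype ι] in
theorem mul (hp : HasNonnegCoeffs p) (hq : HasNonnegCoeffs q) : HasNonnegCoeffs (p * q) :=
  fun m => by
    classical
    rw [coeff_mul]
    exact Finset.sum_nonneg fun x _ => mul_nonneg (hp _) (hq _)

omit [Fintype ι] in
theorem sum {κ : Type*} (s : Finset κ) {f : κ → MvPolynomial ι ℝ}
    (h : ∀ i ∈ s, HasNonnegCoeffs (f i)) : HasNonnegCoeffs (∑ i ∈ s, f i) := fun m => by
  rw [coeff_sum]
  exact Finset.sum_nonneg fun i hi => h i hi m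

omit [Fintype ι] in
theorem matrix_pow {V : Type*} [Fintype V] [DecidableEq V] {M : Matrix V V (MvPolynomial ι ℝ)}
    (hM : ∀ i j, HasNonnegCoeffs (M i j)) (k : ℕ) (i j : V) : HasNonnegCoeffs ((M ^ k) i j) := by
  induction k generalizing i j with
  | zero =>
    rw [pow_zero, Matrix.one_apply]
    split_ifs
    · exact C zero_le_one
    · intro m
      simp
  | succ k ih =>
    rw [pow_succ, Matrix.mul_apply]
    exact sum _ fun l _ => (ih i l).mul (hM l j)

end HasNonnegCoeffs

namespace IsGaussianFunctional

/-- Gaussian moments with nonnegative covariances dominate: replacing the covariance matrix `S`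
by the identity changes the expectation of a polynomial with nonnegative coefficients at most as
much as for a covariance matrix `T` that dominates `S` entrywise. -/
theorem abs_sub_le [DecidableEq ι] {T : Matrix ι ι ℝ} {E₀ E₁ : MvPolynomial ι ℝ →ₗ[ℝ] ℝ}
    (hE : IsGaussianFunctional S E) (hE₀ : IsGaussianFunctional 1 E₀)
    (hE₁ : IsGaussianFunctional T E₁) (hSd : ∀ i, S i i = 1) (hTd : ∀ i, 1 ≤ T i i)
    (hST : ∀ i j, i ≠ j → |S i j| ≤ T i j) {p : MvPolynomial ι ℝ} (hp : HasNonnegCoeffs p) :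
    |E p - E₀ p| ≤ E₁ p - E₀ p := by
  -- Nonnegativity of the independent moments has to be carried along: with the second claim it
  -- gives `|E| ≤ E₁` on monomials. Off the diagonal the independent term is absent and this
  -- suffices; on the diagonal the excess of `T k k` over 1 has the right sign.
  have h : ∀ m, 0 ≤ E₀ (monomial m 1) ∧
      |E (monomial m 1) - E₀ (monomial m 1)| ≤ E₁ (monomial m 1) - E₀ (monomial m 1) := by
    refine monomial_degree_induction ?_ fun k m ih => ?_
    · change 0 ≤ E₀ 1 ∧ |E 1 - E₀ 1| ≤ E₁ 1 - E₀ 1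
      rw [hE.one, hE₀.one, hE₁.one]
      simp
    · rw [hE.monomial_single_add, hE₀.monomial_single_add, hE₁.monomial_single_add]
      constructor
      · refine Finset.sum_nonneg fun l _ => ?_
        have := (ih _ (degree_tsub_single_le m l)).1
        rw [Matrix.one_apply]
        split_ifs <;> positivity
      · rw [← Finset.sum_sub_distrib, ← Finset.sum_sub_distrib]
        refine (Finset.abs_sum_le_sum_abs _ _).trans (Finset.sum_le_sum fun l _ => ?_)
        obtain ⟨i1, i2⟩ := ih _ (degree_tsub_single_le m l)
        generalize E (monomial (m - Finsupp.single l 1) 1) = x at *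
        generalize E₀ (monomial (m - Finsupp.single l 1) 1) = x₀ at *
        generalize E₁ (monomial (m - Finsupp.single l 1) 1) = x₁ at *
        have hm : (0 : ℝ) ≤ m l := Nat.cast_nonneg _
        have i3 := _root_.abs_le.1 i2
        by_cases hkl : k = l
        · subst hkl
          rw [hSd, Matrix.one_apply_eq, ← mul_sub, ← mul_sub, abs_mul, abs_mul, abs_one, one_mul,
            abs_of_nonneg hm, one_mul]
          have : (m k : ℝ) * |x - x₀| ≤ m k * (x₁ - x₀) := by gcongr
          have h2 : (m k : ℝ) * x₁ ≤ T k k * (m k * x₁) :=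
            le_mul_of_one_le_left (mul_nonneg hm (by linarith)) (hTd k)
          linarith
        · rw [Matrix.one_apply_ne hkl, zero_mul, sub_zero, sub_zero, abs_mul, abs_mul,
            abs_of_nonneg hm]
          have h1 : |x| ≤ x₁ := _root_.abs_le.2 ⟨by linarith, by linarith⟩
          have h2 := hST k l hkl
          have h3 : 0 ≤ T k l := (abs_nonneg _).trans h2
          gcongr
  rw [apply_eq_sum E, apply_eq_sum E₀, apply_eq_sum E₁, ← Finset.sum_sub_distrib,
    ← Finset.sum_sub_distrib]
  refine (Finset.abs_sum_le_sum_abs _ _).trans (Finset.sum_le_sum fun m _ => ?_)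
  rw [← mul_sub, ← mul_sub, abs_mul, abs_of_nonneg (hp m)]
  exact mul_le_mul_of_nonneg_left (h m).2 (hp m)

end IsGaussianFunctional

/-! ### The Poincaré inequality -/

/-- The negative generator of the Ornstein–Uhlenbeck semigroup with covariance matrix `S`, acting
on polynomials. -/
noncomputable def ornsteinUhlenbeck (S : Matrix ι ι ℝ) : MvPolynomial ι ℝ →ₗ[ℝ] MvPolynomial ι ℝ where
  toFun p := ∑ k, (X k * pderiv k p - ∑ l, C (S k l) * pderiv l (pderiv k p))
  map_add' p q := by
    rw [← Finset.sum_add_distrib]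
    refine Finset.sum_congr rfl fun k _ => ?_
    simp only [map_add, mul_add, Finset.sum_add_distrib]
    ring
  map_smul' a p := by
    simp only [Derivation.map_smul, RingHom.id_apply, Finset.smul_sum, smul_sub, mul_smul_comm]

theorem ornsteinUhlenbeck_apply (S : Matrix ι ι ℝ) (p : MvPolynomial ι ℝ) :
    ornsteinUhlenbeck S p = ∑ k, (X k * pderiv k p - ∑ l, C (S k l) * pderiv l (pderiv k p)) := rfl

/-- The commutator of a derivative with the generator is the derivative itself; this shift by one is
the spectral gap behind the Poincaré inequality. -/
theorem pderiv_ornsteinUhlenbeck (m : ι) (p : MvPolynomial ι ℝ) :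
    pderiv m (ornsteinUhlenbeck S p) = pderiv m p + ornsteinUhlenbeck S (pderiv m p) := by
  classical
  simp only [ornsteinUhlenbeck_apply, map_sum, map_sub, pderiv_mul, pderiv_C, zero_mul, zero_add]
  have h : ∑ k, pderiv m (X k : MvPolynomial ι ℝ) * pderiv k p = pderiv m p := by
    rw [Finset.sum_eq_single m]
    · simp
    · intro k _ hk
      rw [pderiv_X_of_ne hk, zero_mul]
    · simp
  rw [← h, ← Finset.sum_add_distrib]
  refine Finset.sum_congr rfl fun k _ => ?_
  rw [h, pderiv_commute m k p, add_sub_assoc]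
  congr 2
  refine Finset.sum_congr rfl fun l _ => ?_
  rw [pderiv_commute m l, pderiv_commute m k]

/-- On a monomial the first-order part is multiplication by the degree (Euler), while the
second-order part lowers the degree by two. The operator is thus triangular and can be inverted away
from constants. -/
theorem mem_range_ornsteinUhlenbeck_sup (p : MvPolynomial ι ℝ) :
    p ∈ LinearMap.range (ornsteinUhlenbeck S) ⊔ Submodule.span ℝ {1} := by
  have h : ∀ m, (monomial m 1 : MvPolynomial ι ℝ) ∈
      LinearMap.range (ornsteinUhlenbeck S) ⊔ Submodule.span ℝ {1} := by
    refine monomial_degree_induction ?_ fun k m ih => ?_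
    · exact Submodule.mem_sup_right (Submodule.mem_span_singleton_self _)
    · set s := Finsupp.single k 1 + m with hs
      have hdeg : s.degree = m.degree + 1 := by
        rw [hs, map_add, Finsupp.degree_single, add_comm]
      have h1 : ∀ j, X j * pderiv j (monomial s 1 : MvPolynomial ι ℝ) = (s j : ℝ) • monomial s 1 :=
        fun j => by
          rw [X_mul_pderiv_monomial, Nat.cast_smul_eq_nsmul]
      have h2 : ∑ j, X j * pderiv j (monomial s 1 : MvPolynomial ι ℝ) =
          (s.degree : ℝ) • monomial s 1 := by
        rw [Finset.sum_congr rfl fun j _ => h1 j, ← Finset.sum_smul, Finsupp.degree_eq_sum]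
        push_cast
        rfl
      have h3 : ∀ j l, C (S j l) * pderiv l (pderiv j (monomial s 1 : MvPolynomial ι ℝ)) ∈
          LinearMap.range (ornsteinUhlenbeck S) ⊔ Submodule.span ℝ {1} := by
        intro j l
        rw [pderiv_monomial, pderiv_monomial, C_mul_monomial]
        by_cases hj : s j = 0
        · simp [hj]
        have hd : (s - Finsupp.single j 1 - Finsupp.single l 1).degree ≤ m.degree := by
          refine (degree_tsub_single_le _ _).trans ?_
          have hle : Finsupp.single j 1 ≤ s := by
            rw [Finsupp.single_le_iff]
            omega
          have := congrArg Finsupp.degree (add_tsub_cancel_of_le hle)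
          rw [map_add, Finsupp.degree_single] at this
          omega
        have := Submodule.smul_mem _ (S j l * (1 * (s j : ℝ) * ((s - Finsupp.single j 1 : ι →₀ ℕ) l : ℕ)))
          (ih _ hd)
        rwa [smul_monomial, smul_eq_mul, mul_one] at this
      have h4 : (s.degree : ℝ) • (monomial s 1 : MvPolynomial ι ℝ) =
          ornsteinUhlenbeck S (monomial s 1) +
            ∑ j, ∑ l, C (S j l) * pderiv l (pderiv j (monomial s 1)) := by
        rw [ornsteinUhlenbeck_apply, Finset.sum_sub_distrib, h2]
        ring
      have h5 : (s.degree : ℝ) ≠ 0 := by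
        rw [hdeg]
        positivity
      rw [← inv_smul_smul₀ h5 (monomial s 1), h4]
      refine Submodule.smul_mem _ _ (Submodule.add_mem _ ?_ ?_)
      · exact Submodule.mem_sup_left (LinearMap.mem_range_self _ _)
      · exact Submodule.sum_mem _ fun j _ => Submodule.sum_mem _ fun l _ => h3 j l
  rw [p.as_sum]
  refine Submodule.sum_mem _ fun m _ => ?_
  have := Submodule.smul_mem _ (p.coeff m) (h m)
  rwa [smul_monomial, smul_eq_mul, mul_one] at this

theorem sum_mul_mul_nonneg (hS : S.PosSemidef) (f : ι → ℝ) :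
    0 ≤ ∑ k, ∑ l, S k l * (f l * f k) := by
  have := hS.dotProduct_mulVec_nonneg f
  simp only [Matrix.mulVec, dotProduct, Finset.mul_sum, star_trivial] at this
  refine this.trans_eq (Finset.sum_congr rfl fun k _ => Finset.sum_congr rfl fun l _ => by ring)

namespace IsGaussianFunctional

/-- Integrating the factor `X k` by parts cancels the second-order part and leaves the Dirichlet
form. -/
theorem mul_ornsteinUhlenbeck (hE : IsGaussianFunctional S E) (q p : MvPolynomial ι ℝ) :
    E (q * ornsteinUhlenbeck S p) = ∑ k, ∑ l, S k l * E (pderiv l q * pderiv k p) := by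
  rw [ornsteinUhlenbeck_apply, Finset.mul_sum, map_sum]
  refine Finset.sum_congr rfl fun k _ => ?_
  have h1 : q * (X k * pderiv k p - ∑ l, C (S k l) * pderiv l (pderiv k p)) =
      X k * (q * pderiv k p) - ∑ l, C (S k l) * (q * pderiv l (pderiv k p)) := by
    rw [mul_sub, Finset.mul_sum]
    congr 1
    · ring
    · exact Finset.sum_congr rfl fun l _ => by ring
  rw [h1, map_sub, hE.ibp, map_sum, ← Finset.sum_sub_distrib]
  refine Finset.sum_congr rfl fun l _ => ?_
  rw [map_C_mul, pderiv_mul, map_add]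
  ring

theorem mul_ornsteinUhlenbeck_self_nonneg (hS : S.PosSemidef) (hE : IsGaussianFunctional S E)
    (p : MvPolynomial ι ℝ) : 0 ≤ E (p * ornsteinUhlenbeck S p) := by
  rw [hE.mul_ornsteinUhlenbeck]
  have h : ∑ k, ∑ l, S k l * E (pderiv l p * pderiv k p) =
      E (∑ k, ∑ l, C (S k l) * (pderiv l p * pderiv k p)) := by
    simp only [map_sum, map_C_mul]
  rw [h]
  refine hE.nonneg _ fun y => ?_
  simpa using sum_mul_mul_nonneg hS fun k => eval y (pderiv k p)

theorem mul_ornsteinUhlenbeck_comm (hS : S.PosSemidef) (hE : IsGaussianFunctional S E)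
    (p q : MvPolynomial ι ℝ) : E (p * ornsteinUhlenbeck S q) = E (q * ornsteinUhlenbeck S p) := by
  rw [hE.mul_ornsteinUhlenbeck, hE.mul_ornsteinUhlenbeck, Finset.sum_comm]
  refine Finset.sum_congr rfl fun k _ => Finset.sum_congr rfl fun l _ => ?_
  have h : S l k = S k l := by simpa using hS.isHermitian.apply k l
  rw [h, mul_comm (pderiv k p)]

/-- The Bakry–Émery argument: commuting derivatives past the generator gives the left side plus a
remainder. With `S = Aᵀ A` the remainder is a sum over `r` of Dirichlet energies of `∑ k, A r k * ∂ₖ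
q`, hence nonnegative. -/
theorem mul_ornsteinUhlenbeck_le (hS : S.PosSemidef) (hE : IsGaussianFunctional S E)
    (q : MvPolynomial ι ℝ) :
    E (q * ornsteinUhlenbeck S q) ≤ E (ornsteinUhlenbeck S q * ornsteinUhlenbeck S q) := by
  classical
  obtain ⟨A, hA⟩ := CStarAlgebra.nonneg_iff_eq_star_mul_self.1 hS.nonneg
  have hSA : ∀ k l, S k l = ∑ r, A r k * A r l := fun k l => by
    rw [hA, Matrix.star_eq_conjTranspose, Matrix.mul_apply]
    simp
  rw [hE.mul_ornsteinUhlenbeck (ornsteinUhlenbeck S q), hE.mul_ornsteinUhlenbeck q]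
  simp_rw [pderiv_ornsteinUhlenbeck, add_mul, map_add, mul_add, Finset.sum_add_distrib]
  rw [le_add_iff_nonneg_right]
  have h : ∑ k, ∑ l, S k l * E (ornsteinUhlenbeck S (pderiv l q) * pderiv k q) =
      ∑ r, E ((∑ k, C (A r k) * pderiv k q) *
        ornsteinUhlenbeck S (∑ l, C (A r l) * pderiv l q)) := by
    have h1 : ∀ r, E ((∑ k, C (A r k) * pderiv k q) *
        ornsteinUhlenbeck S (∑ l, C (A r l) * pderiv l q)) =
        ∑ k, ∑ l, A r k * A r l * E (ornsteinUhlenbeck S (pderiv l q) * pderiv k q) := by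
      intro r
      simp_rw [← smul_eq_C_mul, map_sum, map_smul, Finset.sum_mul_sum, map_sum,
        smul_mul_smul_comm, map_smul, smul_eq_mul]
      refine Finset.sum_congr rfl fun k _ => Finset.sum_congr rfl fun l _ => ?_
      rw [mul_comm (pderiv k q)]
    simp_rw [h1, hSA, Finset.sum_mul]
    rw [Finset.sum_comm]
    refine (Finset.sum_congr rfl fun k _ => Finset.sum_comm).trans ?_
    rw [Finset.sum_comm]
    refine Finset.sum_congr rfl fun r _ => Finset.sum_comm
  rw [h]
  exact Finset.sum_nonneg fun r _ => hE.mul_ornsteinUhlenbeck_self_nonneg hS _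

/-- The **Gaussian Poincaré inequality** for polynomials. -/
theorem variance_le (hS : S.PosSemidef) (hE : IsGaussianFunctional S E) (p : MvPolynomial ι ℝ) :
    E (p ^ 2) - E p ^ 2 ≤ ∑ k, ∑ l, S k l * E (pderiv l p * pderiv k p) := by
  -- Solve the Poisson equation: up to a constant, `p` is the generator applied to `q`.
  obtain ⟨_, ⟨q, rfl⟩, c, hc, rfl⟩ := Submodule.mem_sup.1 (mem_range_ornsteinUhlenbeck_sup (S := S) p)
  obtain ⟨a, rfl⟩ := Submodule.mem_span_singleton.1 hc
  set r := ornsteinUhlenbeck S q with hr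
  have h0 : E r = 0 := by
    have := hE.mul_ornsteinUhlenbeck 1 q
    rw [one_mul] at this
    rw [hr, this]
    simp
  have hd : ∀ k, pderiv k (r + a • 1) = pderiv k r := fun k => by
    rw [map_add, Derivation.map_smul, pderiv_one, smul_zero, add_zero]
  have h1 : E ((r + a • 1) ^ 2) - E (r + a • 1) ^ 2 = E (r * r) := by
    have : (r + a • 1) ^ 2 = r * r + (2 * a) • r + (a ^ 2) • 1 := by
      simp only [smul_eq_C_mul, map_mul, map_pow, map_ofNat]
      ring
    rw [this]
    simp only [map_add, map_smul, h0, hE.one, smul_eq_mul]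
    ring
  rw [h1]
  simp_rw [hd]
  rw [← hE.mul_ornsteinUhlenbeck r r]
  -- With `L` the generator, positivity at `r - q` reads `E(r L r) ≥ 2 E(r²) - E(q r)`, and `h3`
  -- below is `E(q r) ≤ E(r²)`.
  have h2 := hE.mul_ornsteinUhlenbeck_self_nonneg hS (r - q)
  rw [map_sub, mul_sub, sub_mul, sub_mul, map_sub, map_sub, map_sub,
    hE.mul_ornsteinUhlenbeck_comm hS q r, ← hr] at h2
  have h3 := hE.mul_ornsteinUhlenbeck_le hS q
  rw [← hr] at h3
  linarith

end IsGaussianFunctional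

end GaussianAlgebra

/-! ### Inequalities for powers of real symmetric matrices -/

section SymmetricMatrices

open Matrix

variable {V : Type*} [Fintype V] [DecidableEq V] {M B : Matrix V V ℝ}

/-- A single `U` serves all powers, so that different powers can be compared eigenvalue by
eigenvalue. -/
theorem exists_pow_eq_diagonal (hM : M.IsHermitian) :
    ∃ U : Matrix V V ℝ, Uᵀ * U = 1 ∧ U * Uᵀ = 1 ∧
      ∀ k, M ^ k = U * diagonal (fun r => hM.eigenvalues r ^ k) * Uᵀ := by
  set U : Matrix V V ℝ := hM.eigenvectorUnitary.1 with hU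
  have h1 : Uᵀ * U = 1 := by
    have := Unitary.coe_star_mul_self hM.eigenvectorUnitary
    rwa [star_eq_conjTranspose, conjTranspose_eq_transpose_of_trivial] at this
  have h2 : U * Uᵀ = 1 := mul_eq_one_comm.1 h1
  refine ⟨U, h1, h2, fun k => ?_⟩
  induction k with
  | zero => simp [h2]
  | succ k ih =>
    have h3 : M = U * diagonal hM.eigenvalues * Uᵀ := by
      have := hM.spectral_theorem
      rw [Unitary.conjStarAlgAut_apply, star_eq_conjTranspose,
        conjTranspose_eq_transpose_of_trivial] at this
      exact this
    generalize hM.eigenvalues = ev at *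
    calc M ^ (k + 1) = U * diagonal (fun r => ev r ^ k) * Uᵀ * (U * diagonal ev * Uᵀ) := by
          rw [pow_succ, ih, ← h3]
      _ = U * (diagonal (fun r => ev r ^ k) * (Uᵀ * U) * diagonal ev) * Uᵀ := by
          simp only [Matrix.mul_assoc]
      _ = _ := by
          rw [h1, Matrix.mul_one, diagonal_mul_diagonal]
          simp_rw [← pow_succ]

theorem trace_pow_eq_sum (hM : M.IsHermitian) (k : ℕ) :
    (M ^ k).trace = ∑ r, hM.eigenvalues r ^ k := by
  obtain ⟨U, h1, -, h3⟩ := exists_pow_eq_diagonal hM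
  rw [h3, trace_mul_comm, ← Matrix.mul_assoc, h1, Matrix.one_mul, trace_diagonal]

theorem abs_pow_mul_abs_pow_le {a c k : ℕ} (hk : a + c = k) (he : Even k) (x y : ℝ) :
    |x| ^ a * |y| ^ c ≤ x ^ k + y ^ k := by
  have hx := he.pow_nonneg x
  have hy := he.pow_nonneg y
  rw [← he.pow_abs x, ← he.pow_abs y] at *
  rcases le_total |x| |y| with h | h
  · calc |x| ^ a * |y| ^ c ≤ |y| ^ a * |y| ^ c := by gcongr
      _ = |y| ^ k := by rw [← pow_add, hk]
      _ ≤ _ := by linarith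
  · calc |x| ^ a * |y| ^ c ≤ |x| ^ a * |x| ^ c := by gcongr
      _ = |x| ^ k := by rw [← pow_add, hk]
      _ ≤ _ := by linarith

/-- Each entry is dominated by an absolute spectral moment for the weights `w r = U i r ^ 2 + U j r
^ 2`, of total mass 2. Splitting `|x| ^ a * |y| ^ c ≤ x ^ k + y ^ k` gives two terms, each with this
mass as a factor: hence the constant 4. -/
theorem abs_pow_apply_mul_pow_apply_le (hM : M.IsHermitian) {a c k : ℕ} (hk : a + c = k)
    (he : Even k) {i j p q u v : V} (hp : p = i ∨ p = j) (hq : q = i ∨ q = j) (hu : u = i ∨ u = j)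
    (hv : v = i ∨ v = j) :
    |(M ^ a) p q * (M ^ c) u v| ≤ 4 * ((M ^ k) i i + (M ^ k) j j) := by
  obtain ⟨U, -, h2, h3⟩ := exists_pow_eq_diagonal hM
  set ev := hM.eigenvalues
  have hpow : ∀ b x y, (M ^ b) x y = ∑ r, U x r * U y r * ev r ^ b := by
    intro b x y
    rw [h3, mul_apply]
    refine Finset.sum_congr rfl fun r _ => ?_
    rw [mul_diagonal, transpose_apply]
    ring
  set w : V → ℝ := fun r => U i r ^ 2 + U j r ^ 2 with hw
  have hw0 : ∀ r, 0 ≤ w r := fun r => by positivity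
  have hw1 : ∑ r, w r = 2 := by
    have h := fun x => congrFun (congrFun h2 x) x
    simp only [mul_apply, transpose_apply, one_apply_eq] at h
    simp only [hw, Finset.sum_add_distrib, pow_two, h]
    norm_num
  have hwk : ∑ r, w r * ev r ^ k = (M ^ k) i i + (M ^ k) j j := by
    rw [hpow, hpow, ← Finset.sum_add_distrib]
    exact Finset.sum_congr rfl fun r _ => by ring
  have hb : ∀ b x y, (x = i ∨ x = j) → (y = i ∨ y = j) →
      |(M ^ b) x y| ≤ ∑ r, w r * |ev r| ^ b := by
    intro b x y hx hy
    rw [hpow]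
    refine (Finset.abs_sum_le_sum_abs _ _).trans (Finset.sum_le_sum fun r _ => ?_)
    rw [abs_mul, abs_pow]
    refine mul_le_mul_of_nonneg_right ?_ (by positivity)
    have key : ∀ z, (z = i ∨ z = j) → U z r ^ 2 ≤ w r := by
      intro z hz
      simp only [hw]
      rcases hz with h | h <;> rw [h] <;> nlinarith [sq_nonneg (U i r), sq_nonneg (U j r)]
    have hx' := key x hx
    have hy' := key y hy
    rw [abs_le]
    constructor <;> nlinarith [sq_nonneg (U x r - U y r), sq_nonneg (U x r + U y r)]
  calc |(M ^ a) p q * (M ^ c) u v| ≤ (∑ r, w r * |ev r| ^ a) * ∑ s, w s * |ev s| ^ c := by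
        rw [abs_mul]
        exact mul_le_mul (hb _ _ _ hp hq) (hb _ _ _ hu hv) (abs_nonneg _)
          ((abs_nonneg _).trans (hb _ _ _ hp hq))
    _ ≤ ∑ r, ∑ s, (w r * ev r ^ k * w s + w r * (w s * ev s ^ k)) := by
        rw [Finset.sum_mul_sum]
        refine Finset.sum_le_sum fun r _ => Finset.sum_le_sum fun s _ => ?_
        have := mul_le_mul_of_nonneg_left (abs_pow_mul_abs_pow_le hk he (ev r) (ev s))
          (mul_nonneg (hw0 r) (hw0 s))
        linarith
    _ = 4 * ((M ^ k) i i + (M ^ k) j j) := by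
        simp only [Finset.sum_add_distrib, ← Finset.mul_sum, ← Finset.sum_mul, hw1, hwk]
        ring

theorem pow_apply_comm (hM : M.IsHermitian) (a : ℕ) (i j : V) : (M ^ a) i j = (M ^ a) j i := by
  simpa using (hM.pow a).apply j i

theorem pow_two_mul_apply_self (hM : M.IsHermitian) (a : ℕ) (i : V) :
    (M ^ (2 * a)) i i = ∑ j, (M ^ a) i j ^ 2 := by
  rw [two_mul, pow_add, mul_apply]
  exact Finset.sum_congr rfl fun j _ => by rw [pow_apply_comm hM a j i, pow_two]

theorem pow_two_mul_apply_self_nonneg (hM : M.IsHermitian) (a : ℕ) (i : V) :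
    0 ≤ (M ^ (2 * a)) i i := by
  rw [pow_two_mul_apply_self hM]
  positivity

theorem sq_pow_apply_self_le (hM : M.IsHermitian) (a : ℕ) (i : V) :
    (M ^ a) i i ^ 2 ≤ (M ^ (2 * a)) i i := by
  rw [pow_two_mul_apply_self hM]
  exact Finset.single_le_sum (f := fun j => (M ^ a) i j ^ 2) (fun j _ => sq_nonneg _)
    (Finset.mem_univ i)

theorem sum_abs_pow_apply_mul_pow_apply_le (hM : M.IsHermitian) (a c : ℕ) (i : V) :
    ∑ j, |(M ^ a) j i * (M ^ c) j i| ≤ (M ^ (2 * a)) i i + (M ^ (2 * c)) i i := by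
  rw [pow_two_mul_apply_self hM, pow_two_mul_apply_self hM, ← Finset.sum_add_distrib]
  refine Finset.sum_le_sum fun j _ => ?_
  rw [pow_apply_comm hM a i j, pow_apply_comm hM c i j, abs_le]
  constructor <;>
  nlinarith [sq_nonneg ((M ^ a) j i + (M ^ c) j i), sq_nonneg ((M ^ a) j i - (M ^ c) j i),
    sq_nonneg ((M ^ a) j i), sq_nonneg ((M ^ c) j i)]

theorem trace_mul_self_mul_pow (hM : M.IsHermitian) (hB : B.IsHermitian) (a : ℕ) :
    (B * B * M ^ (2 * a)).trace = ∑ i, ∑ j, (B * M ^ a) i j ^ 2 := by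
  have h : (B * B * M ^ (2 * a)).trace = ((B * M ^ a) * (B * M ^ a)ᵀ).trace := by
    have h1 : (B * M ^ a)ᵀ = M ^ a * B := by
      rw [transpose_mul]
      congr 1
      ext i j
      exact pow_apply_comm hM a j i
    rw [h1, two_mul, pow_add, Matrix.mul_assoc, trace_mul_comm]
    simp only [Matrix.mul_assoc]
  rw [h]
  simp only [trace, diag_apply, mul_apply (M := B * M ^ a), transpose_apply, pow_two]

/-- In an eigenbasis of `M` both traces are sums over pairs of eigenvalues with the same weights `D
r s ^ 2`, where `D = Uᵀ B U`. The two terms of the scalar inequality contribute equally because `D`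
is symmetric. -/
theorem trace_mul_pow_mul_pow_le (hM : M.IsHermitian) (hB : B.IsHermitian) {a c k : ℕ}
    (hk : a + c = k) (he : Even k) :
    |(B * M ^ a * B * M ^ c).trace| ≤ 2 * (B * B * M ^ k).trace := by
  obtain ⟨U, h1, h2, h3⟩ := exists_pow_eq_diagonal hM
  set ev := hM.eigenvalues
  set D := Uᵀ * B * U with hD
  have hDs : ∀ r s, D s r = D r s := by
    intro r s
    have : Dᵀ = D := by
      have hBt : Bᵀ = B := by simpa using hB.eq
      rw [hD, transpose_mul, transpose_mul, transpose_transpose, hBt, Matrix.mul_assoc]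
    exact congrFun (congrFun this r) s
  have hgen : ∀ f g : V → ℝ, (B * (U * diagonal f * Uᵀ) * B * (U * diagonal g * Uᵀ)).trace =
      ∑ r, ∑ s, D r s ^ 2 * (f s * g r) := by
    intro f g
    have : (B * (U * diagonal f * Uᵀ) * B * (U * diagonal g * Uᵀ)).trace =
        ((D * diagonal f) * (D * diagonal g)).trace := by
      have e1 : B * (U * diagonal f * Uᵀ) * B * (U * diagonal g * Uᵀ) =
          (B * (U * diagonal f * Uᵀ) * B * (U * diagonal g)) * Uᵀ := by
        simp only [Matrix.mul_assoc]
      rw [e1, trace_mul_comm]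
      simp only [hD, Matrix.mul_assoc]
    rw [this, trace]
    refine Finset.sum_congr rfl fun r _ => ?_
    rw [diag_apply, mul_apply]
    refine Finset.sum_congr rfl fun s _ => ?_
    rw [mul_diagonal, mul_diagonal, hDs r s]
    ring
  have hk' : (B * B * M ^ k).trace = ∑ r, ∑ s, D r s ^ 2 * ev r ^ k := by
    have := hgen (fun _ => 1) (fun r => ev r ^ k)
    rw [← h3] at this
    have h4 : U * diagonal (fun _ => (1 : ℝ)) * Uᵀ = 1 := by
      rw [diagonal_one, Matrix.mul_one, h2]
    rw [h4, Matrix.mul_one] at this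
    rw [this]
    simp only [one_mul]
  have hk'' : (B * B * M ^ k).trace = ∑ r, ∑ s, D r s ^ 2 * ev s ^ k := by
    rw [hk', Finset.sum_comm]
    exact Finset.sum_congr rfl fun s _ => Finset.sum_congr rfl fun r _ => by rw [hDs]
  rw [h3 a, h3 c, hgen, two_mul]
  nth_rw 1 [hk']
  rw [hk'', ← Finset.sum_add_distrib]
  refine (Finset.abs_sum_le_sum_abs _ _).trans (Finset.sum_le_sum fun r _ => ?_)
  rw [← Finset.sum_add_distrib]
  refine (Finset.abs_sum_le_sum_abs _ _).trans (Finset.sum_le_sum fun s _ => ?_)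
  rw [abs_mul, abs_of_nonneg (sq_nonneg _), ← mul_add, abs_mul, abs_pow, abs_pow]
  refine mul_le_mul_of_nonneg_left ?_ (sq_nonneg _)
  rw [add_comm (ev r ^ k)]
  exact abs_pow_mul_abs_pow_le hk he _ _

/-- A symmetric `0`-`1` matrix with all row sums equal to `d`. -/
structure IsRegularAdjacency (B : Matrix V V ℝ) (d : ℕ) : Prop where
  symm : B.IsHermitian
  zero_or_one : ∀ i j, B i j = 0 ∨ B i j = 1
  row_sum : ∀ i, ∑ j, B i j = d

namespace IsRegularAdjacency

variable {d : ℕ}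

omit [DecidableEq V] in
theorem sq (hB : IsRegularAdjacency B d) (i j : V) : B i j ^ 2 = B i j := by
  rcases hB.zero_or_one i j with h | h <;> simp [h]

omit [DecidableEq V] in
theorem nonneg (hB : IsRegularAdjacency B d) (i j : V) : 0 ≤ B i j := by
  rcases hB.zero_or_one i j with h | h <;> simp [h]

omit [DecidableEq V] in
theorem le_one (hB : IsRegularAdjacency B d) (i j : V) : B i j ≤ 1 := by
  rcases hB.zero_or_one i j with h | h <;> simp [h]

omit [DecidableEq V] in
theorem apply_comm (hB : IsRegularAdjacency B d) (i j : V) : B i j = B j i := by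
  simpa using hB.symm.apply j i

omit [DecidableEq V] in
theorem le_card (hB : IsRegularAdjacency B d) (i : V) : (d : ℝ) ≤ Fintype.card V := by
  rw [← hB.row_sum i]
  refine (Finset.sum_le_sum fun j _ => hB.le_one i j).trans ?_
  simp

/-- Cauchy–Schwarz along the rows of `B`: the operator norm of `B` is at most `d`. This serves only
for the a priori moment bounds. -/
theorem trace_mul_self_mul_pow_le (hB : IsRegularAdjacency B d) (hM : M.IsHermitian) (a : ℕ) :
    (B * B * M ^ (2 * a)).trace ≤ d ^ 2 * (M ^ (2 * a)).trace := by
  rw [trace_mul_self_mul_pow hM hB.symm, Finset.sum_comm, trace, Finset.mul_sum]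
  refine Finset.sum_le_sum fun j _ => ?_
  have h1 : ∀ i, (B * M ^ a) i j ^ 2 ≤ d * ∑ l, B i l * (M ^ a) l j ^ 2 := by
    intro i
    have := Finset.sum_mul_sq_le_sq_mul_sq Finset.univ (fun l => B i l)
      (fun l => B i l * (M ^ a) l j)
    simp only [← mul_assoc, ← pow_two, mul_pow, hB.sq, hB.row_sum] at this
    rw [mul_apply]
    exact this
  refine (Finset.sum_le_sum fun i _ => h1 i).trans ?_
  rw [← Finset.mul_sum, Finset.sum_comm]
  simp_rw [← Finset.sum_mul, fun i l => hB.apply_comm i l, hB.row_sum]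
  rw [diag_apply, pow_two_mul_apply_self hM, ← Finset.mul_sum, ← mul_assoc, pow_two]
  simp_rw [pow_apply_comm hM a _ j]
  exact le_rfl

-- The entries of `B * B` are at most `d`, and its row sums are `d ^ 2`.
omit [DecidableEq V] in
theorem sum_sq_mul_self_le (hB : IsRegularAdjacency B d) :
    ∑ i, ∑ j, (B * B) i j ^ 2 ≤ d ^ 3 * Fintype.card V := by
  have h1 : ∀ i j, (B * B) i j ^ 2 ≤ d * (B * B) i j := by
    intro i j
    have h0 : 0 ≤ (B * B) i j := by
      rw [mul_apply]
      exact Finset.sum_nonneg fun l _ => mul_nonneg (hB.nonneg _ _) (hB.nonneg _ _)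
    have h2 : (B * B) i j ≤ d := by
      rw [mul_apply, ← hB.row_sum i]
      exact Finset.sum_le_sum fun l _ => mul_le_of_le_one_right (hB.nonneg _ _) (hB.le_one _ _)
    rw [pow_two]
    exact mul_le_mul_of_nonneg_right h2 h0
  have h3 : ∀ i, ∑ j, (B * B) i j = d ^ 2 := by
    intro i
    simp_rw [mul_apply]
    rw [Finset.sum_comm]
    simp_rw [← Finset.mul_sum, hB.row_sum, ← Finset.sum_mul, hB.row_sum]
    ring
  calc ∑ i, ∑ j, (B * B) i j ^ 2 ≤ ∑ i, ∑ j, d * (B * B) i j :=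
        Finset.sum_le_sum fun i _ => Finset.sum_le_sum fun j _ => h1 i j
    _ = _ := by
        simp_rw [← Finset.mul_sum, h3]
        simp
        ring

/-- A Hilbert–Schmidt pairing of `B * B` with `M ^ (2 * a)`. Compared with the operator norm bound
it gains a factor `√d` at the price of doubling the power of `M`. This gain makes the correlation
term negligible even when `ρ` is of order `1 / |V|`. -/
theorem trace_mul_self_mul_pow_le_sqrt (hB : IsRegularAdjacency B d) (hd : 0 < d)
    (hM : M.IsHermitian) (a : ℕ) :
    (B * B * M ^ (2 * a)).trace ≤ d * √d * (Fintype.card V + (M ^ (4 * a)).trace) := by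
  have hs : (0 : ℝ) < d * √d := by positivity
  have h1 : (B * B * M ^ (2 * a)).trace = ∑ i, ∑ j, (B * B) i j * (M ^ (2 * a)) i j := by
    rw [trace]
    refine Finset.sum_congr rfl fun i _ => ?_
    rw [diag_apply, mul_apply]
    exact Finset.sum_congr rfl fun j _ => by rw [pow_apply_comm hM]
  have h2 : (M ^ (4 * a)).trace = ∑ i, ∑ j, (M ^ (2 * a)) i j ^ 2 := by
    rw [trace]
    refine Finset.sum_congr rfl fun i _ => ?_
    rw [diag_apply, ← pow_two_mul_apply_self hM, ← mul_assoc]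
    norm_num
  have hss : (d * √d) * (d * √d) = (d : ℝ) ^ 3 := by
    have := Real.mul_self_sqrt (Nat.cast_nonneg (α := ℝ) d)
    calc (d * √d) * (d * √d) = (d : ℝ) ^ 2 * (√d * √d) := by ring
      _ = _ := by rw [this]; ring
  have h3 : ∀ x y : ℝ, d * √d * (x * y) ≤ x ^ 2 + d ^ 3 * y ^ 2 := by
    intro x y
    rw [← hss]
    nlinarith [sq_nonneg (x - d * √d * y), sq_nonneg x, sq_nonneg (d * √d * y)]
  refine le_of_mul_le_mul_left ?_ hs
  rw [h1, ← mul_assoc, hss, mul_add, h2]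
  calc d * √d * ∑ i, ∑ j, (B * B) i j * (M ^ (2 * a)) i j ≤
        ∑ i, ∑ j, ((B * B) i j ^ 2 + d ^ 3 * (M ^ (2 * a)) i j ^ 2) := by
        simp_rw [Finset.mul_sum]
        exact Finset.sum_le_sum fun i _ => Finset.sum_le_sum fun j _ => h3 _ _
    _ ≤ _ := by
        simp_rw [Finset.sum_add_distrib, ← Finset.mul_sum]
        gcongr
        exact hB.sum_sq_mul_self_le

theorem abs_trace_mul_pow_mul_pow_le (hB : IsRegularAdjacency B d) (hd : 0 < d)
    (hM : M.IsHermitian) (p q : ℕ) :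
    |(B * M ^ p * B * M ^ q).trace| ≤
      d * √d * (2 * Fintype.card V + (M ^ (4 * p)).trace + (M ^ (4 * q)).trace) := by
  have h1 : (B * M ^ p * B * M ^ q).trace = ∑ i, ∑ j, (B * M ^ p) i j * (B * M ^ q) j i := by
    rw [Matrix.mul_assoc (B * M ^ p), trace]
    exact Finset.sum_congr rfl fun i _ => by rw [diag_apply, mul_apply]
  have h2 : |(B * M ^ p * B * M ^ q).trace| ≤
      ∑ i, ∑ j, ((B * M ^ p) i j ^ 2 + (B * M ^ q) j i ^ 2) := by
    rw [h1]
    refine (Finset.abs_sum_le_sum_abs _ _).trans (Finset.sum_le_sum fun i _ => ?_)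
    refine (Finset.abs_sum_le_sum_abs _ _).trans (Finset.sum_le_sum fun j _ => ?_)
    rw [abs_le]
    constructor <;>
    nlinarith [sq_nonneg ((B * M ^ p) i j + (B * M ^ q) j i), sq_nonneg ((B * M ^ p) i j),
      sq_nonneg ((B * M ^ p) i j - (B * M ^ q) j i), sq_nonneg ((B * M ^ q) j i)]
  simp_rw [Finset.sum_add_distrib] at h2
  rw [Finset.sum_comm (f := fun i j => (B * M ^ q) j i ^ 2), ← trace_mul_self_mul_pow hM hB.symm,
    ← trace_mul_self_mul_pow hM hB.symm] at h2
  have h3 := hB.trace_mul_self_mul_pow_le_sqrt hd hM p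
  have h4 := hB.trace_mul_self_mul_pow_le_sqrt hd hM q
  linarith

end IsRegularAdjacency

end SymmetricMatrices

/-! ### Periodic band matrices with equicorrelated Gaussian entries -/

section BandMatrices

open MvPolynomial
open Finset.HasAntidiagonal (antidiagonal)

theorem Derivation.map_matrix_pow_succ {R A V : Type*} [CommRing R] [CommRing A] [Algebra R A] [Fintype V]
    [DecidableEq V] (D : Derivation R A A) (M : Matrix V V A) (k : ℕ) :
    (M ^ (k + 1)).map D =
      ∑ x ∈ antidiagonal k, M ^ x.1 * M.map D * M ^ x.2 := by
  have hmul : ∀ N₁ N₂ : Matrix V V A, (N₁ * N₂).map D = N₁.map D * N₂ + N₁ * N₂.map D := by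
    intro N₁ N₂
    ext i j
    simp only [Matrix.map_apply, Matrix.mul_apply, Matrix.add_apply, map_sum, Derivation.leibniz,
      smul_eq_mul, Finset.sum_add_distrib]
    rw [add_comm]
    congr 1
    exact Finset.sum_congr rfl fun l _ => mul_comm _ _
  induction k with
  | zero => simp
  | succ k ih =>
    rw [pow_succ, hmul, ih, Finset.Nat.sum_antidiagonal_succ', Finset.sum_mul, pow_zero, Matrix.mul_one,
      add_comm]
    congr 1
    refine Finset.sum_congr rfl fun x _ => ?_
    rw [Matrix.mul_assoc, ← pow_succ]

variable {V : Type} [Fintype V] [DecidableEq V]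

/-- The covariance matrix with diagonal entries `1 + ρ` and all other entries equal to `ρ`. -/
def equicorrelation (ι : Type*) [DecidableEq ι] (ρ : ℝ) : Matrix ι ι ℝ :=
  Matrix.of fun i j => (1 : Matrix ι ι ℝ) i j + ρ

theorem equicorrelation_apply {ι : Type*} [DecidableEq ι] (ρ : ℝ) (i j : ι) :
    equicorrelation ι ρ i j = (1 : Matrix ι ι ℝ) i j + ρ := rfl

theorem equicorrelation_zero (ι : Type*) [DecidableEq ι] : equicorrelation ι 0 = 1 := by
  ext i j
  simp [equicorrelation_apply]

theorem posSemidef_equicorrelation (ι : Type*) [Fintype ι] [DecidableEq ι] {ρ : ℝ} (hρ : 0 ≤ ρ) :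
    (equicorrelation ι ρ).PosSemidef := by
  have h : equicorrelation ι ρ = 1 + ρ • Matrix.vecMulVec (fun _ => 1) (star fun _ => 1) := by
    ext i j
    simp [equicorrelation_apply, Matrix.vecMulVec_apply]
  rw [h]
  exact Matrix.PosSemidef.one.add ((Matrix.posSemidef_vecMulVec_self_star _).smul hρ)

/-- The sum of all partial derivatives. -/
noncomputable def totalDeriv (ι : Type*) [Fintype ι] :
    Derivation ℝ (MvPolynomial ι ℝ) (MvPolynomial ι ℝ) := ∑ s, pderiv s

theorem totalDeriv_apply {ι : Type*} [Fintype ι] (p : MvPolynomial ι ℝ) :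
    totalDeriv ι p = ∑ s, pderiv s p := by
  rw [totalDeriv, ← Derivation.coeFnAddMonoidHom_apply, map_sum, Finset.sum_apply]
  rfl

section Equicorrelated

variable {ι : Type*} [Fintype ι] [DecidableEq ι] {ρ : ℝ} {E : MvPolynomial ι ℝ →ₗ[ℝ] ℝ}

theorem IsGaussianFunctional.X_mul (hE : IsGaussianFunctional (equicorrelation ι ρ) E) (k : ι)
    (p : MvPolynomial ι ℝ) : E (X k * p) = E (pderiv k p) + ρ * E (totalDeriv ι p) := by
  rw [hE.ibp, totalDeriv_apply, map_sum, Finset.mul_sum]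
  simp_rw [equicorrelation_apply, add_mul, Finset.sum_add_distrib]
  congr 1
  rw [Finset.sum_eq_single k]
  · simp
  · intro l _ hl
    rw [Matrix.one_apply_ne hl.symm, zero_mul]
  · simp

/-- The rank-one part of the covariance sees the gradient only through the sum of its components. -/
theorem IsGaussianFunctional.variance_le_equicorrelation (hρ : 0 ≤ ρ)
    (hE : IsGaussianFunctional (equicorrelation ι ρ) E) (p : MvPolynomial ι ℝ) :
    E (p ^ 2) - E p ^ 2 ≤ E (∑ k, pderiv k p ^ 2) + ρ * E (totalDeriv ι p ^ 2) := by
  refine (hE.variance_le (posSemidef_equicorrelation ι hρ) p).trans_eq ?_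
  simp_rw [equicorrelation_apply, add_mul, Finset.sum_add_distrib]
  congr 1
  · rw [map_sum]
    refine Finset.sum_congr rfl fun k _ => ?_
    rw [Finset.sum_eq_single k]
    · simp [pow_two]
    · intro l _ hl
      rw [Matrix.one_apply_ne hl.symm, zero_mul]
    · simp
  · rw [totalDeriv_apply, pow_two, Finset.sum_mul_sum, Finset.sum_comm]
    simp only [map_sum, Finset.mul_sum]

end Equicorrelated

/-- The `V × V` random matrix with entries `B i j / √d * y s(i, j)`, as a matrix of polynomials in
the independent entries `y`. -/
noncomputable def bandPoly (B : Matrix V V ℝ) (d : ℕ) : Matrix V V (MvPolynomial (Sym2 V) ℝ) :=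
  Matrix.of fun i j => C (B i j / √d) * X s(i, j)

omit [Fintype V] [DecidableEq V] in
theorem bandPoly_apply (B : Matrix V V ℝ) (d : ℕ) (i j : V) :
    bandPoly B d i j = C (B i j / √d) * X s(i, j) := rfl

/-- A real matrix, seen as a matrix of constant polynomials. -/
noncomputable def constPoly (B : Matrix V V ℝ) : Matrix V V (MvPolynomial (Sym2 V) ℝ) := B.map C

omit [Fintype V] [DecidableEq V] in
theorem constPoly_apply (B : Matrix V V ℝ) (i j : V) : constPoly B i j = C (B i j) := rfl

/-- The value of `bandPoly` at `y`. -/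
noncomputable def bandEval (B : Matrix V V ℝ) (d : ℕ) (y : Sym2 V → ℝ) : Matrix V V ℝ :=
  Matrix.of fun i j => B i j / √d * y s(i, j)

variable {B : Matrix V V ℝ} {d : ℕ}

omit [DecidableEq V] in
theorem bandEval_isHermitian (hB : IsRegularAdjacency B d) (y : Sym2 V → ℝ) :
    (bandEval B d y).IsHermitian := by
  ext i j
  simp [bandEval, hB.apply_comm i j, Sym2.eq_swap]

theorem map_eval_bandPoly_pow (B : Matrix V V ℝ) (d : ℕ) (y : Sym2 V → ℝ) (k : ℕ) :
    (bandPoly B d ^ k).map (eval y) = bandEval B d y ^ k := by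
  have h := map_pow (eval y).mapMatrix (bandPoly B d) k
  rw [RingHom.mapMatrix_apply, RingHom.mapMatrix_apply] at h
  rw [h]
  congr 1
  ext i j
  simp [bandPoly, bandEval]

@[simp]
theorem eval_bandPoly_pow_apply (B : Matrix V V ℝ) (d : ℕ) (y : Sym2 V → ℝ) (k : ℕ) (i j : V) :
    eval y ((bandPoly B d ^ k) i j) = (bandEval B d y ^ k) i j := by
  rw [← map_eval_bandPoly_pow]
  rfl

@[simp]
theorem eval_trace_bandPoly_pow (B : Matrix V V ℝ) (d : ℕ) (y : Sym2 V → ℝ) (k : ℕ) :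
    eval y (bandPoly B d ^ k).trace = (bandEval B d y ^ k).trace := by
  simp [Matrix.trace]

omit [Fintype V] in
theorem bandPoly_map_pderiv (B : Matrix V V ℝ) (d : ℕ) (s : Sym2 V) :
    (bandPoly B d).map (pderiv s) =
      Matrix.of fun i j => if s(i, j) = s then C (B i j / √d) else 0 := by
  ext1 i j
  simp only [Matrix.map_apply, bandPoly_apply, pderiv_C_mul, pderiv_X, Matrix.of_apply]
  split_ifs with h
  · rw [h, Pi.single_eq_same, mul_one]
  · rw [Pi.single_eq_of_ne h, mul_zero]

theorem bandPoly_map_totalDeriv (B : Matrix V V ℝ) (d : ℕ) :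
    (bandPoly B d).map (totalDeriv (Sym2 V)) = (C (1 / √d) : MvPolynomial (Sym2 V) ℝ) • constPoly B := by
  ext1 i j
  rw [Matrix.map_apply, totalDeriv_apply]
  have h : ∀ s, pderiv s (bandPoly B d i j) = if s(i, j) = s then C (B i j / √d) else 0 :=
    fun s => congrFun (congrFun (bandPoly_map_pderiv B d s) i) j
  simp_rw [h]
  rw [Finset.sum_ite_eq]
  simp only [Finset.mem_univ, if_true, Matrix.smul_apply, constPoly_apply, smul_eq_mul, ← C_mul]
  congr 1
  ring

/-- The two orderings of an unordered pair coincide on the diagonal, where they must be counted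
once. -/
theorem sum_sum_ite_sym2 {R : Type*} [AddCommMonoid R] (f : V → V → R) (i j : V) :
    ∑ u, ∑ v, (if s(u, v) = s(i, j) then f u v else 0) = f j i + if i = j then 0 else f i j := by
  have h : ∀ u v, (if s(u, v) = s(i, j) then f u v else 0) =
      (if u = j then if v = i then f u v else 0 else 0) +
        if u = i then if v = j then (if i = j then 0 else f u v) else 0 else 0 := by
    intro u v
    simp only [Sym2.eq_iff]
    by_cases h1 : u = i <;> by_cases h2 : v = j <;> by_cases h3 : u = j <;> by_cases h4 : v = i <;>
      by_cases h5 : i = j <;> simp_all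
  simp_rw [h, Finset.sum_add_distrib]
  simp

/-- An off-diagonal variable sits at two places of the matrix. One gives a product of diagonal
entries, the source of the Catalan recursion; the other gives a transposed product of lower order.
-/
theorem pderiv_bandPoly_pow (hB : IsRegularAdjacency B d) (k : ℕ) (i j : V) :
    pderiv s(i, j) ((bandPoly B d ^ (k + 1)) j i) = C (B i j / √d) *
      ∑ x ∈ antidiagonal k, ((bandPoly B d ^ x.1) j j * (bandPoly B d ^ x.2) i i +
        if i = j then 0 else (bandPoly B d ^ x.1) j i * (bandPoly B d ^ x.2) j i) := by
  have h := congrFun (congrFun (Derivation.map_matrix_pow_succ (pderiv s(i, j)) (bandPoly B d) k) j) i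
  rw [Matrix.map_apply] at h
  rw [h, Matrix.sum_apply, Finset.mul_sum]
  refine Finset.sum_congr rfl fun x _ => ?_
  have h2 : (bandPoly B d ^ x.1 * (bandPoly B d).map (pderiv s(i, j)) * bandPoly B d ^ x.2) j i =
      ∑ u, ∑ v, if s(u, v) = s(i, j) then
        (bandPoly B d ^ x.1) j u * C (B u v / √d) * (bandPoly B d ^ x.2) v i else 0 := by
    rw [bandPoly_map_pderiv, Matrix.mul_apply]
    simp_rw [Matrix.mul_apply, Finset.sum_mul]
    rw [Finset.sum_comm]
    refine Finset.sum_congr rfl fun u _ => Finset.sum_congr rfl fun v _ => ?_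
    rw [Matrix.of_apply]
    split_ifs <;> simp
  rw [h2, sum_sum_ite_sym2, hB.apply_comm j i]
  split_ifs <;> ring

theorem totalDeriv_bandPoly_pow (k : ℕ) (i j : V) :
    totalDeriv (Sym2 V) ((bandPoly B d ^ (k + 1)) j i) = C (1 / √d) *
      ∑ x ∈ antidiagonal k, (bandPoly B d ^ x.1 * constPoly B * bandPoly B d ^ x.2) j i := by
  have h := congrFun (congrFun (Derivation.map_matrix_pow_succ (totalDeriv (Sym2 V)) (bandPoly B d) k) j) i
  rw [Matrix.map_apply] at h
  rw [h, Matrix.sum_apply, Finset.mul_sum]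
  refine Finset.sum_congr rfl fun x _ => ?_
  rw [bandPoly_map_totalDeriv, Matrix.mul_smul, Matrix.smul_mul, Matrix.smul_apply, smul_eq_mul]

/-- Gaussian integration by parts for the trace of a power of a band matrix. -/
theorem expectation_trace_bandPoly_pow {ρ : ℝ} {E : MvPolynomial (Sym2 V) ℝ →ₗ[ℝ] ℝ}
    (hB : IsRegularAdjacency B d)
    (hE : IsGaussianFunctional (equicorrelation (Sym2 V) ρ) E) (k : ℕ) :
    E (bandPoly B d ^ (k + 2)).trace =
      ∑ x ∈ antidiagonal k,
        (E (∑ i, ∑ j, C (B i j / d) * ((bandPoly B d ^ x.1) j j * (bandPoly B d ^ x.2) i i)) +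
        E (∑ i, ∑ j, C (B i j / d) *
          if i = j then 0 else (bandPoly B d ^ x.1) j i * (bandPoly B d ^ x.2) j i) +
        ρ / d * E (constPoly B * bandPoly B d ^ x.1 * constPoly B * bandPoly B d ^ x.2).trace) := by
  have hdd : ∀ b : ℝ, b / √d * (1 / √d) = b / d := by
    intro b
    rw [div_mul_div_comm, mul_one, Real.mul_self_sqrt (Nat.cast_nonneg _)]
  -- One factor comes from the entry and one from its derivative; they merge since `B` is 0-1
  -- valued.
  have hBB : ∀ i j, B i j / √d * (B i j / √d) = B i j / d := by
    intro i j
    rw [div_mul_div_comm, ← pow_two, hB.sq, Real.mul_self_sqrt (Nat.cast_nonneg _)]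
  have h1 : (bandPoly B d ^ (k + 2)).trace =
      ∑ i, ∑ j, C (B i j / √d) * (X s(i, j) * (bandPoly B d ^ (k + 1)) j i) := by
    rw [pow_succ' _ (k + 1), Matrix.trace]
    refine Finset.sum_congr rfl fun i _ => ?_
    rw [Matrix.diag_apply, Matrix.mul_apply]
    exact Finset.sum_congr rfl fun j _ => by rw [bandPoly_apply, mul_assoc]
  have h2 : ∀ i j, E (C (B i j / √d) * (X s(i, j) * (bandPoly B d ^ (k + 1)) j i)) =
      ∑ x ∈ antidiagonal k,
        (E (C (B i j / d) * ((bandPoly B d ^ x.1) j j * (bandPoly B d ^ x.2) i i)) +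
        E (C (B i j / d) *
          if i = j then 0 else (bandPoly B d ^ x.1) j i * (bandPoly B d ^ x.2) j i) +
        ρ / d * E (C (B i j) * (bandPoly B d ^ x.1 * constPoly B * bandPoly B d ^ x.2) j i)) := by
    intro i j
    rw [IsGaussianFunctional.map_C_mul, hE.X_mul, pderiv_bandPoly_pow hB, totalDeriv_bandPoly_pow,
      mul_add, IsGaussianFunctional.map_C_mul, IsGaussianFunctional.map_C_mul, ← mul_assoc, hBB]
    have h3 : B i j / √d * (ρ * (1 / √d * E (∑ x ∈ antidiagonal k,
        (bandPoly B d ^ x.1 * constPoly B * bandPoly B d ^ x.2) j i))) =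
        B i j / d * (ρ * E (∑ x ∈ antidiagonal k,
        (bandPoly B d ^ x.1 * constPoly B * bandPoly B d ^ x.2) j i)) := by
      rw [← hdd]
      ring
    rw [h3, map_sum, map_sum, Finset.mul_sum, Finset.mul_sum, Finset.mul_sum,
      ← Finset.sum_add_distrib]
    refine Finset.sum_congr rfl fun x _ => ?_
    rw [map_add, IsGaussianFunctional.map_C_mul, IsGaussianFunctional.map_C_mul,
      IsGaussianFunctional.map_C_mul]
    ring
  have h4 : ∀ x : ℕ × ℕ, (constPoly B * bandPoly B d ^ x.1 * constPoly B * bandPoly B d ^ x.2).trace =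
      ∑ i, ∑ j, C (B i j) * (bandPoly B d ^ x.1 * constPoly B * bandPoly B d ^ x.2) j i := by
    intro x
    rw [Matrix.mul_assoc, Matrix.mul_assoc, Matrix.trace]
    refine Finset.sum_congr rfl fun i _ => ?_
    rw [Matrix.diag_apply, Matrix.mul_apply]
    refine Finset.sum_congr rfl fun j _ => ?_
    rw [constPoly_apply, Matrix.mul_assoc]
  rw [h1]
  simp_rw [h4, map_sum, h2, Finset.mul_sum, Finset.sum_add_distrib]
  congr 1
  · congr 1
    · exact (Finset.sum_congr rfl fun i _ => Finset.sum_comm).trans Finset.sum_comm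
    · exact (Finset.sum_congr rfl fun i _ => Finset.sum_comm).trans Finset.sum_comm
  · exact (Finset.sum_congr rfl fun i _ => Finset.sum_comm).trans Finset.sum_comm

end BandMatrices

/-! ### Vertex transitivity and a priori bounds for even moments and error terms. -/

section BandMoments

open MvPolynomial
open Finset.HasAntidiagonal (antidiagonal)

variable {V : Type} [Fintype V] [DecidableEq V]

theorem eval_trace_eq {ι : Type*} (y : ι → ℝ) (N : Matrix V V (MvPolynomial ι ℝ)) :
    eval y N.trace = ((eval y).mapMatrix N).trace := by
  simp [Matrix.trace]

theorem eval_apply_eq {ι : Type*} (y : ι → ℝ) (N : Matrix V V (MvPolynomial ι ℝ)) (i j : V) :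
    eval y (N i j) = ((eval y).mapMatrix N) i j := rfl

theorem mapMatrix_eval_constPoly (B : Matrix V V ℝ) (y : Sym2 V → ℝ) :
    (eval y).mapMatrix (constPoly B) = B := by
  ext i j
  simp [constPoly_apply]

theorem mapMatrix_eval_bandPoly_pow (B : Matrix V V ℝ) (d : ℕ) (y : Sym2 V → ℝ) (k : ℕ) :
    (eval y).mapMatrix (bandPoly B d ^ k) = bandEval B d y ^ k :=
  map_eval_bandPoly_pow B d y k

/-- A centred Gaussian functional for the band matrix with adjacency matrix `B`, whose entries have
variance `1 + ρ` and pairwise covariances `ρ ≤ c / |V|`; the adjacency is vertex transitive. -/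
structure EquicorrelatedBand (B : Matrix V V ℝ) (d : ℕ) (c ρ : ℝ)
    (E : MvPolynomial (Sym2 V) ℝ →ₗ[ℝ] ℝ) : Prop where
  regular : IsRegularAdjacency B d
  pos : 0 < d
  transitive : ∀ i j, ∃ σ : Equiv.Perm V, σ i = j ∧ ∀ k l, B (σ k) (σ l) = B k l
  nonneg : 0 ≤ ρ
  mul_card_le : ρ * Fintype.card V ≤ c
  gaussian : IsGaussianFunctional (equicorrelation (Sym2 V) ρ) E

/-- The expectation of the normalized trace of the `k`-th power of the band matrix. -/
noncomputable def meanMoment (B : Matrix V V ℝ) (d : ℕ) (E : MvPolynomial (Sym2 V) ℝ →ₗ[ℝ] ℝ)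
    (k : ℕ) : ℝ := E (bandPoly B d ^ k).trace / Fintype.card V

/-- The permutation of unordered pairs induced by a permutation. -/
def sym2Perm (σ : Equiv.Perm V) : Equiv.Perm (Sym2 V) where
  toFun := Sym2.map σ
  invFun := Sym2.map σ.symm
  left_inv s := by simp [Sym2.map_map]
  right_inv s := by simp [Sym2.map_map]

variable {B : Matrix V V ℝ} {d : ℕ} {c ρ : ℝ} {E : MvPolynomial (Sym2 V) ℝ →ₗ[ℝ] ℝ}

/-- Symmetries of the band act compatibly on variables and on matrix indices. Since they also
preserve the equicorrelated law, the law of a diagonal entry cannot depend on the vertex. -/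
theorem rename_bandPoly_pow {σ : Equiv.Perm V} (hσ : ∀ k l, B (σ k) (σ l) = B k l) (k : ℕ)
    (i j : V) : rename (sym2Perm σ) ((bandPoly B d ^ k) i j) = (bandPoly B d ^ k) (σ i) (σ j) := by
  induction k generalizing i j with
  | zero => simp [Matrix.one_apply, apply_ite]
  | succ k ih =>
    rw [pow_succ, Matrix.mul_apply, Matrix.mul_apply, map_sum,
      ← Equiv.sum_comp σ fun l => (bandPoly B d ^ k) (σ i) l * bandPoly B d l (σ j)]
    refine Finset.sum_congr rfl fun l _ => ?_
    rw [map_mul, ih, bandPoly_apply, bandPoly_apply, hσ]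
    simp [sym2Perm]

namespace EquicorrelatedBand

theorem apply_rename (h : EquicorrelatedBand B d c ρ E) (σ : Equiv.Perm V)
    (p : MvPolynomial (Sym2 V) ℝ) : E (rename (sym2Perm σ) p) = E p := by
  refine h.gaussian.apply_rename (sym2Perm σ) (fun i j => ?_) p
  simp [equicorrelation_apply, Matrix.one_apply]

variable [Nonempty V]

theorem card_pos (V : Type) [Fintype V] [Nonempty V] : (0 : ℝ) < Fintype.card V := by
  exact_mod_cast Fintype.card_pos

omit [Nonempty V] in
theorem c_nonneg (h : EquicorrelatedBand B d c ρ E) : 0 ≤ c :=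
  (mul_nonneg h.nonneg (Nat.cast_nonneg _)).trans h.mul_card_le

theorem d_le_card (h : EquicorrelatedBand B d c ρ E) : (d : ℝ) ≤ Fintype.card V :=
  h.regular.le_card (Classical.arbitrary V)

omit [Nonempty V] in
theorem d_pos (h : EquicorrelatedBand B d c ρ E) : (0 : ℝ) < d := Nat.cast_pos.2 h.pos

omit [Nonempty V] in
theorem expectation_diag_eq (h : EquicorrelatedBand B d c ρ E) (k : ℕ) (i j : V) :
    E ((bandPoly B d ^ k) i i) = E ((bandPoly B d ^ k) j j) := by
  obtain ⟨σ, rfl, hσ⟩ := h.transitive i j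
  rw [← rename_bandPoly_pow hσ, h.apply_rename]

omit [Nonempty V] in
theorem expectation_diag_sq_eq (h : EquicorrelatedBand B d c ρ E) (k : ℕ) (i j : V) :
    E ((bandPoly B d ^ k) i i ^ 2) = E ((bandPoly B d ^ k) j j ^ 2) := by
  obtain ⟨σ, rfl, hσ⟩ := h.transitive i j
  rw [← rename_bandPoly_pow hσ, ← map_pow, h.apply_rename]

theorem expectation_trace (E : MvPolynomial (Sym2 V) ℝ →ₗ[ℝ] ℝ) (k : ℕ) :
    E (bandPoly B d ^ k).trace = Fintype.card V * meanMoment B d E k := by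
  rw [meanMoment, mul_div_cancel₀ _ (card_pos V).ne']

theorem expectation_diag (h : EquicorrelatedBand B d c ρ E) (k : ℕ) (i : V) :
    E ((bandPoly B d ^ k) i i) = meanMoment B d E k := by
  rw [meanMoment, Matrix.trace, map_sum, eq_div_iff (card_pos V).ne']
  simp_rw [Matrix.diag_apply, fun j => h.expectation_diag_eq k j i]
  simp [mul_comm]

theorem meanMoment_zero (h : EquicorrelatedBand B d c ρ E) : meanMoment B d E 0 = 1 := by
  rw [← h.expectation_diag 0 (Classical.arbitrary V), pow_zero, Matrix.one_apply_eq,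
    h.gaussian.one]

theorem meanMoment_one (h : EquicorrelatedBand B d c ρ E) : meanMoment B d E 1 = 0 := by
  rw [← h.expectation_diag 1 (Classical.arbitrary V), pow_one, bandPoly_apply,
    IsGaussianFunctional.map_C_mul, ← mul_one (X _), h.gaussian.X_mul]
  simp

/-- Each of the `k + 1` terms from integration by parts is compared with the trace of the `k`-th
power: 8 for the diagonal products and 8 for the transposed ones, as `B / d` has row and column sums
1, and `2 * c` for the correlation term, by the operator norm bound and `ρ * d ≤ c`. -/
theorem expectation_trace_le_of_even (h : EquicorrelatedBand B d c ρ E) {k : ℕ} (hk : Even k) :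
    E (bandPoly B d ^ (k + 2)).trace ≤ (k + 1) * (16 + 2 * c) * E (bandPoly B d ^ k).trace := by
  have hG := h.gaussian
  have hB := h.regular
  have hd := h.d_pos
  have hsum : ∀ f : V → ℝ, ∑ i, ∑ j, B i j / d * (f i + f j) = 2 * ∑ i, f i := by
    intro f
    have hr : ∀ i, ∑ j, B i j / d = 1 := fun i => by
      rw [← Finset.sum_div, hB.row_sum, div_self hd.ne']
    have hc : ∀ j, ∑ i, B i j / d = 1 := fun j => by
      rw [← hr j]
      exact Finset.sum_congr rfl fun i _ => by rw [hB.apply_comm]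
    simp_rw [mul_add, Finset.sum_add_distrib]
    rw [Finset.sum_comm (f := fun i j => B i j / d * f j)]
    simp_rw [← Finset.sum_mul, hr, hc, one_mul]
    ring
  have ht0 : ∀ y, 0 ≤ (bandEval B d y ^ k).trace := by
    intro y
    obtain ⟨m, rfl⟩ := hk
    rw [← two_mul]
    exact Finset.sum_nonneg fun i _ =>
      pow_two_mul_apply_self_nonneg (bandEval_isHermitian hB y) m i
  have hterm : ∀ x ∈ antidiagonal k,
      E (∑ i, ∑ j, C (B i j / d) * ((bandPoly B d ^ x.1) j j * (bandPoly B d ^ x.2) i i)) +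
        E (∑ i, ∑ j, C (B i j / d) *
          if i = j then 0 else (bandPoly B d ^ x.1) j i * (bandPoly B d ^ x.2) j i) +
        ρ / d * E (constPoly B * bandPoly B d ^ x.1 * constPoly B * bandPoly B d ^ x.2).trace ≤
      (16 + 2 * c) * E (bandPoly B d ^ k).trace := by
    intro x hx
    have hx := Finset.HasAntidiagonal.mem_antidiagonal.1 hx
    have e1 : E (∑ i, ∑ j, C (B i j / d) *
        ((bandPoly B d ^ x.1) j j * (bandPoly B d ^ x.2) i i)) ≤
        8 * E (bandPoly B d ^ k).trace := by
      rw [← IsGaussianFunctional.map_C_mul]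
      refine hG.mono fun y => ?_
      simp only [map_sum, map_mul, eval_C, eval_bandPoly_pow_apply, eval_trace_bandPoly_pow]
      have hM := bandEval_isHermitian hB y (d := d)
      calc _ ≤ ∑ i, ∑ j, B i j / d * (4 * (bandEval B d y ^ k) i i + 4 * (bandEval B d y ^ k) j j) := by
            refine Finset.sum_le_sum fun i _ => Finset.sum_le_sum fun j _ => ?_
            refine mul_le_mul_of_nonneg_left ?_ (div_nonneg (hB.nonneg _ _) hd.le)
            have := (le_abs_self _).trans (abs_pow_apply_mul_pow_apply_le hM hx hk (i := i) (j := j)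
              (p := j) (q := j) (u := i) (v := i) (by simp) (by simp) (by simp) (by simp))
            linarith
        _ = _ := by
            rw [hsum fun i => 4 * (bandEval B d y ^ k) i i, ← Finset.mul_sum, Matrix.trace]
            simp only [Matrix.diag_apply]
            ring
    have e2 : E (∑ i, ∑ j, C (B i j / d) *
          if i = j then 0 else (bandPoly B d ^ x.1) j i * (bandPoly B d ^ x.2) j i) ≤
        8 * E (bandPoly B d ^ k).trace := by
      rw [← IsGaussianFunctional.map_C_mul]
      refine hG.mono fun y => ?_
      simp only [map_sum, map_mul, eval_C, eval_trace_bandPoly_pow, apply_ite (eval y), map_zero,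
        eval_bandPoly_pow_apply]
      have hM := bandEval_isHermitian hB y (d := d)
      calc _ ≤ ∑ i, ∑ j, B i j / d * (4 * (bandEval B d y ^ k) i i + 4 * (bandEval B d y ^ k) j j) := by
            refine Finset.sum_le_sum fun i _ => Finset.sum_le_sum fun j _ => ?_
            refine mul_le_mul_of_nonneg_left ?_ (div_nonneg (hB.nonneg _ _) hd.le)
            have := abs_pow_apply_mul_pow_apply_le hM hx hk (i := i) (j := j)
              (p := j) (q := i) (u := j) (v := i) (by simp) (by simp) (by simp) (by simp)
            split_ifs
            · have := (abs_nonneg _).trans this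
              linarith
            · have := (le_abs_self _).trans this
              linarith
        _ = _ := by
            rw [hsum fun i => 4 * (bandEval B d y ^ k) i i, ← Finset.mul_sum, Matrix.trace]
            simp only [Matrix.diag_apply]
            ring
    have e3 : ρ / d * E (constPoly B * bandPoly B d ^ x.1 * constPoly B * bandPoly B d ^ x.2).trace
        ≤ 2 * c * E (bandPoly B d ^ k).trace := by
      rw [← IsGaussianFunctional.map_C_mul, ← IsGaussianFunctional.map_C_mul]
      refine hG.mono fun y => ?_
      simp only [map_mul, eval_C, eval_trace_eq, mapMatrix_eval_constPoly,
        mapMatrix_eval_bandPoly_pow]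
      have hM := bandEval_isHermitian hB y (d := d)
      have h1 := (le_abs_self _).trans (trace_mul_pow_mul_pow_le hM hB.symm hx hk)
      have h2 : (B * B * bandEval B d y ^ k).trace ≤ d ^ 2 * (bandEval B d y ^ k).trace := by
        obtain ⟨m, rfl⟩ := hk
        rw [← two_mul]
        exact hB.trace_mul_self_mul_pow_le hM m
      have h3 : ρ * d ≤ c :=
        (mul_le_mul_of_nonneg_left h.d_le_card h.nonneg).trans h.mul_card_le
      calc _ ≤ ρ / d * (2 * (d ^ 2 * (bandEval B d y ^ k).trace)) := by
            refine mul_le_mul_of_nonneg_left (h1.trans ?_) (div_nonneg h.nonneg hd.le)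
            linarith
        _ = 2 * (ρ * d) * (bandEval B d y ^ k).trace := by
            field_simp
        _ ≤ _ := by
            have := ht0 y
            gcongr
    linarith
  rw [expectation_trace_bandPoly_pow hB hG]
  refine (Finset.sum_le_sum hterm).trans_eq ?_
  rw [Finset.sum_const, Finset.Nat.card_antidiagonal, nsmul_eq_mul]
  push_cast
  ring

end EquicorrelatedBand

/-- A bound for the even mean moments of equicorrelated band matrices. -/
noncomputable def momentBound (c : ℝ) : ℕ → ℝ
  | 0 => 1
  | m + 1 => (2 * m + 1) * (16 + 2 * c) * momentBound c m

namespace EquicorrelatedBand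

variable [Nonempty V]

theorem meanMoment_even_le (h : EquicorrelatedBand B d c ρ E) (m : ℕ) :
    meanMoment B d E (2 * m) ≤ momentBound c m := by
  induction m with
  | zero => rw [mul_zero, h.meanMoment_zero, momentBound]
  | succ m ih =>
    have h1 := h.expectation_trace_le_of_even (even_two_mul m)
    rw [expectation_trace, expectation_trace] at h1
    have h2 : meanMoment B d E (2 * m + 2) ≤
        ((2 * m : ℕ) + 1) * (16 + 2 * c) * meanMoment B d E (2 * m) := by
      refine le_of_mul_le_mul_left ?_ (card_pos V)
      linarith
    rw [mul_add, mul_one, momentBound]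
    push_cast at h2
    have hc := h.c_nonneg
    exact h2.trans (by gcongr)

theorem expectation_trace_even_le (h : EquicorrelatedBand B d c ρ E) (m : ℕ) :
    E (bandPoly B d ^ (2 * m)).trace ≤ Fintype.card V * momentBound c m := by
  rw [expectation_trace]
  exact mul_le_mul_of_nonneg_left (h.meanMoment_even_le m) (card_pos V).le

theorem expectation_trace_four_le (h : EquicorrelatedBand B d c ρ E) (m : ℕ) :
    E (bandPoly B d ^ (4 * m)).trace ≤ Fintype.card V * momentBound c (2 * m) := by
  have := h.expectation_trace_even_le (2 * m)
  rwa [← mul_assoc] at this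

/-- Bounding `B i j` by 1 extends the sum to all `j`, where it is still controlled by diagonal
entries of even powers; the factor `1 / d` survives. -/
theorem abs_offDiagonal_le (h : EquicorrelatedBand B d c ρ E) (p q : ℕ) :
    |E (∑ i, ∑ j, C (B i j / d) *
        if i = j then 0 else (bandPoly B d ^ p) j i * (bandPoly B d ^ q) j i)| ≤
      Fintype.card V * ((momentBound c p + momentBound c q) / d) := by
  have hd := h.d_pos
  have hB := h.regular
  have h1 : |E (∑ i, ∑ j, C (B i j / d) *
        if i = j then 0 else (bandPoly B d ^ p) j i * (bandPoly B d ^ q) j i)| ≤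
      E (C (1 / (d : ℝ)) * ((bandPoly B d ^ (2 * p)).trace + (bandPoly B d ^ (2 * q)).trace)) := by
    refine h.gaussian.abs_le fun y => ?_
    simp only [map_sum, map_mul, map_add, eval_C, eval_trace_bandPoly_pow, apply_ite (eval y),
      map_zero, eval_bandPoly_pow_apply]
    have hM := bandEval_isHermitian hB y (d := d)
    rw [Matrix.trace, Matrix.trace, ← Finset.sum_add_distrib, Finset.mul_sum]
    refine (Finset.abs_sum_le_sum_abs _ _).trans (Finset.sum_le_sum fun i _ => ?_)
    refine (Finset.abs_sum_le_sum_abs _ _).trans ?_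
    refine le_trans ?_ (mul_le_mul_of_nonneg_left
      (sum_abs_pow_apply_mul_pow_apply_le hM p q i) (by positivity))
    rw [Finset.mul_sum]
    refine Finset.sum_le_sum fun j _ => ?_
    rw [abs_mul, abs_of_nonneg (div_nonneg (hB.nonneg _ _) hd.le)]
    refine mul_le_mul ?_ ?_ (abs_nonneg _) (by positivity)
    · exact div_le_div_of_nonneg_right (hB.le_one i j) hd.le
    · split_ifs
      · rw [abs_zero]
        exact abs_nonneg _
      · exact le_rfl
  refine h1.trans ?_
  rw [IsGaussianFunctional.map_C_mul, map_add]
  have h2 := h.expectation_trace_even_le p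
  have h3 := h.expectation_trace_even_le q
  calc _ ≤ 1 / (d : ℝ) * (Fintype.card V * momentBound c p + Fintype.card V * momentBound c q) := by
        gcongr
    _ = _ := by ring

theorem abs_expectation_trace_mul_le (h : EquicorrelatedBand B d c ρ E) (p q : ℕ) :
    |E (constPoly B * bandPoly B d ^ p * constPoly B * bandPoly B d ^ q).trace| ≤
      d * √d * (Fintype.card V * (2 + momentBound c (2 * p) + momentBound c (2 * q))) := by
  have hB := h.regular
  have h1 : |E (constPoly B * bandPoly B d ^ p * constPoly B * bandPoly B d ^ q).trace| ≤
      E (C (d * √d) * (C (2 * (Fintype.card V : ℝ)) + (bandPoly B d ^ (4 * p)).trace +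
        (bandPoly B d ^ (4 * q)).trace)) := by
    refine h.gaussian.abs_le fun y => ?_
    have hM := bandEval_isHermitian hB y (d := d)
    have := hB.abs_trace_mul_pow_mul_pow_le h.pos hM p q
    rw [eval_trace_eq]
    simpa only [map_mul, map_add, eval_C, eval_trace_bandPoly_pow, mapMatrix_eval_constPoly,
        mapMatrix_eval_bandPoly_pow] using this
  refine h1.trans ?_
  rw [IsGaussianFunctional.map_C_mul, map_add, map_add, h.gaussian.map_C]
  have h2 := h.expectation_trace_four_le p
  have h3 := h.expectation_trace_four_le q
  refine mul_le_mul_of_nonneg_left ?_ (by positivity)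
  linarith

omit [Nonempty V] in
theorem inv_le_inv_sqrt (h : EquicorrelatedBand B d c ρ E) : 1 / (d : ℝ) ≤ 1 / √d := by
  have h1 : (1 : ℝ) ≤ d := by exact_mod_cast h.pos
  have hs : 0 < √(d : ℝ) := Real.sqrt_pos.2 h.d_pos
  refine one_div_le_one_div_of_le hs ?_
  rw [Real.sqrt_le_left (by positivity)]
  nlinarith

/-- Since `d ≤ |V|`, also `ρ * d ≤ c`. This turns the gained `√d` in the Hilbert–Schmidt bound into
decay. -/
theorem mul_sqrt_le (h : EquicorrelatedBand B d c ρ E) : ρ * √d ≤ c / √d := by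
  have hs : 0 < √(d : ℝ) := Real.sqrt_pos.2 h.d_pos
  rw [le_div_iff₀ hs, mul_assoc, Real.mul_self_sqrt (Nat.cast_nonneg _)]
  exact (mul_le_mul_of_nonneg_left h.d_le_card h.nonneg).trans h.mul_card_le

end EquicorrelatedBand

end BandMoments

/-! ### Variances of diagonal entries and the approximate Catalan recursion. -/

section BandRecursion

open MvPolynomial
open Finset.HasAntidiagonal (antidiagonal)

variable {V : Type} [Fintype V] [DecidableEq V]

/-- An unordered pair has at most two orderings, so squaring a fibre sum costs at most a factor 2.
-/
theorem sum_sq_sum_fiber_le (f : V → V → ℝ) :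
    ∑ s : Sym2 V, (∑ u, ∑ v, if s(u, v) = s then f u v else 0) ^ 2 ≤ 2 * ∑ u, ∑ v, f u v ^ 2 := by
  have h1 : ∀ s : Sym2 V, (∑ u, ∑ v, if s(u, v) = s then f u v else 0) ^ 2 ≤
      2 * ∑ u, ∑ v, if s(u, v) = s then f u v ^ 2 else 0 := by
    intro s
    induction s using Sym2.ind with
    | _ i j =>
      rw [sum_sum_ite_sym2, sum_sum_ite_sym2 fun u v => f u v ^ 2]
      split_ifs
      · nlinarith [sq_nonneg (f j i)]
      · nlinarith [sq_nonneg (f j i - f i j)]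
  refine (Finset.sum_le_sum fun s _ => h1 s).trans_eq ?_
  rw [← Finset.mul_sum, Finset.sum_comm]
  congr 1
  refine Finset.sum_congr rfl fun u _ => ?_
  rw [Finset.sum_comm]
  refine Finset.sum_congr rfl fun v _ => ?_
  rw [Finset.sum_ite_eq]
  simp

variable {B : Matrix V V ℝ} {d : ℕ} {c ρ : ℝ} {E : MvPolynomial (Sym2 V) ℝ →ₗ[ℝ] ℝ}

theorem eval_pderiv_bandPoly_pow (y : Sym2 V → ℝ) (s : Sym2 V) (k : ℕ) (i j : V) :
    eval y (pderiv s ((bandPoly B d ^ (k + 1)) i j)) =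
      ∑ u, ∑ v, if s(u, v) = s then B u v / √d * ∑ x ∈ antidiagonal k,
        (bandEval B d y ^ x.1) i u * (bandEval B d y ^ x.2) v j else 0 := by
  have h := congrFun (congrFun (Derivation.map_matrix_pow_succ (pderiv s) (bandPoly B d) k) i) j
  rw [Matrix.map_apply] at h
  rw [h, Matrix.sum_apply, map_sum]
  have h2 : ∀ x : ℕ × ℕ,
      eval y ((bandPoly B d ^ x.1 * (bandPoly B d).map (pderiv s) * bandPoly B d ^ x.2) i j) =
      ∑ u, ∑ v, if s(u, v) = s then
        B u v / √d * ((bandEval B d y ^ x.1) i u * (bandEval B d y ^ x.2) v j) else 0 := by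
    intro x
    rw [bandPoly_map_pderiv, Matrix.mul_apply]
    simp_rw [Matrix.mul_apply, Finset.sum_mul]
    rw [Finset.sum_comm]
    simp only [map_sum, map_mul, Matrix.of_apply, eval_bandPoly_pow_apply, apply_ite (eval y),
      eval_C, map_zero]
    refine Finset.sum_congr rfl fun u _ => Finset.sum_congr rfl fun v _ => ?_
    split_ifs
    · ring
    · simp
  simp_rw [h2]
  rw [Finset.sum_comm]
  refine Finset.sum_congr rfl fun u _ => ?_
  rw [Finset.sum_comm]
  refine Finset.sum_congr rfl fun v _ => ?_
  split_ifs
  · rw [Finset.mul_sum]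
  · simp

/-- The gradient part of the Poincaré bound. Extending the sum from the band to all pairs makes it
factorize into diagonal entries of `M ^ (2 * x.1)` and `M ^ (2 * x.2)`. -/
theorem sum_sq_pderiv_diag_le (hB : IsRegularAdjacency B d) (y : Sym2 V → ℝ) (k : ℕ) (i : V) :
    ∑ s, eval y (pderiv s ((bandPoly B d ^ (k + 1)) i i)) ^ 2 ≤
      2 * (k + 1) / d * ∑ x ∈ antidiagonal k,
        ((bandEval B d y ^ (4 * x.1)) i i + (bandEval B d y ^ (4 * x.2)) i i) := by
  have hM := bandEval_isHermitian hB y (d := d)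
  set M := bandEval B d y with hMdef
  simp_rw [eval_pderiv_bandPoly_pow]
  refine (sum_sq_sum_fiber_le _).trans ?_
  have h1 : ∀ u v, (B u v / √d * ∑ x ∈ antidiagonal k, (M ^ x.1) i u * (M ^ x.2) v i) ^ 2 ≤
      (k + 1) / d * ∑ x ∈ antidiagonal k, (M ^ x.1) i u ^ 2 * (M ^ x.2) v i ^ 2 := by
    intro u v
    rw [mul_pow, div_pow, Real.sq_sqrt (Nat.cast_nonneg _), hB.sq]
    have h2 := sq_sum_le_card_mul_sum_sq (s := antidiagonal k)
      (f := fun x => (M ^ x.1) i u * (M ^ x.2) v i)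
    simp only [Finset.Nat.card_antidiagonal, mul_pow] at h2
    push_cast at h2
    calc _ ≤ 1 / (d : ℝ) * ((k + 1) * ∑ x ∈ antidiagonal k,
          (M ^ x.1) i u ^ 2 * (M ^ x.2) v i ^ 2) := by
          refine mul_le_mul ?_ h2 (sq_nonneg _) (by positivity)
          exact div_le_div_of_nonneg_right (hB.le_one _ _) (Nat.cast_nonneg _)
      _ = _ := by ring
  have h3 : ∑ u, ∑ v, (k + 1) / d * ∑ x ∈ antidiagonal k, (M ^ x.1) i u ^ 2 * (M ^ x.2) v i ^ 2 =
      (k + 1) / d * ∑ x ∈ antidiagonal k, (M ^ (2 * x.1)) i i * (M ^ (2 * x.2)) i i := by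
    simp_rw [← Finset.mul_sum]
    congr 1
    simp_rw [pow_two_mul_apply_self hM, Finset.sum_mul_sum, fun a v => pow_apply_comm hM a v i]
    rw [(Finset.sum_congr rfl fun u _ => Finset.sum_comm).trans Finset.sum_comm]
  have h4 : ∀ x : ℕ × ℕ, (M ^ (2 * x.1)) i i * (M ^ (2 * x.2)) i i ≤
      (M ^ (4 * x.1)) i i + (M ^ (4 * x.2)) i i := by
    intro x
    have e1 := sq_pow_apply_self_le hM (2 * x.1) i
    have e2 := sq_pow_apply_self_le hM (2 * x.2) i
    rw [← mul_assoc] at e1 e2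
    norm_num at e1 e2
    nlinarith [sq_nonneg ((M ^ (2 * x.1)) i i - (M ^ (2 * x.2)) i i),
      sq_nonneg ((M ^ (2 * x.1)) i i), sq_nonneg ((M ^ (2 * x.2)) i i)]
  calc _ ≤ 2 * ((k + 1) / d * ∑ x ∈ antidiagonal k, (M ^ (2 * x.1)) i i * (M ^ (2 * x.2)) i i) := by
        rw [← h3]
        gcongr with u _ v _
        exact h1 u v
    _ ≤ 2 * ((k + 1) / d * ∑ x ∈ antidiagonal k,
          ((M ^ (4 * x.1)) i i + (M ^ (4 * x.2)) i i)) := by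
        gcongr with x _
        exact h4 x
    _ = _ := by ring

/-- The rank-one part, summed over vertices: the diagonal of `M ^ x.1 * B * M ^ x.2` is dominated by
its Hilbert–Schmidt norm, whose square is the trace on the right. -/
theorem sum_sq_totalDeriv_diag_le (hB : IsRegularAdjacency B d) (y : Sym2 V → ℝ) (k : ℕ) :
    ∑ i, eval y (totalDeriv (Sym2 V) ((bandPoly B d ^ (k + 1)) i i)) ^ 2 ≤
      (k + 1) / d * ∑ x ∈ antidiagonal k,
        (B * bandEval B d y ^ (2 * x.1) * B * bandEval B d y ^ (2 * x.2)).trace := by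
  have hM := bandEval_isHermitian hB y (d := d)
  have h1 : ∀ i, eval y (totalDeriv (Sym2 V) ((bandPoly B d ^ (k + 1)) i i)) =
      1 / √d * ∑ x ∈ antidiagonal k,
        (bandEval B d y ^ x.1 * B * bandEval B d y ^ x.2) i i := by
    intro i
    rw [totalDeriv_bandPoly_pow, map_mul, eval_C, map_sum]
    simp only [eval_apply_eq, map_mul, mapMatrix_eval_constPoly, mapMatrix_eval_bandPoly_pow]
  set M := bandEval B d y with hMdef
  have h2 : ∀ x : ℕ × ℕ, ∑ i, (M ^ x.1 * B * M ^ x.2) i i ^ 2 ≤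
      (B * M ^ (2 * x.1) * B * M ^ (2 * x.2)).trace := by
    intro x
    have hT : ∀ a, (M ^ a).transpose = M ^ a := fun a => by
      ext i j
      exact pow_apply_comm hM a j i
    have hBT : B.transpose = B := by
      ext i j
      exact hB.apply_comm j i
    have e : (B * M ^ (2 * x.1) * B * M ^ (2 * x.2)).trace =
        ((M ^ x.1 * B * M ^ x.2).transpose * (M ^ x.1 * B * M ^ x.2)).trace := by
      simp only [Matrix.transpose_mul, hT, hBT, two_mul, pow_add]
      rw [← Matrix.mul_assoc, Matrix.trace_mul_comm]
      simp only [Matrix.mul_assoc]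
    rw [e, Matrix.trace]
    refine Finset.sum_le_sum fun i _ => ?_
    rw [Matrix.diag_apply, Matrix.mul_apply]
    refine (Finset.single_le_sum (f := fun j => (M ^ x.1 * B * M ^ x.2) j i ^ 2)
      (fun j _ => sq_nonneg _) (Finset.mem_univ i)).trans_eq ?_
    exact Finset.sum_congr rfl fun j _ => pow_two _
  have h3 : ∀ i, eval y (totalDeriv (Sym2 V) ((bandPoly B d ^ (k + 1)) i i)) ^ 2 ≤
      (k + 1) / d * ∑ x ∈ antidiagonal k, (M ^ x.1 * B * M ^ x.2) i i ^ 2 := by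
    intro i
    rw [h1, mul_pow, div_pow, one_pow, Real.sq_sqrt (Nat.cast_nonneg _)]
    have h2 := sq_sum_le_card_mul_sum_sq (s := antidiagonal k)
      (f := fun x => (M ^ x.1 * B * M ^ x.2) i i)
    simp only [Finset.Nat.card_antidiagonal] at h2
    push_cast at h2
    calc _ ≤ 1 / (d : ℝ) * ((k + 1) * ∑ x ∈ antidiagonal k, (M ^ x.1 * B * M ^ x.2) i i ^ 2) := by
          gcongr
      _ = _ := by ring
  refine (Finset.sum_le_sum fun i _ => h3 i).trans ?_
  rw [← Finset.mul_sum, Finset.sum_comm]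
  gcongr with x _
  exact h2 x

/-- A bound for `√d` times the variance of a diagonal entry of the `k`-th power of an
equicorrelated band matrix. -/
noncomputable def varianceBound (c : ℝ) : ℕ → ℝ
  | 0 => 0
  | k + 1 => (k + 1) * ∑ x ∈ antidiagonal k,
      (2 * (momentBound c (2 * x.1) + momentBound c (2 * x.2)) +
        c * (2 + momentBound c (2 * (2 * x.1)) + momentBound c (2 * (2 * x.2))))

theorem momentBound_nonneg (hc : 0 ≤ c) (m : ℕ) : 0 ≤ momentBound c m := by
  induction m with
  | zero => exact zero_le_one
  | succ m ih =>
    rw [momentBound]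
    positivity

namespace EquicorrelatedBand

variable [Nonempty V]

theorem variance_diag_le (h : EquicorrelatedBand B d c ρ E) (k : ℕ) (i : V) :
    E ((bandPoly B d ^ k) i i ^ 2) - meanMoment B d E k ^ 2 ≤ varianceBound c k / √d := by
  have hB := h.regular
  have hG := h.gaussian
  have hd := h.d_pos
  have hs : 0 < √(d : ℝ) := Real.sqrt_pos.2 hd
  cases k with
  | zero =>
    rw [h.meanMoment_zero, pow_zero, Matrix.one_apply_eq, one_pow, hG.one, varianceBound]
    simp
  | succ k =>
    -- The variance is the same at all vertices. Summing over them turns local quantities into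
    -- traces, for which bounds are available.
    refine le_of_mul_le_mul_left ?_ (card_pos V)
    have h1 : ∑ j, (E ((bandPoly B d ^ (k + 1)) j j ^ 2) - E ((bandPoly B d ^ (k + 1)) j j) ^ 2) =
        Fintype.card V * (E ((bandPoly B d ^ (k + 1)) i i ^ 2) -
          meanMoment B d E (k + 1) ^ 2) := by
      simp_rw [fun j => h.expectation_diag_sq_eq (k + 1) j i, h.expectation_diag]
      rw [Finset.sum_const, Finset.card_univ, nsmul_eq_mul]
    rw [← h1]
    have h2 : ∑ j, E (∑ s, pderiv s ((bandPoly B d ^ (k + 1)) j j) ^ 2) ≤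
        E (C (2 * (k + 1) / (d : ℝ)) * ∑ x ∈ antidiagonal k,
          ((bandPoly B d ^ (4 * x.1)).trace + (bandPoly B d ^ (4 * x.2)).trace)) := by
      rw [← map_sum]
      refine hG.mono fun y => ?_
      simp only [map_sum, map_mul, map_add, map_pow, eval_C, eval_trace_bandPoly_pow]
      refine (Finset.sum_le_sum fun j _ => sum_sq_pderiv_diag_le hB y k j).trans_eq ?_
      rw [← Finset.mul_sum, Finset.sum_comm]
      congr 1
      refine Finset.sum_congr rfl fun x _ => ?_
      rw [Finset.sum_add_distrib]
      rfl
    have h3 : ∑ j, E (totalDeriv (Sym2 V) ((bandPoly B d ^ (k + 1)) j j) ^ 2) ≤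
        E (C ((k + 1) / (d : ℝ)) * ∑ x ∈ antidiagonal k,
          (constPoly B * bandPoly B d ^ (2 * x.1) * constPoly B *
            bandPoly B d ^ (2 * x.2)).trace) := by
      rw [← map_sum]
      refine hG.mono fun y => ?_
      simp only [map_sum, map_mul, map_pow, eval_C, eval_trace_eq, mapMatrix_eval_constPoly]
      simp only [← map_pow (eval y).mapMatrix, mapMatrix_eval_bandPoly_pow]
      exact sum_sq_totalDeriv_diag_le hB y k
    have h4 : E (C (2 * (k + 1) / (d : ℝ)) * ∑ x ∈ antidiagonal k,
          ((bandPoly B d ^ (4 * x.1)).trace + (bandPoly B d ^ (4 * x.2)).trace)) ≤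
        Fintype.card V * ((k + 1) * (1 / √d) * ∑ x ∈ antidiagonal k,
          2 * (momentBound c (2 * x.1) + momentBound c (2 * x.2))) := by
      have hnn : ∀ x : ℕ × ℕ, 0 ≤ momentBound c (2 * x.1) + momentBound c (2 * x.2) := fun x =>
        add_nonneg (momentBound_nonneg h.c_nonneg _) (momentBound_nonneg h.c_nonneg _)
      rw [IsGaussianFunctional.map_C_mul, map_sum]
      calc _ ≤ 2 * (k + 1) / (d : ℝ) * ∑ x ∈ antidiagonal k, Fintype.card V *
            (momentBound c (2 * x.1) + momentBound c (2 * x.2)) := by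
            gcongr with x _
            rw [map_add, mul_add]
            exact add_le_add (h.expectation_trace_four_le _) (h.expectation_trace_four_le _)
        _ = Fintype.card V * ((k + 1) * (1 / d) * ∑ x ∈ antidiagonal k,
          2 * (momentBound c (2 * x.1) + momentBound c (2 * x.2))) := by
            simp_rw [← Finset.mul_sum]
            ring
        _ ≤ _ := by
            have := h.inv_le_inv_sqrt
            have hnn' : 0 ≤ ∑ x ∈ antidiagonal k,
              2 * (momentBound c (2 * x.1) + momentBound c (2 * x.2)) :=
              Finset.sum_nonneg fun x _ => mul_nonneg zero_le_two (hnn x)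
            gcongr
    have h5 : ρ * E (C ((k + 1) / (d : ℝ)) * ∑ x ∈ antidiagonal k,
          (constPoly B * bandPoly B d ^ (2 * x.1) * constPoly B *
            bandPoly B d ^ (2 * x.2)).trace) ≤
        Fintype.card V * ((k + 1) * (1 / √d) * ∑ x ∈ antidiagonal k,
          c * (2 + momentBound c (2 * (2 * x.1)) + momentBound c (2 * (2 * x.2)))) := by
      have hnn : 0 ≤ ∑ x ∈ antidiagonal k,
          (2 + momentBound c (2 * (2 * x.1)) + momentBound c (2 * (2 * x.2))) :=
        Finset.sum_nonneg fun x _ => add_nonneg (add_nonneg zero_le_two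
          (momentBound_nonneg h.c_nonneg _)) (momentBound_nonneg h.c_nonneg _)
      rw [IsGaussianFunctional.map_C_mul, map_sum]
      have hρ := h.nonneg
      calc _ ≤ ρ * ((k + 1) / (d : ℝ) * ∑ x ∈ antidiagonal k, d * √d * (Fintype.card V *
            (2 + momentBound c (2 * (2 * x.1)) + momentBound c (2 * (2 * x.2))))) := by
            gcongr with x _
            exact (le_abs_self _).trans (h.abs_expectation_trace_mul_le _ _)
        _ = Fintype.card V * ((k + 1) * (ρ * √d) * ∑ x ∈ antidiagonal k,
            (2 + momentBound c (2 * (2 * x.1)) + momentBound c (2 * (2 * x.2)))) := by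
            simp_rw [← Finset.mul_sum]
            field_simp
        _ ≤ Fintype.card V * ((k + 1) * (c / √d) * ∑ x ∈ antidiagonal k,
            (2 + momentBound c (2 * (2 * x.1)) + momentBound c (2 * (2 * x.2)))) := by
            have := h.mul_sqrt_le
            gcongr
        _ = _ := by
            simp_rw [← Finset.mul_sum]
            ring
    calc _ ≤ ∑ j, (E (∑ s, pderiv s ((bandPoly B d ^ (k + 1)) j j) ^ 2) +
          ρ * E (totalDeriv (Sym2 V) ((bandPoly B d ^ (k + 1)) j j) ^ 2)) :=
          Finset.sum_le_sum fun j _ => hG.variance_le_equicorrelation h.nonneg _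
      _ ≤ Fintype.card V * ((k + 1) * (1 / √d) * ∑ x ∈ antidiagonal k,
          2 * (momentBound c (2 * x.1) + momentBound c (2 * x.2))) +
        Fintype.card V * ((k + 1) * (1 / √d) * ∑ x ∈ antidiagonal k,
          c * (2 + momentBound c (2 * (2 * x.1)) + momentBound c (2 * (2 * x.2)))) := by
          rw [Finset.sum_add_distrib, ← Finset.mul_sum]
          exact add_le_add (h2.trans h4)
            ((mul_le_mul_of_nonneg_left h3 h.nonneg).trans h5)
      _ = _ := by
          rw [varianceBound, Finset.sum_add_distrib]
          ring

/-- A covariance is at most the sum of the two variances, so no decorrelation between distinct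
vertices is required. -/
theorem abs_covariance_le (h : EquicorrelatedBand B d c ρ E) (p q : ℕ) (i j : V) :
    |E ((bandPoly B d ^ p) j j * (bandPoly B d ^ q) i i) - meanMoment B d E p * meanMoment B d E q| ≤
      (varianceBound c p + varianceBound c q) / √d := by
  have hG := h.gaussian
  have key : ∀ f g : MvPolynomial (Sym2 V) ℝ,
      |E (f * g) - E f * E g| ≤ (E (f ^ 2) - E f ^ 2) + (E (g ^ 2) - E g ^ 2) := by
    intro f g
    have e1 : ∀ f g : MvPolynomial (Sym2 V) ℝ,
        E ((f - C (E f)) * (g - C (E g))) = E (f * g) - E f * E g := by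
      intro f g
      have : (f - C (E f)) * (g - C (E g)) =
          f * g - C (E g) * f - C (E f) * g + C (E f * E g) := by
        rw [C_mul]
        ring
      rw [this, map_add, map_sub, map_sub, IsGaussianFunctional.map_C_mul,
        IsGaussianFunctional.map_C_mul, hG.map_C]
      ring
    rw [← e1, pow_two f, pow_two g, pow_two (E f), pow_two (E g), ← e1 f f, ← e1 g g, ← map_add]
    refine hG.abs_le fun y => ?_
    simp only [map_mul, map_add]
    generalize eval y (f - C (E f)) = a
    generalize eval y (g - C (E g)) = b
    rw [_root_.abs_le]
    constructor <;> nlinarith [sq_nonneg (a - b), sq_nonneg (a + b), sq_nonneg a, sq_nonneg b]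
  have h1 := key ((bandPoly B d ^ p) j j) ((bandPoly B d ^ q) i i)
  rw [h.expectation_diag, h.expectation_diag] at h1
  have h2 := h.variance_diag_le p j
  have h3 := h.variance_diag_le q i
  rw [add_div]
  linarith

/-- The mean moments satisfy the recursion of the Catalan numbers up to an error of order
`1 / √d`. -/
theorem abs_meanMoment_sub_le (h : EquicorrelatedBand B d c ρ E) (k : ℕ) :
    |meanMoment B d E (k + 2) -
        ∑ x ∈ antidiagonal k, meanMoment B d E x.1 * meanMoment B d E x.2| ≤
      (∑ x ∈ antidiagonal k, (varianceBound c x.1 + varianceBound c x.2 +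
        (momentBound c x.1 + momentBound c x.2) +
        c * (2 + momentBound c (2 * x.1) + momentBound c (2 * x.2)))) / √d := by
  have hB := h.regular
  have hG := h.gaussian
  have hd := h.d_pos
  have hn := card_pos V
  have hs : 0 < √(d : ℝ) := Real.sqrt_pos.2 hd
  refine le_of_mul_le_mul_left ?_ hn
  nth_rw 1 [← abs_of_pos hn]
  rw [← abs_mul, mul_sub, ← expectation_trace, expectation_trace_bandPoly_pow hB hG,
    Finset.mul_sum, ← Finset.sum_sub_distrib, Finset.sum_div, Finset.mul_sum]
  refine (Finset.abs_sum_le_sum_abs _ _).trans (Finset.sum_le_sum fun x _ => ?_)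
  have h1 : |E (∑ i, ∑ j, C (B i j / d) *
      ((bandPoly B d ^ x.1) j j * (bandPoly B d ^ x.2) i i)) -
        Fintype.card V * (meanMoment B d E x.1 * meanMoment B d E x.2)| ≤
      Fintype.card V * ((varianceBound c x.1 + varianceBound c x.2) / √d) := by
    have hsum : ∀ a : ℝ, Fintype.card V * a = ∑ i : V, ∑ j, B i j / d * a := by
      intro a
      have hr : ∀ i, ∑ j, B i j / d * a = a := fun i => by
        rw [← Finset.sum_mul, ← Finset.sum_div, hB.row_sum, div_self hd.ne', one_mul]
      rw [Finset.sum_congr rfl fun i _ => hr i]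
      simp
    rw [hsum, hsum, map_sum, ← Finset.sum_sub_distrib]
    simp_rw [map_sum, IsGaussianFunctional.map_C_mul, ← Finset.sum_sub_distrib, ← mul_sub]
    refine (Finset.abs_sum_le_sum_abs _ _).trans (Finset.sum_le_sum fun i _ => ?_)
    refine (Finset.abs_sum_le_sum_abs _ _).trans (Finset.sum_le_sum fun j _ => ?_)
    rw [abs_mul, abs_of_nonneg (div_nonneg (hB.nonneg _ _) hd.le)]
    exact mul_le_mul_of_nonneg_left (h.abs_covariance_le _ _ _ _)
      (div_nonneg (hB.nonneg _ _) hd.le)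
  have hmb := fun m => momentBound_nonneg h.c_nonneg m
  have h2 : |E (∑ i, ∑ j, C (B i j / d) *
        if i = j then 0 else (bandPoly B d ^ x.1) j i * (bandPoly B d ^ x.2) j i)| ≤
      Fintype.card V * ((momentBound c x.1 + momentBound c x.2) / √d) := by
    refine (h.abs_offDiagonal_le x.1 x.2).trans ?_
    refine mul_le_mul_of_nonneg_left ?_ hn.le
    rw [← mul_one_div, ← mul_one_div _ (√(d : ℝ))]
    exact mul_le_mul_of_nonneg_left h.inv_le_inv_sqrt (add_nonneg (hmb _) (hmb _))
  have h3 : |ρ / d * E (constPoly B * bandPoly B d ^ x.1 * constPoly B *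
        bandPoly B d ^ x.2).trace| ≤
      Fintype.card V * (c * (2 + momentBound c (2 * x.1) + momentBound c (2 * x.2)) / √d) := by
    rw [abs_mul, abs_of_nonneg (div_nonneg h.nonneg hd.le)]
    calc _ ≤ ρ / d * (d * √d * (Fintype.card V *
          (2 + momentBound c (2 * x.1) + momentBound c (2 * x.2)))) :=
          mul_le_mul_of_nonneg_left (h.abs_expectation_trace_mul_le _ _)
            (div_nonneg h.nonneg hd.le)
      _ = Fintype.card V * ((ρ * √d) * (2 + momentBound c (2 * x.1) + momentBound c (2 * x.2))) := by
          field_simp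
      _ ≤ Fintype.card V * ((c / √d) * (2 + momentBound c (2 * x.1) + momentBound c (2 * x.2))) := by
          have := h.mul_sqrt_le
          have := hmb (2 * x.1)
          have := hmb (2 * x.2)
          gcongr
      _ = _ := by ring
  rw [add_assoc, add_sub_right_comm]
  refine (abs_add_le _ _).trans ?_
  refine (add_le_add h1 ((abs_add_le _ _).trans (add_le_add h2 h3))).trans_eq ?_
  ring

end EquicorrelatedBand

end BandRecursion

/-! ### Limits of the mean moments, reduction of weak to equal correlations, concentration of
traces. -/

section MomentLimits

open MvPolynomial
open Finset.HasAntidiagonal (antidiagonal)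

/-- The mean moments of equicorrelated band matrices are within `O(1 / √d)` of the moments of the
semicircle distribution, which are characterized by the recursion of the Catalan numbers. -/
theorem exists_abs_meanMoment_sub_le (c : ℝ) {m : ℕ → ℝ} (hm0 : m 0 = 1) (hm1 : m 1 = 0)
    (hm : ∀ k, m (k + 2) = ∑ x ∈ antidiagonal k, m x.1 * m x.2) (k : ℕ) :
    ∃ K, 0 ≤ K ∧ ∀ {V : Type} [Fintype V] [DecidableEq V] [Nonempty V] {B : Matrix V V ℝ} {d : ℕ}
      {ρ : ℝ} {E : MvPolynomial (Sym2 V) ℝ →ₗ[ℝ] ℝ}, EquicorrelatedBand B d c ρ E →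
      |meanMoment B d E k - m k| ≤ K / √d := by
  induction k using Nat.strong_induction_on with
  | _ k ih =>
    rcases k with _ | _ | k
    · refine ⟨0, le_rfl, fun h => ?_⟩
      rw [h.meanMoment_zero, hm0]
      simp
    · refine ⟨0, le_rfl, fun h => ?_⟩
      rw [zero_add, h.meanMoment_one, hm1]
      simp
    · choose! K hK0 hK using ih
      set A := ∑ x ∈ antidiagonal k, (varianceBound c x.1 + varianceBound c x.2 +
        (momentBound c x.1 + momentBound c x.2) +
        c * (2 + momentBound c (2 * x.1) + momentBound c (2 * x.2))) with hA
      set A' := ∑ x ∈ antidiagonal k, ((|m x.1| + K x.1) * K x.2 + |m x.2| * K x.1) with hA'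
      refine ⟨|A| + |A'|, by positivity, fun {V _ _ _ B d ρ E} h => ?_⟩
      have hs : 1 ≤ √(d : ℝ) := by
        rw [Real.one_le_sqrt]
        exact_mod_cast h.pos
      have hs0 : 0 < √(d : ℝ) := by linarith
      have h1 := h.abs_meanMoment_sub_le k
      rw [← hA] at h1
      have h2 : |∑ x ∈ antidiagonal k, meanMoment B d E x.1 * meanMoment B d E x.2 -
          ∑ x ∈ antidiagonal k, m x.1 * m x.2| ≤ A' / √d := by
        rw [← Finset.sum_sub_distrib, hA', Finset.sum_div]
        refine (Finset.abs_sum_le_sum_abs _ _).trans (Finset.sum_le_sum fun x hx => ?_)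
        have hx := Finset.HasAntidiagonal.mem_antidiagonal.1 hx
        have hx1 : x.1 < k + 1 + 1 := by omega
        have hx2 : x.2 < k + 1 + 1 := by omega
        have a1 := hK x.1 hx1 h
        have a2 := hK x.2 hx2 h
        have a3 : |meanMoment B d E x.1| ≤ |m x.1| + K x.1 := by
          have e1 := abs_sub_abs_le_abs_sub (meanMoment B d E x.1) (m x.1)
          have e2 : K x.1 / √d ≤ K x.1 := div_le_self (hK0 _ hx1) hs
          linarith
        have e : meanMoment B d E x.1 * meanMoment B d E x.2 - m x.1 * m x.2 =
            meanMoment B d E x.1 * (meanMoment B d E x.2 - m x.2) +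
              m x.2 * (meanMoment B d E x.1 - m x.1) := by ring
        rw [e]
        refine (abs_add_le _ _).trans ?_
        rw [abs_mul, abs_mul, add_div, mul_div_assoc, mul_div_assoc]
        have := hK0 _ hx1
        gcongr
      rw [hm]
      have h3 : A / √d ≤ |A| / √d := div_le_div_of_nonneg_right (le_abs_self _) hs0.le
      have h4 : A' / √d ≤ |A'| / √d := div_le_div_of_nonneg_right (le_abs_self _) hs0.le
      rw [add_div]
      have h5 := abs_sub_le (meanMoment B d E (k + 1 + 1))
        (∑ x ∈ antidiagonal k, meanMoment B d E x.1 * meanMoment B d E x.2)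
        (∑ x ∈ antidiagonal k, m x.1 * m x.2)
      have e6 : k + 1 + 1 = k + 2 := rfl
      rw [e6] at *
      linarith

variable {V : Type} [Fintype V] [DecidableEq V]

/-- A Gaussian functional for the band matrix with vertex transitive adjacency `B`, whose entries
have unit variances and covariances of modulus at most `ρ ≤ c / |V|`. -/
structure WeaklyCorrelatedBand (B : Matrix V V ℝ) (d : ℕ) (c ρ : ℝ) (S : Matrix (Sym2 V) (Sym2 V) ℝ)
    (E : MvPolynomial (Sym2 V) ℝ →ₗ[ℝ] ℝ) : Prop where
  regular : IsRegularAdjacency B d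
  pos : 0 < d
  transitive : ∀ i j, ∃ σ : Equiv.Perm V, σ i = j ∧ ∀ k l, B (σ k) (σ l) = B k l
  nonneg : 0 ≤ ρ
  mul_card_le : ρ * Fintype.card V ≤ c
  posSemidef : S.PosSemidef
  diag : ∀ s, S s s = 1
  offDiag : ∀ s t, s ≠ t → |S s t| ≤ ρ
  gaussian : IsGaussianFunctional S E

variable {B : Matrix V V ℝ} {d : ℕ} {c ρ : ℝ} {S : Matrix (Sym2 V) (Sym2 V) ℝ}
  {E : MvPolynomial (Sym2 V) ℝ →ₗ[ℝ] ℝ}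

theorem hasNonnegCoeffs_trace_bandPoly_pow (hB : IsRegularAdjacency B d) (k : ℕ) :
    HasNonnegCoeffs (bandPoly B d ^ k).trace := by
  refine HasNonnegCoeffs.sum _ fun i _ => HasNonnegCoeffs.matrix_pow (fun i j => ?_) k i i
  exact (HasNonnegCoeffs.C (div_nonneg (hB.nonneg i j) (Real.sqrt_nonneg _))).mul
    (HasNonnegCoeffs.X _)

/-- By cyclicity of the trace, all `k + 1` positions of the differentiated factor contribute
equally. -/
theorem eval_pderiv_trace_bandPoly_pow (hB : IsRegularAdjacency B d) (y : Sym2 V → ℝ) (s : Sym2 V)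
    (k : ℕ) : eval y (pderiv s (bandPoly B d ^ (k + 1)).trace) =
      ∑ u, ∑ v, if s(u, v) = s then B u v / √d * ((k + 1) * (bandEval B d y ^ k) u v) else 0 := by
  have hM := bandEval_isHermitian hB y (d := d)
  rw [Matrix.trace, map_sum, map_sum]
  simp_rw [Matrix.diag_apply, eval_pderiv_bandPoly_pow]
  rw [Finset.sum_comm]
  refine Finset.sum_congr rfl fun u _ => ?_
  rw [Finset.sum_comm]
  refine Finset.sum_congr rfl fun v _ => ?_
  split_ifs
  · rw [← Finset.mul_sum, Finset.sum_comm]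
    congr 1
    have h : ∀ x ∈ antidiagonal k, ∑ i, (bandEval B d y ^ x.1) i u * (bandEval B d y ^ x.2) v i =
        (bandEval B d y ^ k) u v := by
      intro x hx
      rw [pow_apply_comm hM k u v, ← Finset.HasAntidiagonal.mem_antidiagonal.1 hx, add_comm, pow_add,
        Matrix.mul_apply]
      exact Finset.sum_congr rfl fun i _ => mul_comm _ _
    rw [Finset.sum_congr rfl h]
    simp
  · simp

theorem trace_pow_two_mul (hB : IsRegularAdjacency B d) (y : Sym2 V → ℝ) (k : ℕ) :
    (bandEval B d y ^ (2 * k)).trace = ∑ u, ∑ v, (bandEval B d y ^ k) u v ^ 2 :=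
  Finset.sum_congr rfl fun u _ => pow_two_mul_apply_self (bandEval_isHermitian hB y) k u

namespace WeaklyCorrelatedBand

theorem equicorrelated (h : WeaklyCorrelatedBand B d c ρ S E) :
    EquicorrelatedBand B d c ρ (gaussianExpectation (equicorrelation (Sym2 V) ρ)) where
  regular := h.regular
  pos := h.pos
  transitive := h.transitive
  nonneg := h.nonneg
  mul_card_le := h.mul_card_le
  gaussian := isGaussianFunctional_gaussianExpectation (posSemidef_equicorrelation _ h.nonneg)

theorem uncorrelated (h : WeaklyCorrelatedBand B d c ρ S E) :
    EquicorrelatedBand B d c 0 (gaussianExpectation (equicorrelation (Sym2 V) 0)) where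
  regular := h.regular
  pos := h.pos
  transitive := h.transitive
  nonneg := le_rfl
  mul_card_le := by
    rw [zero_mul]
    exact (mul_nonneg h.nonneg (Nat.cast_nonneg _)).trans h.mul_card_le
  gaussian := isGaussianFunctional_gaussianExpectation (posSemidef_equicorrelation _ le_rfl)

variable [Nonempty V]

/-- The trace polynomial has nonnegative coefficients, so the moment comparison applies whatever the
signs of the covariances. Both functionals on the right are equicorrelated and share the Catalan
limit. -/
theorem abs_meanMoment_sub_le (h : WeaklyCorrelatedBand B d c ρ S E) (k : ℕ) :
    |meanMoment B d E k - meanMoment B d (gaussianExpectation (equicorrelation (Sym2 V) 0)) k| ≤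
      meanMoment B d (gaussianExpectation (equicorrelation (Sym2 V) ρ)) k -
        meanMoment B d (gaussianExpectation (equicorrelation (Sym2 V) 0)) k := by
  have h0 := h.uncorrelated.gaussian
  have h1 := h.equicorrelated.gaussian
  simp only [meanMoment]
  rw [← sub_div, ← sub_div, abs_div, abs_of_pos (EquicorrelatedBand.card_pos V)]
  refine div_le_div_of_nonneg_right ?_ (Nat.cast_nonneg _)
  refine h.gaussian.abs_sub_le ?_ h1 h.diag (fun i => ?_) (fun i j hij => ?_)
    (hasNonnegCoeffs_trace_bandPoly_pow h.regular k)
  · rwa [equicorrelation_zero] at h0 ⊢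
  · rw [equicorrelation_apply, Matrix.one_apply_eq]
    linarith [h.nonneg]
  · rw [equicorrelation_apply, Matrix.one_apply_ne hij, zero_add]
    exact h.offDiag i j hij

theorem meanMoment_even_le (h : WeaklyCorrelatedBand B d c ρ S E) (k : ℕ) :
    meanMoment B d E (2 * k) ≤ momentBound c k := by
  have h1 := h.abs_meanMoment_sub_le (2 * k)
  have h2 := h.equicorrelated.meanMoment_even_le k
  have h3 := le_abs_self (meanMoment B d E (2 * k) -
    meanMoment B d (gaussianExpectation (equicorrelation (Sym2 V) 0)) (2 * k))
  linarith

/-- The variance of the normalized trace of a power of a weakly correlated band matrix. -/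
theorem variance_trace_le (h : WeaklyCorrelatedBand B d c ρ S E) (k : ℕ) :
    E ((C (1 / (Fintype.card V : ℝ)) * (bandPoly B d ^ (k + 1)).trace) ^ 2) -
        meanMoment B d E (k + 1) ^ 2 ≤
      (k + 1) ^ 2 * momentBound c k * (2 / (Fintype.card V * d) + ρ) := by
  have hG := h.gaussian
  have hB := h.regular
  have hd : (0 : ℝ) < d := Nat.cast_pos.2 h.pos
  have hn := EquicorrelatedBand.card_pos V
  set p := (bandPoly B d ^ (k + 1)).trace with hp
  have h1 : E (p ^ 2) - E p ^ 2 ≤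
      E (C ((k + 1) ^ 2 * (2 / d + ρ * Fintype.card V)) * (bandPoly B d ^ (2 * k)).trace) := by
    refine (hG.variance_le h.posSemidef p).trans ?_
    have e : ∑ s, ∑ t, S s t * E (pderiv t p * pderiv s p) =
        E (∑ s, ∑ t, C (S s t) * (pderiv t p * pderiv s p)) := by
      simp_rw [map_sum, IsGaussianFunctional.map_C_mul]
    rw [e]
    refine hG.mono fun y => ?_
    simp only [map_sum, map_mul, eval_C, eval_trace_bandPoly_pow]
    set g : Sym2 V → ℝ := fun s => eval y (pderiv s p) with hg
    have hM := bandEval_isHermitian hB y (d := d)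
    set M := bandEval B d y with hMdef
    have hgs : ∀ s, g s = ∑ u, ∑ v, if s(u, v) = s then B u v / √d * ((k + 1) * (M ^ k) u v) else 0 :=
      fun s => eval_pderiv_trace_bandPoly_pow hB y s k
    -- The unit diagonal gives the sum of squares; the rest is bounded by moduli, with no
    -- cancellation used.
    have hS : ∑ s, ∑ t, S s t * (g t * g s) ≤ ∑ s, g s ^ 2 + ρ * (∑ s, |g s|) ^ 2 := by
      have : ∀ s t, S s t * (g t * g s) ≤ (if s = t then g s ^ 2 else 0) + ρ * (|g s| * |g t|) := by
        intro s t
        have hρ := h.nonneg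
        split_ifs with hst
        · subst hst
          rw [h.diag]
          have : 0 ≤ ρ * (|g s| * |g s|) := by positivity
          nlinarith
        · rw [zero_add]
          refine (le_abs_self _).trans ?_
          rw [abs_mul, abs_mul, mul_comm |g t|]
          exact mul_le_mul_of_nonneg_right (h.offDiag s t hst) (by positivity)
      refine (Finset.sum_le_sum fun s _ => Finset.sum_le_sum fun t _ => this s t).trans_eq ?_
      simp_rw [Finset.sum_add_distrib]
      congr 1
      · simp
      · rw [pow_two, Finset.sum_mul_sum]
        simp_rw [Finset.mul_sum]
    have htr := trace_pow_two_mul hB y k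
    rw [← hMdef] at htr
    have h2 : ∑ s, g s ^ 2 ≤ 2 / d * ((k + 1) ^ 2 * (M ^ (2 * k)).trace) := by
      simp_rw [hgs]
      refine (sum_sq_sum_fiber_le _).trans ?_
      rw [htr, Finset.mul_sum, Finset.mul_sum, Finset.mul_sum]
      refine Finset.sum_le_sum fun u _ => ?_
      rw [Finset.mul_sum, Finset.mul_sum, Finset.mul_sum]
      refine Finset.sum_le_sum fun v _ => ?_
      rw [mul_pow, div_pow, Real.sq_sqrt hd.le, hB.sq, mul_pow, div_eq_mul_one_div (2 : ℝ),
        mul_assoc (2 : ℝ)]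
      have := hB.le_one u v
      gcongr
    have h3 : (∑ s, |g s|) ^ 2 ≤ (k + 1) ^ 2 * (Fintype.card V * (M ^ (2 * k)).trace) := by
      have h4 : ∑ s, |g s| ≤ ∑ u, ∑ v, B u v * ((k + 1) / √d * |(M ^ k) u v|) := by
        calc ∑ s, |g s| ≤ ∑ s : Sym2 V, ∑ u, ∑ v,
              if s(u, v) = s then B u v * ((k + 1) / √d * |(M ^ k) u v|) else 0 := by
              refine Finset.sum_le_sum fun s _ => ?_
              rw [hgs]
              refine (Finset.abs_sum_le_sum_abs _ _).trans (Finset.sum_le_sum fun u _ => ?_)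
              refine (Finset.abs_sum_le_sum_abs _ _).trans (Finset.sum_le_sum fun v _ => ?_)
              split_ifs
              · rw [abs_mul, abs_mul, abs_of_nonneg (div_nonneg (hB.nonneg u v) (Real.sqrt_nonneg _)),
                  abs_of_nonneg (by positivity : (0 : ℝ) ≤ k + 1)]
                apply le_of_eq
                ring
              · simp
          _ = _ := by
              rw [Finset.sum_comm]
              refine Finset.sum_congr rfl fun u _ => ?_
              rw [Finset.sum_comm]
              refine Finset.sum_congr rfl fun v _ => ?_
              rw [Finset.sum_ite_eq]
              simp
      -- Cauchy–Schwarz splits off `B`, whose squared entries sum to `|V| * d`; this `d` cancels the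
      -- normalization.
      have h5 : (∑ u, ∑ v, B u v * ((k + 1) / √d * |(M ^ k) u v|)) ^ 2 ≤
          (∑ u, ∑ v, B u v ^ 2) * ∑ u, ∑ v, ((k + 1) / √d * |(M ^ k) u v|) ^ 2 := by
        have := Finset.sum_mul_sq_le_sq_mul_sq (Finset.univ ×ˢ Finset.univ)
          (fun x : V × V => B x.1 x.2) (fun x => (k + 1) / √d * |(M ^ k) x.1 x.2|)
        simpa only [Finset.sum_product] using this
      have h6 : ∑ u, ∑ v, B u v ^ 2 = Fintype.card V * d := by
        have hr : ∀ u, ∑ v, B u v ^ 2 = d := fun u => by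
          rw [← hB.row_sum u]
          exact Finset.sum_congr rfl fun v _ => hB.sq u v
        rw [Finset.sum_congr rfl fun u _ => hr u]
        simp
      calc (∑ s, |g s|) ^ 2 ≤ _ := by
            have : 0 ≤ ∑ s, |g s| := Finset.sum_nonneg fun s _ => abs_nonneg _
            gcongr
        _ ≤ _ := h5
        _ = _ := by
            rw [h6, htr]
            simp_rw [mul_pow, div_pow, Real.sq_sqrt hd.le, sq_abs, ← Finset.mul_sum]
            field_simp
    have hρ := h.nonneg
    calc _ ≤ _ := hS
      _ ≤ 2 / d * ((k + 1) ^ 2 * (M ^ (2 * k)).trace) +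
          ρ * ((k + 1) ^ 2 * (Fintype.card V * (M ^ (2 * k)).trace)) := by
          gcongr
      _ = _ := by ring
  rw [IsGaussianFunctional.map_C_mul, EquicorrelatedBand.expectation_trace E (2 * k)] at h1
  have h2 : E ((C (1 / (Fintype.card V : ℝ)) * p) ^ 2) - meanMoment B d E (k + 1) ^ 2 =
      1 / (Fintype.card V : ℝ) ^ 2 * (E (p ^ 2) - E p ^ 2) := by
    rw [mul_pow, ← map_pow, IsGaussianFunctional.map_C_mul, meanMoment]
    ring
  rw [h2]
  have hρ := h.nonneg
  calc _ ≤ 1 / (Fintype.card V : ℝ) ^ 2 * ((k + 1) ^ 2 * (2 / d + ρ * Fintype.card V) *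
        (Fintype.card V * momentBound c k)) := by
        refine mul_le_mul_of_nonneg_left (h1.trans ?_) (by positivity)
        have := h.meanMoment_even_le k
        gcongr
    _ = _ := by
        field_simp

end WeaklyCorrelatedBand

/-- The mean moments of weakly correlated band matrices are within `O(1 / √d)` of the moments of the
semicircle distribution. -/
theorem WeaklyCorrelatedBand.exists_abs_meanMoment_sub_le (c : ℝ) {m : ℕ → ℝ} (hm0 : m 0 = 1)
    (hm1 : m 1 = 0) (hm : ∀ k, m (k + 2) = ∑ x ∈ antidiagonal k, m x.1 * m x.2) (k : ℕ) :
    ∃ K, 0 ≤ K ∧ ∀ {V : Type} [Fintype V] [DecidableEq V] [Nonempty V] {B : Matrix V V ℝ} {d : ℕ}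
      {ρ : ℝ} {S : Matrix (Sym2 V) (Sym2 V) ℝ} {E : MvPolynomial (Sym2 V) ℝ →ₗ[ℝ] ℝ},
      WeaklyCorrelatedBand B d c ρ S E → |meanMoment B d E k - m k| ≤ K / √d := by
  obtain ⟨K, hK0, hK⟩ := _root_.exists_abs_meanMoment_sub_le c hm0 hm1 hm k
  -- Through the independent case: the comparison costs `2 * K`, and the independent moment is
  -- within another `K` of the limit, all over `√d`.
  refine ⟨3 * K, by positivity, fun h => ?_⟩
  have h1 := h.abs_meanMoment_sub_le k
  have h2 := abs_le.1 (hK h.equicorrelated)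
  have h3 := abs_le.1 (hK h.uncorrelated)
  have h4 := abs_le.1 h1
  rw [mul_div_assoc, abs_le]
  constructor <;> linarith

end MomentLimits

/-! ### The moments of the semicircle distribution -/

section Semicircle

open Finset.HasAntidiagonal (antidiagonal)

/-- The density of the semicircle distribution. -/
noncomputable def semicircleDensity (x : ℝ) : ℝ :=
  (Set.Icc (-2 : ℝ) 2).indicator (fun x => 1 / (2 * Real.pi) * √(4 - x ^ 2)) x

theorem semicircleDensity_nonneg (x : ℝ) : 0 ≤ semicircleDensity x :=
  Set.indicator_nonneg (fun x _ => by positivity) x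

theorem measurable_semicircleDensity : Measurable semicircleDensity :=
  Measurable.indicator (by fun_prop) measurableSet_Icc

theorem semicircleDensity_mul (g : ℝ → ℝ) (x : ℝ) : semicircleDensity x * g x =
    (Set.Icc (-2 : ℝ) 2).indicator (fun x => 1 / (2 * Real.pi) * (g x * √(4 - x ^ 2))) x := by
  by_cases hx : x ∈ Set.Icc (-2 : ℝ) 2
  · rw [semicircleDensity, Set.indicator_of_mem hx, Set.indicator_of_mem hx]
    ring
  · rw [semicircleDensity, Set.indicator_of_notMem hx, Set.indicator_of_notMem hx, zero_mul]

theorem integral_semicircleDistribution (g : ℝ → ℝ) :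
    ∫ x, g x ∂semicircleDistribution =
      1 / (2 * Real.pi) * ∫ x in (-2 : ℝ)..2, g x * √(4 - x ^ 2) := by
  have h1 : semicircleDistribution =
      volume.withDensity fun x => ENNReal.ofReal (semicircleDensity x) := rfl
  rw [h1, integral_withDensity_eq_integral_toReal_smul (by
    exact measurable_semicircleDensity.ennreal_ofReal) (by simp)]
  simp_rw [ENNReal.toReal_ofReal (semicircleDensity_nonneg _), smul_eq_mul, semicircleDensity_mul]
  rw [integral_indicator measurableSet_Icc, integral_Icc_eq_integral_Ioc,
    ← intervalIntegral.integral_of_le (by norm_num), intervalIntegral.integral_const_mul]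

theorem integrable_pow_semicircleDistribution (k : ℕ) :
    Integrable (fun x => x ^ k) semicircleDistribution := by
  have h1 : semicircleDistribution =
      volume.withDensity fun x => ENNReal.ofReal (semicircleDensity x) := rfl
  rw [h1, integrable_withDensity_iff measurable_semicircleDensity.ennreal_ofReal (by simp)]
  simp_rw [ENNReal.toReal_ofReal (semicircleDensity_nonneg _), mul_comm (_ ^ k)]
  simp_rw [semicircleDensity_mul fun x => x ^ k]
  rw [integrable_indicator_iff measurableSet_Icc]
  exact ContinuousOn.integrableOn_Icc (by fun_prop)

/-- The moments of the semicircle distribution. -/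
noncomputable def semicircleMoment (k : ℕ) : ℝ := ∫ x, x ^ k ∂semicircleDistribution

/-- The substitution `x = 2u` reduces the mass to the area of the unit half disc. -/
theorem semicircleMoment_zero : semicircleMoment 0 = 1 := by
  rw [semicircleMoment, integral_semicircleDistribution]
  simp only [pow_zero, one_mul]
  have h := intervalIntegral.integral_comp_mul_left (a := -1) (b := 1)
    (fun x : ℝ => √(4 - x ^ 2)) (two_ne_zero : (2 : ℝ) ≠ 0)
  have h2 : ∀ x : ℝ, √(4 - (2 * x) ^ 2) = 2 * √(1 - x ^ 2) := by
    intro x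
    have : 4 - (2 * x) ^ 2 = 2 ^ 2 * (1 - x ^ 2) := by ring
    rw [this, Real.sqrt_mul (by norm_num), Real.sqrt_sq (by norm_num)]
  simp_rw [h2, intervalIntegral.integral_const_mul, integral_sqrt_one_sub_sq] at h
  norm_num at h
  rw [← sub_eq_zero] at h
  have h3 : ∫ x in (-2 : ℝ)..2, √(4 - x ^ 2) = 2 * Real.pi := by linarith
  rw [h3]
  have := Real.pi_ne_zero
  field_simp

theorem semicircleMoment_one : semicircleMoment 1 = 0 := by
  rw [semicircleMoment, integral_semicircleDistribution]
  have h := intervalIntegral.integral_comp_neg (a := -2) (b := 2)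
    (fun x : ℝ => x ^ 1 * √(4 - x ^ 2))
  have h2 : ∀ x : ℝ, (-x) ^ 1 * √(4 - (-x) ^ 2) = -(x ^ 1 * √(4 - x ^ 2)) := fun x => by
    rw [neg_sq]
    ring
  simp_rw [h2, intervalIntegral.integral_neg, neg_neg] at h
  have h3 : ∫ x in (-2 : ℝ)..2, x ^ 1 * √(4 - x ^ 2) = 0 := by linarith
  rw [h3, mul_zero]

/-- Integrate the derivative of `x ^ (k + 1) * (4 - x ^ 2) ^ (3 / 2)`, which vanishes at both
endpoints. -/
theorem semicircleMoment_add_two (k : ℕ) :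
    (k + 4) * semicircleMoment (k + 2) = 4 * (k + 1) * semicircleMoment k := by
  have hder : ∀ x ∈ Set.Ioo (-2 : ℝ) 2, HasDerivAt
      (fun x : ℝ => x ^ (k + 1) * ((4 - x ^ 2) * √(4 - x ^ 2)))
      (4 * (k + 1) * (x ^ k * √(4 - x ^ 2)) - (k + 4) * (x ^ (k + 2) * √(4 - x ^ 2))) x := by
    intro x hx
    have hpos : 0 < 4 - x ^ 2 := by nlinarith [hx.1, hx.2]
    have h1 : HasDerivAt (fun x : ℝ => 4 - x ^ 2) (-(2 * x)) x := by
      simpa using (hasDerivAt_pow 2 x).const_sub 4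
    have h2 := (hasDerivAt_pow (k + 1) x).mul (h1.mul (h1.sqrt hpos.ne'))
    convert! h2 using 1
    have hs : √(4 - x ^ 2) ≠ 0 := (Real.sqrt_pos.2 hpos).ne'
    have hss : √(4 - x ^ 2) ^ 2 = 4 - x ^ 2 := Real.sq_sqrt hpos.le
    simp only [Nat.cast_add, Nat.cast_one, add_tsub_cancel_right, Pi.mul_apply]
    have h3 : (4 - x ^ 2) * (-(2 * x) / (2 * √(4 - x ^ 2))) = -x * √(4 - x ^ 2) := by
      field_simp
      rw [hss]
    rw [h3]
    ring
  have hint : ∀ j : ℕ, IntervalIntegrable (fun x : ℝ => x ^ j * √(4 - x ^ 2)) volume (-2) 2 :=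
    fun j => Continuous.intervalIntegrable (by fun_prop) _ _
  have h := intervalIntegral.integral_eq_sub_of_hasDerivAt_of_le (by norm_num : (-2 : ℝ) ≤ 2)
    (Continuous.continuousOn (by fun_prop)) hder
    (((hint k).const_mul _).sub ((hint (k + 2)).const_mul _))
  rw [intervalIntegral.integral_sub ((hint k).const_mul _) ((hint (k + 2)).const_mul _),
    intervalIntegral.integral_const_mul, intervalIntegral.integral_const_mul] at h
  norm_num at h
  rw [semicircleMoment, semicircleMoment, integral_semicircleDistribution,
    integral_semicircleDistribution]
  linear_combination -(1 / (2 * Real.pi)) * h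

theorem semicircleMoment_odd (j : ℕ) : semicircleMoment (2 * j + 1) = 0 := by
  induction j with
  | zero => exact semicircleMoment_one
  | succ j ih =>
    have h := semicircleMoment_add_two (2 * j + 1)
    rw [ih, mul_zero] at h
    exact (mul_eq_zero.1 h).resolve_left (by positivity)

theorem semicircleMoment_even (j : ℕ) : semicircleMoment (2 * j) = catalan j := by
  induction j with
  | zero => simp [semicircleMoment_zero]
  | succ j ih =>
    have h := semicircleMoment_add_two (2 * j)
    rw [ih] at h
    have h1 := succ_mul_catalan_eq_centralBinom j
    have h2 := succ_mul_catalan_eq_centralBinom (j + 1)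
    have h3 := Nat.succ_mul_centralBinom_succ j
    rw [← h1, ← h2] at h3
    have h4 : ((j : ℝ) + 1) * ((j + 2) * catalan (j + 1)) =
        (j + 1) * (2 * (2 * j + 1) * catalan j) := by
      have : (((j + 1) * ((j + 1 + 1) * catalan (j + 1)) : ℕ) : ℝ) =
        ((2 * (2 * j + 1) * ((j + 1) * catalan j) : ℕ) : ℝ) := by rw [h3]
      push_cast at this
      linarith
    have h5 := mul_left_cancel₀ (by positivity) h4
    push_cast at h
    have h6 : (2 * (j : ℝ) + 4) * semicircleMoment (2 * j + 2) =
        (2 * (j : ℝ) + 4) * catalan (j + 1) := by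
      rw [h]
      linarith
    exact mul_left_cancel₀ (by positivity) h6

/-- Odd moments vanish, so only pairs of even indices survive, and these form the Catalan
convolution. -/
theorem semicircleMoment_recursion (k : ℕ) : semicircleMoment (k + 2) =
    ∑ x ∈ antidiagonal k, semicircleMoment x.1 * semicircleMoment x.2 := by
  rcases Nat.even_or_odd' k with ⟨j, rfl | rfl⟩
  · have h1 : 2 * j + 2 = 2 * (j + 1) := by ring
    rw [h1, semicircleMoment_even, catalan_succ']
    push_cast
    refine Finset.sum_of_injOn (fun x => (2 * x.1, 2 * x.2)) ?_ ?_ ?_ ?_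
    · intro x _ y _ hxy
      simp only [Prod.mk.injEq] at hxy
      ext <;> omega
    · intro x hx
      simp only [Finset.mem_coe, Finset.HasAntidiagonal.mem_antidiagonal] at hx ⊢
      omega
    · intro x hx hx'
      rw [Finset.HasAntidiagonal.mem_antidiagonal] at hx
      rcases Nat.even_or_odd' x.1 with ⟨a, ha | ha⟩
      · refine absurd ?_ hx'
        refine ⟨(a, j - a), ?_, ?_⟩
        · simp only [Finset.mem_coe, Finset.HasAntidiagonal.mem_antidiagonal]
          omega
        · ext
          · exact ha.symm
          · change 2 * (j - a) = x.2
            omega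
      · rw [ha, semicircleMoment_odd, zero_mul]
    · intro x _
      rw [semicircleMoment_even, semicircleMoment_even]
  · have h1 : 2 * j + 1 + 2 = 2 * (j + 1) + 1 := by ring
    rw [h1, semicircleMoment_odd]
    refine (Finset.sum_eq_zero fun x hx => ?_).symm
    rw [Finset.HasAntidiagonal.mem_antidiagonal] at hx
    rcases Nat.even_or_odd' x.1 with ⟨a, ha | ha⟩
    · have h2 : x.2 = 2 * (j - a) + 1 := by omega
      rw [h2, semicircleMoment_odd, mul_zero]
    · rw [ha, semicircleMoment_odd, zero_mul]

/-- Consecutive even moments have ratio `4 * (2 * j + 1) / (2 * j + 4) ≤ 4`. -/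
theorem semicircleMoment_even_le (j : ℕ) : semicircleMoment (2 * j) ≤ 4 ^ j := by
  induction j with
  | zero => simp [semicircleMoment_zero]
  | succ j ih =>
    have h := semicircleMoment_add_two (2 * j)
    have h0 : 0 ≤ semicircleMoment (2 * j) := by
      rw [semicircleMoment_even]
      positivity
    push_cast at h
    have h1 : (2 * (j : ℝ) + 4) * semicircleMoment (2 * j + 2) ≤
        (2 * (j : ℝ) + 4) * (4 * semicircleMoment (2 * j)) := by
      rw [h]
      nlinarith
    have h2 := le_of_mul_le_mul_left h1 (by positivity)
    have h3 : 2 * (j + 1) = 2 * j + 2 := by ring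
    rw [h3, pow_succ]
    linarith

instance isProbabilityMeasure_semicircleDistribution :
    IsProbabilityMeasure semicircleDistribution := by
  constructor
  have h := semicircleMoment_zero
  simp only [semicircleMoment, pow_zero, integral_const, smul_eq_mul, mul_one, Measure.real] at h
  rwa [ENNReal.toReal_eq_one_iff] at h

end Semicircle

/-! ### The method of moments -/

section MethodOfMoments

theorem integrable_polynomial {ν : Measure ℝ} (hν : ∀ k : ℕ, Integrable (fun x => x ^ k) ν)
    (p : Polynomial ℝ) : Integrable (fun x => p.eval x) ν := by
  simp_rw [Polynomial.eval_eq_sum_range]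
  exact integrable_finsetSum _ fun i _ => (hν i).const_mul _

theorem integral_polynomial {ν : Measure ℝ} (hν : ∀ k : ℕ, Integrable (fun x => x ^ k) ν)
    (p : Polynomial ℝ) : ∫ x, p.eval x ∂ν =
      ∑ i ∈ Finset.range (p.natDegree + 1), p.coeff i * ∫ x, x ^ i ∂ν := by
  simp_rw [Polynomial.eval_eq_sum_range]
  rw [integral_finsetSum _ fun i _ => (hν i).const_mul _]
  simp_rw [integral_const_mul]

/-- Weierstrass on `[-3, 3]`, strictly larger than the support. Outside, the error grows at most
like a fixed power of `|x|`, which the last term absorbs for large `M` because `(9 / 4) ^ M` is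
unbounded. Its normalization keeps its integral at most `η` whenever the moment of order `2 * M` is
at most `2 * 4 ^ M`. -/
theorem exists_abs_sub_polynomial_le (f : BoundedContinuousFunction ℝ ℝ) {η : ℝ} (hη : 0 < η) :
    ∃ (p : Polynomial ℝ) (M : ℕ), ∀ x, |f x - p.eval x| ≤ η + η / (2 * 4 ^ M) * x ^ (2 * M) := by
  obtain ⟨p, hp⟩ := exists_polynomial_near_of_continuousOn (-3) 3 f f.continuous.continuousOn η hη
  set D := p.natDegree
  set C := ‖f‖ + ∑ i ∈ Finset.range (D + 1), |p.coeff i| with hC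
  have hC0 : 0 ≤ C := add_nonneg (norm_nonneg _) (Finset.sum_nonneg fun i _ => abs_nonneg _)
  have hgrow : ∀ x : ℝ, 1 ≤ |x| → |f x - p.eval x| ≤ C * |x| ^ D := by
    intro x hx
    have h1 : |f x| ≤ ‖f‖ * |x| ^ D :=
      (f.norm_coe_le_norm x).trans (le_mul_of_one_le_right (norm_nonneg _) (one_le_pow₀ hx))
    have h2 : |p.eval x| ≤ (∑ i ∈ Finset.range (D + 1), |p.coeff i|) * |x| ^ D := by
      rw [Polynomial.eval_eq_sum_range, Finset.sum_mul]
      refine (Finset.abs_sum_le_sum_abs _ _).trans (Finset.sum_le_sum fun i hi => ?_)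
      rw [abs_mul, abs_pow]
      have : i ≤ D := Nat.lt_succ_iff.1 (Finset.mem_range.1 hi)
      gcongr
    rw [hC, add_mul]
    exact (abs_sub _ _).trans (add_le_add h1 h2)
  obtain ⟨M, hM⟩ : ∃ M : ℕ, D ≤ 2 * M ∧ 2 * C * 3 ^ D * (4 / 9 : ℝ) ^ M ≤ η := by
    have ht : Tendsto (fun M : ℕ => 2 * C * 3 ^ D * (4 / 9 : ℝ) ^ M) atTop (𝓝 0) := by
      simpa using (tendsto_pow_atTop_nhds_zero_of_lt_one (by norm_num : (0 : ℝ) ≤ 4 / 9)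
        (by norm_num)).const_mul (2 * C * 3 ^ D)
    obtain ⟨M, h1, h2⟩ := ((ht.eventually_le_const hη).and (eventually_ge_atTop D)).exists
    exact ⟨M, by omega, h1⟩
  refine ⟨p, M, fun x => ?_⟩
  have hnn : 0 ≤ η / (2 * 4 ^ M) * x ^ (2 * M) := by
    rw [pow_mul]
    positivity
  rcases le_total |x| 3 with hx | hx
  · have := hp x (abs_le.1 hx)
    rw [abs_sub_comm] at this
    linarith
  · have h1 := hgrow x (by linarith)
    have h2 : C * |x| ^ D ≤ η / (2 * 4 ^ M) * x ^ (2 * M) := by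
      have e1 : x ^ (2 * M) = |x| ^ D * |x| ^ (2 * M - D) := by
        rw [← pow_add, Nat.add_sub_cancel' hM.1, (even_two_mul M).pow_abs]
      have e2 : (3 : ℝ) ^ (2 * M - D) ≤ |x| ^ (2 * M - D) := by gcongr
      have e3 : (3 : ℝ) ^ D * 3 ^ (2 * M - D) = 9 ^ M := by
        rw [← pow_add, Nat.add_sub_cancel' hM.1, pow_mul]
        norm_num
      have e4 : C ≤ η / (2 * 4 ^ M) * 3 ^ (2 * M - D) := by
        rw [div_mul_eq_mul_div, le_div_iff₀ (by positivity)]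
        have h9 : (0 : ℝ) < 9 ^ M := by positivity
        have := hM.2
        rw [div_pow, ← e3] at this
        have h3 : (0 : ℝ) < 3 ^ D := by positivity
        have h3' : (0 : ℝ) < 3 ^ (2 * M - D) := by positivity
        field_simp at this
        linarith
      rw [e1]
      calc C * |x| ^ D ≤ (η / (2 * 4 ^ M) * 3 ^ (2 * M - D)) * |x| ^ D := by gcongr
        _ ≤ (η / (2 * 4 ^ M) * |x| ^ (2 * M - D)) * |x| ^ D := by gcongr
        _ = _ := by ring
    linarith

/-- A quantitative form of the method of moments for the semicircle distribution: if finitely many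
moments of a probability measure are close to the moments of the semicircle distribution, then so is
the integral of a given bounded continuous function. -/
theorem exists_moments_close (f : BoundedContinuousFunction ℝ ℝ) {ε : ℝ} (hε : 0 < ε) :
    ∃ (N : ℕ) (δ : ℝ), 0 < δ ∧ ∀ ν : Measure ℝ, IsProbabilityMeasure ν →
      (∀ k : ℕ, Integrable (fun x => x ^ k) ν) →
      (∀ k ∈ Finset.range N, |∫ x, x ^ k ∂ν - semicircleMoment k| < δ) →
      |∫ x, f x ∂ν - ∫ x, f x ∂semicircleDistribution| < ε := by
  obtain ⟨p, M, hpM⟩ := exists_abs_sub_polynomial_le f (η := ε / 6) (by positivity)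
  set A := ∑ i ∈ Finset.range (p.natDegree + 1), |p.coeff i| with hA
  have hA0 : 0 ≤ A := Finset.sum_nonneg fun i _ => abs_nonneg _
  -- The tolerance 1 keeps the moment of order `2 * M` below `4 ^ M + 1 ≤ 2 * 4 ^ M`; the other
  -- makes the integrals of `p` differ by at most `ε / 6`, with `A + 1` avoiding a zero denominator.
  refine ⟨max (p.natDegree + 1) (2 * M + 1), min 1 (ε / 6 / (A + 1)), by positivity, ?_⟩
  have happrox : ∀ ν : Measure ℝ, IsProbabilityMeasure ν →
      (∀ k : ℕ, Integrable (fun x => x ^ k) ν) → ∫ x, x ^ (2 * M) ∂ν ≤ 2 * 4 ^ M →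
      |∫ x, f x ∂ν - ∫ x, p.eval x ∂ν| ≤ 2 * (ε / 6) := by
    intro ν _ hν hM
    have hf : Integrable f ν := f.integrable ν
    rw [← integral_sub hf (integrable_polynomial hν p)]
    refine abs_integral_le_integral_abs.trans ?_
    refine (integral_mono (hf.sub (integrable_polynomial hν p)).abs
      ((integrable_const _).add ((hν (2 * M)).const_mul _)) hpM).trans ?_
    rw [integral_add' (integrable_const _) ((hν (2 * M)).const_mul _), integral_const_mul]
    simp only [integral_const, probReal_univ, one_smul]
    have h4 : (0 : ℝ) < 2 * 4 ^ M := by positivity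
    have : ε / 6 / (2 * 4 ^ M) * ∫ x, x ^ (2 * M) ∂ν ≤ ε / 6 / (2 * 4 ^ M) * (2 * 4 ^ M) := by
      gcongr
    rw [div_mul_cancel₀ _ h4.ne'] at this
    linarith
  intro ν hνp hν hclose
  have h4 : (1 : ℝ) ≤ 4 ^ M := one_le_pow₀ (by norm_num)
  have h1 := happrox ν hνp hν (by
    have e := hclose (2 * M) (Finset.mem_range.2 (by omega))
    have e1 := (abs_lt.1 (e.trans_le (min_le_left _ _))).2
    have e2 := semicircleMoment_even_le M
    linarith)
  have h2 := happrox semicircleDistribution inferInstance integrable_pow_semicircleDistribution (by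
    have e2 := semicircleMoment_even_le M
    rw [semicircleMoment] at e2
    linarith)
  have h3 : |∫ x, p.eval x ∂ν - ∫ x, p.eval x ∂semicircleDistribution| ≤ ε / 6 := by
    rw [integral_polynomial hν, integral_polynomial integrable_pow_semicircleDistribution,
      ← Finset.sum_sub_distrib]
    calc _ ≤ ∑ i ∈ Finset.range (p.natDegree + 1), |p.coeff i| * (ε / 6 / (A + 1)) := by
          refine (Finset.abs_sum_le_sum_abs _ _).trans (Finset.sum_le_sum fun i hi => ?_)
          rw [← mul_sub, abs_mul]
          have := hclose i (Finset.mem_range.2 ((Finset.mem_range.1 hi).trans_le (le_max_left _ _)))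
          exact mul_le_mul_of_nonneg_left ((this.trans_le (min_le_right _ _)).le) (abs_nonneg _)
      _ = A * (ε / 6 / (A + 1)) := by rw [← Finset.sum_mul]
      _ ≤ (A + 1) * (ε / 6 / (A + 1)) := by gcongr; linarith
      _ = _ := by field_simp
  rw [abs_le] at h1 h2 h3
  rw [abs_lt]
  constructor <;> linarith

end MethodOfMoments

/-! ### The periodic band as a regular vertex-transitive graph, and the law of its entries. -/

section PeriodicBand

open MvPolynomial

theorem isRelevant_comm {n b : ℕ} (i j : Fin n) : IsRelevant b i j ↔ IsRelevant b j i := by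
  simp only [IsRelevant, abs_sub_comm (j : ℤ) (i : ℤ)]

/-- Relevance depends on the cyclic difference of the indices only. -/
theorem isRelevant_iff_val_sub {n h : ℕ} (hn : 2 * h + 1 < n) (i j : Fin n) :
    IsRelevant (2 * h + 1) i j ↔ ((j - i : Fin n) : ℕ) ≤ h ∨ n ≤ ((j - i : Fin n) : ℕ) + h := by
  have e : (((2 * h + 1 : ℕ) : ℤ) - 1) / 2 = h := by
    push_cast
    omega
  rw [IsRelevant, e]
  have hi := i.isLt
  have hj := j.isLt
  rcases le_or_gt i j with hij | hij
  · have hv := Fin.coe_sub_iff_le.2 hij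
    have hij' : (i : ℕ) ≤ j := hij
    rw [abs_of_nonpos (by omega)]
    omega
  · have hv := Fin.coe_sub_iff_lt.2 hij
    have hij' : (j : ℕ) < i := hij
    rw [abs_of_pos (by omega)]
    omega

open Classical in
/-- The indicator matrix of the periodic band of width `b`. -/
noncomputable def bandAdjacency (n b : ℕ) : Matrix (Fin n) (Fin n) ℝ :=
  Matrix.of fun i j => if IsRelevant b i j then 1 else 0

theorem card_filter_cyclic_ball {n h : ℕ} (hn : 2 * h + 1 < n) :
    ((Finset.range n).filter fun k => k ≤ h ∨ n ≤ k + h).card = 2 * h + 1 := by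
  have e : ((Finset.range n).filter fun k => k ≤ h ∨ n ≤ k + h) =
      Finset.range (h + 1) ∪ Finset.Ico (n - h) n := by
    ext k
    simp only [Finset.mem_filter, Finset.mem_range, Finset.mem_union, Finset.mem_Ico]
    omega
  rw [e, Finset.card_union_of_disjoint, Finset.card_range, Nat.card_Ico]
  · omega
  · rw [Finset.disjoint_left]
    intro k
    simp only [Finset.mem_range, Finset.mem_Ico]
    omega

theorem bandAdjacency_row_sum {n b : ℕ} [NeZero n] (hb : IsBandwidth n b) (i : Fin n) :
    ∑ j, bandAdjacency n b i j = b := by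
  classical
  rcases hb with ⟨⟨h, rfl⟩, hn⟩ | rfl
  · have e : ∀ j, bandAdjacency n (2 * h + 1) i j =
        (fun k : Fin n => if (k : ℕ) ≤ h ∨ n ≤ k + h then (1 : ℝ) else 0) (Equiv.subRight i j) :=
      fun j => by
        simp only [bandAdjacency, Matrix.of_apply, Equiv.subRight_apply, isRelevant_iff_val_sub hn]
    rw [Finset.sum_congr rfl fun j _ => e j, Equiv.sum_comp (Equiv.subRight i)
      (fun k : Fin n => if (k : ℕ) ≤ h ∨ n ≤ k + h then (1 : ℝ) else 0), Fin.sum_univ_eq_sum_range (fun k => if k ≤ h ∨ n ≤ k + h then (1 : ℝ) else 0),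
      Finset.sum_boole, card_filter_cyclic_ball hn]
  · simp [bandAdjacency, IsRelevant]

theorem isRegularAdjacency_bandAdjacency {n b : ℕ} [NeZero n] (hb : IsBandwidth n b) :
    IsRegularAdjacency (bandAdjacency n b) b where
  symm := by
    ext i j
    by_cases h : IsRelevant b i j
    · simp [bandAdjacency, h, (isRelevant_comm i j).1 h]
    · simp [bandAdjacency, h, mt (isRelevant_comm j i).1 h]
  zero_or_one i j := by
    by_cases h : IsRelevant b i j <;> simp [bandAdjacency, h]
  row_sum := bandAdjacency_row_sum hb

/-- Translations of the cyclic group act transitively on indices. Here, and in the constancy of the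
row sums, the band has to be periodic. -/
theorem bandAdjacency_transitive {n b : ℕ} [NeZero n] (hb : IsBandwidth n b) (i j : Fin n) :
    ∃ σ : Equiv.Perm (Fin n), σ i = j ∧
      ∀ k l, bandAdjacency n b (σ k) (σ l) = bandAdjacency n b k l := by
  refine ⟨Equiv.addRight (j - i), by simp, fun k l => ?_⟩
  rcases hb with ⟨⟨h, rfl⟩, hn⟩ | rfl
  · simp only [bandAdjacency, Matrix.of_apply, isRelevant_iff_val_sub hn, Equiv.coe_addRight,
      add_sub_add_right_eq_sub]
  · simp [bandAdjacency, IsRelevant]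

theorem IsTriangleEnumeration.apply_comm {n : ℕ} {φ : Fin n × Fin n → Fin (triangleCard n)}
    (hφ : IsTriangleEnumeration φ) (i j : Fin n) : φ (i, j) = φ (j, i) := by
  rcases lt_trichotomy i j with h | rfl | h
  · exact (hφ.symm j i h).symm
  · rfl
  · exact hφ.symm i j h

/-- The enumeration of unordered pairs given by a triangle enumeration. -/
noncomputable def IsTriangleEnumeration.equiv {n : ℕ} {φ : Fin n × Fin n → Fin (triangleCard n)}
    (hφ : IsTriangleEnumeration φ) : Sym2 (Fin n) ≃ Fin (triangleCard n) :=
  Equiv.ofBijective (Sym2.lift ⟨fun i j => φ (i, j), hφ.apply_comm⟩) <| by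
    constructor
    · have key : ∀ s : Sym2 (Fin n), ∃ i j, i ≤ j ∧ s = s(i, j) := fun s =>
        Sym2.inductionOn s fun i j => (le_total i j).elim (fun h => ⟨i, j, h, rfl⟩)
          fun h => ⟨j, i, h, Sym2.eq_swap⟩
      intro s t hst
      obtain ⟨i, j, hij, rfl⟩ := key s
      obtain ⟨k, l, hkl, rfl⟩ := key t
      have := hφ.bijOn.injOn (x₁ := (i, j)) hij (x₂ := (k, l)) hkl hst
      simp only [Prod.mk.injEq] at this
      rw [this.1, this.2]
    · intro r
      obtain ⟨p, -, hp⟩ := hφ.bijOn.surjOn (Set.mem_univ r)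
      exact ⟨s(p.1, p.2), hp⟩

theorem IsTriangleEnumeration.equiv_mk {n : ℕ} {φ : Fin n × Fin n → Fin (triangleCard n)}
    (hφ : IsTriangleEnumeration φ) (i j : Fin n) : hφ.equiv s(i, j) = φ (i, j) := rfl

theorem periodicBandMatrix_eq_bandEval {n b : ℕ} {φ : Fin n × Fin n → Fin (triangleCard n)}
    (hφ : IsTriangleEnumeration φ) (y : EuclideanSpace ℝ (Fin (triangleCard n))) :
    periodicBandMatrix b (filledMatrix φ y) =
      bandEval (bandAdjacency n b) b (fun s => y (hφ.equiv s)) := by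
  ext i j
  by_cases h : IsRelevant b i j <;>
    simp [periodicBandMatrix, filledMatrix, bandEval, bandAdjacency, h, hφ.equiv_mk]

theorem triangleCard_bounds {n : ℕ} (hn : 1 ≤ n) :
    1 ≤ triangleCard n ∧ n ^ 2 ≤ 2 * triangleCard n := by
  have h : 2 * triangleCard n = n * (n + 1) :=
    Nat.mul_div_cancel' (Nat.even_mul_succ_self n).two_dvd
  constructor <;> nlinarith

/-- Since `n ^ 2 ≤ 2 * triangleCard n`, the covariance bound in terms of the number of entries is of
order `n ^ (-2α)`. -/
theorem one_div_triangleCard_rpow_le {α : ℝ} (hα : 0 ≤ α) {n : ℕ} (hn : 1 ≤ n) :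
    1 / (triangleCard n : ℝ) ^ α ≤ 2 ^ α * (1 / (n : ℝ) ^ (2 * α)) := by
  have h2 : (n : ℝ) ^ 2 ≤ 2 * triangleCard n := by exact_mod_cast (triangleCard_bounds hn).2
  have h3 : (0 : ℝ) < triangleCard n := by
    exact_mod_cast (triangleCard_bounds hn).1
  have hn0 : (0 : ℝ) < n := by exact_mod_cast hn
  have h4 := Real.rpow_le_rpow (by positivity) h2 hα
  rw [Real.mul_rpow zero_le_two h3.le, ← Real.rpow_natCast, ← Real.rpow_mul hn0.le] at h4
  push_cast at h4
  rw [mul_one_div, div_le_div_iff₀ (by positivity) (by positivity)]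
  linarith

/-- For `α ≥ 1 / 2` the covariances are of order `1 / n`. -/
theorem one_div_triangleCard_rpow_mul_le {α : ℝ} (hα : 1 / 2 ≤ α) {n : ℕ} (hn : 1 ≤ n) :
    1 / (triangleCard n : ℝ) ^ α * n ≤ 2 := by
  have h1 : (1 : ℝ) ≤ triangleCard n := by exact_mod_cast (triangleCard_bounds hn).1
  have hn0 : (0 : ℝ) < n := by exact_mod_cast hn
  have h := one_div_triangleCard_rpow_le (α := 1 / 2) (by norm_num) hn
  have e : (n : ℝ) ^ (2 * (1 / 2) : ℝ) = n := by norm_num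
  rw [e] at h
  have h2 : (2 : ℝ) ^ (1 / 2 : ℝ) ≤ 2 := by
    conv_rhs => rw [← Real.rpow_one 2]
    exact Real.rpow_le_rpow_of_exponent_le one_le_two (by norm_num)
  have h3 : 1 / (triangleCard n : ℝ) ^ α ≤ 1 / (triangleCard n : ℝ) ^ (1 / 2 : ℝ) :=
    one_div_le_one_div_of_le (by positivity) (Real.rpow_le_rpow_of_exponent_le h1 hα)
  calc 1 / (triangleCard n : ℝ) ^ α * n ≤ 2 ^ (1 / 2 : ℝ) * (1 / n) * n := by
        gcongr
        exact h3.trans h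
    _ = 2 ^ (1 / 2 : ℝ) := by field_simp
    _ ≤ 2 := h2

/-- The expectation of polynomials in the independent entries of the random matrix. -/
noncomputable def entryExpectation {n : ℕ} {φ : Fin n × Fin n → Fin (triangleCard n)}
    (hφ : IsTriangleEnumeration φ) (S : Matrix (Fin (triangleCard n)) (Fin (triangleCard n)) ℝ) :
    MvPolynomial (Sym2 (Fin n)) ℝ →ₗ[ℝ] ℝ :=
  gaussianExpectation S ∘ₗ (rename hφ.equiv).toLinearMap

/-- The constant 2 bounds `n / triangleCard n ^ α`; this is where `α ≥ 1 / 2` enters. -/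
theorem weaklyCorrelatedBand_entryExpectation {α : ℝ} (hα : 1 / 2 ≤ α)
    {S : ∀ n : ℕ, Matrix (Fin n) (Fin n) ℝ} (hS : IsCovMatSeq α S) {n b : ℕ} [NeZero n]
    {φ : Fin n × Fin n → Fin (triangleCard n)} (hφ : IsTriangleEnumeration φ)
    (hb : IsBandwidth n b) :
    WeaklyCorrelatedBand (bandAdjacency n b) b 2 (1 / (triangleCard n : ℝ) ^ α)
      ((S (triangleCard n)).submatrix hφ.equiv hφ.equiv)
      (entryExpectation hφ (S (triangleCard n))) where
  regular := isRegularAdjacency_bandAdjacency hb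
  pos := by
    rcases hb with ⟨h, -⟩ | rfl
    · exact h.pos
    · exact NeZero.pos _
  transitive := bandAdjacency_transitive hb
  nonneg := by positivity
  mul_card_le := by
    rw [Fintype.card_fin]
    exact one_div_triangleCard_rpow_mul_le hα NeZero.one_le
  posSemidef := (hS.posDef _).posSemidef.submatrix _
  diag s := hS.diag _ _
  offDiag s t hst := hS.offDiag _ _ _ (hφ.equiv.injective.ne hst)
  gaussian := (isGaussianFunctional_gaussianExpectation (hS.posDef _).posSemidef).comp_rename _

variable {Ω : Type*} [MeasurableSpace Ω] {P : Measure Ω}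

theorem integrable_eval_of_hasLaw {n : ℕ} {φ : Fin n × Fin n → Fin (triangleCard n)}
    (hφ : IsTriangleEnumeration φ) {S : Matrix (Fin (triangleCard n)) (Fin (triangleCard n)) ℝ}
    {Y : Ω → EuclideanSpace ℝ (Fin (triangleCard n))} (hY : HasLaw Y (multivariateGaussian 0 S) P)
    (p : MvPolynomial (Sym2 (Fin n)) ℝ) :
    Integrable (fun ω => eval (fun s => Y ω (hφ.equiv s)) p) P ∧
      ∫ ω, eval (fun s => Y ω (hφ.equiv s)) p ∂P = entryExpectation hφ S p := by
  have e : ∀ y : EuclideanSpace ℝ (Fin (triangleCard n)),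
      eval (fun s => y (hφ.equiv s)) p = eval y.ofLp (rename hφ.equiv p) := fun y => by
    rw [eval_rename]; rfl
  simp_rw [e]
  have hi := integrable_eval_multivariateGaussian S (rename hφ.equiv p)
  constructor
  · rw [← hY.map_eq] at hi
    exact hi.comp_aemeasurable hY.aemeasurable
  · change _ = gaussianExpectation S (rename hφ.equiv p)
    rw [gaussianExpectation_apply, ← hY.map_eq, integral_map hY.aemeasurable
      (measurable_eval _).aestronglyMeasurable]

/-- The second moment of the deviation of the empirical moment from its mean. -/
theorem lintegral_sq_trace_sub_meanMoment_le [IsProbabilityMeasure P] {α : ℝ} (hα : 1 / 2 ≤ α)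
    {S : ∀ n : ℕ, Matrix (Fin n) (Fin n) ℝ} (hS : IsCovMatSeq α S) {n b : ℕ} [NeZero n]
    {φ : Fin n × Fin n → Fin (triangleCard n)} (hφ : IsTriangleEnumeration φ)
    (hb : IsBandwidth n b) {Y : Ω → EuclideanSpace ℝ (Fin (triangleCard n))}
    (hY : HasLaw Y (multivariateGaussian 0 (S (triangleCard n))) P) (k : ℕ) :
    ∫⁻ ω, ENNReal.ofReal (((periodicBandMatrix b (filledMatrix φ (Y ω)) ^ k).trace / n -
        meanMoment (bandAdjacency n b) b (entryExpectation hφ (S (triangleCard n))) k) ^ 2) ∂P ≤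
      ENNReal.ofReal (k ^ 2 * momentBound 2 (k - 1) *
        (2 / (n * b) + 1 / (triangleCard n : ℝ) ^ α)) := by
  have hW := weaklyCorrelatedBand_entryExpectation hα hS hφ hb
  set E := entryExpectation hφ (S (triangleCard n))
  set μ := meanMoment (bandAdjacency n b) b E k with hμ
  set q : MvPolynomial (Sym2 (Fin n)) ℝ :=
    C (1 / (n : ℝ)) * (bandPoly (bandAdjacency n b) b ^ k).trace with hq
  have hEq : E q = μ := by
    rw [hq, IsGaussianFunctional.map_C_mul, hμ, meanMoment, Fintype.card_fin]
    ring
  have e : ∀ ω, ((periodicBandMatrix b (filledMatrix φ (Y ω)) ^ k).trace / n - μ) ^ 2 =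
      eval (fun s => Y ω (hφ.equiv s)) ((q - C μ) ^ 2) := fun ω => by
    rw [periodicBandMatrix_eq_bandEval hφ, map_pow, map_sub, hq, map_mul, eval_C, eval_C,
      eval_trace_bandPoly_pow]
    ring
  simp_rw [e]
  obtain ⟨h1, h2⟩ := integrable_eval_of_hasLaw hφ hY ((q - C μ) ^ 2)
  rw [← ofReal_integral_eq_lintegral_ofReal h1 (Eventually.of_forall fun ω => by
    simp only [map_pow, Pi.zero_apply]; positivity), h2]
  refine ENNReal.ofReal_le_ofReal ?_
  have e2 : (q - C μ) ^ 2 = q ^ 2 + C (-2 * μ) * q + C (μ ^ 2) * 1 := by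
    simp only [map_mul, map_pow, map_neg, map_ofNat]
    ring
  have e3 : E ((q - C μ) ^ 2) = E (q ^ 2) - μ ^ 2 := by
    rw [e2, map_add, map_add, IsGaussianFunctional.map_C_mul E (-2 * μ) q,
      IsGaussianFunctional.map_C_mul E (μ ^ 2) 1, hEq, hW.gaussian.one]
    ring
  rw [e3]
  -- For `k = 0` the normalized trace is constant and both sides vanish, so the truncated `k - 1`
  -- does not matter.
  rcases k with _ | k
  · have : q = 1 := by
      rw [hq, pow_zero, Matrix.trace_one, Fintype.card_fin, ← C_eq_coe_nat, ← C_mul, one_div,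
        inv_mul_cancel₀ (NeZero.ne _), C_1]
    rw [← hEq, this, one_pow, hW.gaussian.one]
    simp
  · have h := hW.variance_trace_le k
    rw [Fintype.card_fin] at h
    simpa only [Nat.add_sub_cancel, Nat.cast_add, Nat.cast_one] using h

end PeriodicBand

/-! ### From concentrating moments to weak convergence in probability and almost surely. -/

section Convergence

variable {Ω : Type*} [MeasurableSpace Ω] {P : Measure Ω}

/-- Chebyshev's inequality for a sequence with vanishing second moments. -/
theorem tendsto_measure_le_abs {D : ℕ → Ω → ℝ} {v : ℕ → ℝ} (hD : ∀ n, 1 ≤ n → AEMeasurable (D n) P)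
    (hv : ∀ n, 1 ≤ n → ∫⁻ ω, ENNReal.ofReal (D n ω ^ 2) ∂P ≤ ENNReal.ofReal (v n))
    (hv0 : Tendsto v atTop (𝓝 0)) {δ : ℝ} (hδ : 0 < δ) :
    Tendsto (fun n => P {ω | δ ≤ |D n ω|}) atTop (𝓝 0) := by
  have hδ2 : ENNReal.ofReal (δ ^ 2) ≠ 0 := (ENNReal.ofReal_pos.2 (by positivity)).ne'
  have h0 : Tendsto (fun n => ENNReal.ofReal (v n) / ENNReal.ofReal (δ ^ 2)) atTop (𝓝 0) := by
    have h1 := ENNReal.tendsto_ofReal hv0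
    rw [ENNReal.ofReal_zero] at h1
    simpa using ENNReal.Tendsto.div_const h1 (Or.inr hδ2)
  refine tendsto_of_tendsto_of_tendsto_of_le_of_le' tendsto_const_nhds h0
    (Eventually.of_forall fun n => zero_le) ?_
  filter_upwards [eventually_ge_atTop 1] with n hn
  have h2 : {ω | δ ≤ |D n ω|} ⊆ {ω | ENNReal.ofReal (δ ^ 2) ≤ ENNReal.ofReal (D n ω ^ 2)} := by
    intro ω hω
    refine ENNReal.ofReal_le_ofReal ?_
    rw [← sq_abs (D n ω)]
    exact pow_le_pow_left₀ hδ.le hω 2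
  refine (measure_mono h2).trans ((meas_ge_le_lintegral_div
    ((hD n hn).pow_const 2).ennreal_ofReal hδ2 ENNReal.ofReal_ne_top).trans ?_)
  gcongr
  exact hv n hn

/-- A sequence with summable second moments tends to zero almost surely. -/
theorem ae_tendsto_zero_of_summable {D : ℕ → Ω → ℝ} {v : ℕ → ℝ}
    (hD : ∀ n, 1 ≤ n → AEMeasurable (D n) P)
    (hv : ∀ n, 1 ≤ n → ∫⁻ ω, ENNReal.ofReal (D n ω ^ 2) ∂P ≤ ENNReal.ofReal (v n))
    (hs : Summable v) : ∀ᵐ ω ∂P, Tendsto (fun n => D n ω) atTop (𝓝 0) := by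
  have hm : ∀ n, AEMeasurable (fun ω => ENNReal.ofReal (D (n + 1) ω ^ 2)) P := fun n =>
    ((hD (n + 1) (by omega)).pow_const 2).ennreal_ofReal
  -- By Tonelli the expected sum of squares is finite, whatever the joint law for different `n`.
  -- Indices are shifted because the bounds start at 1.
  have h1 : ∫⁻ ω, ∑' n, ENNReal.ofReal (D (n + 1) ω ^ 2) ∂P ≠ ⊤ := by
    rw [lintegral_tsum hm]
    exact ne_top_of_le_ne_top ((summable_nat_add_iff 1).2 hs).tsum_ofReal_ne_top
      (ENNReal.tsum_le_tsum fun n => hv (n + 1) (by omega))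
  filter_upwards [ae_lt_top' (AEMeasurable.tsum hm) h1] with ω hω
  have h2 := ENNReal.tendsto_atTop_zero_of_tsum_ne_top hω.ne
  have h3 := (ENNReal.tendsto_toReal ENNReal.zero_ne_top).comp h2
  have h4 : Tendsto (fun n => D (n + 1) ω ^ 2) atTop (𝓝 0) := by
    refine h3.congr fun n => ?_
    exact ENNReal.toReal_ofReal (sq_nonneg _)
  have h5 := h4.sqrt
  simp only [Real.sqrt_sq_eq_abs, Real.sqrt_zero] at h5
  exact (tendsto_add_atTop_iff_nat 1).1 ((tendsto_zero_iff_abs_tendsto_zero _).2 h5)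

/-- Random probability measures on the line, all of whose moments concentrate around the moments
`c k n`, with second moments of the deviations bounded by `v k n`, where `c k n` converges to
the `k`-th moment of the semicircle distribution. -/
structure HasConcentratingMoments (P : Measure Ω) (ν : ℕ → Ω → Measure ℝ) (c v : ℕ → ℕ → ℝ) :
    Prop where
  prob : ∀ n, 1 ≤ n → ∀ ω, IsProbabilityMeasure (ν n ω)
  integrable : ∀ n ω (k : ℕ), Integrable (fun x => x ^ k) (ν n ω)
  aemeasurable : ∀ k n, 1 ≤ n → AEMeasurable (fun ω => ∫ x, x ^ k ∂(ν n ω) - c k n) P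
  lintegral_le : ∀ k n, 1 ≤ n →
    ∫⁻ ω, ENNReal.ofReal ((∫ x, x ^ k ∂(ν n ω) - c k n) ^ 2) ∂P ≤ ENNReal.ofReal (v k n)
  tendsto : ∀ k, Tendsto (c k) atTop (𝓝 (semicircleMoment k))

theorem HasConcentratingMoments.tendstoInMeasure {ν : ℕ → Ω → Measure ℝ} {c v : ℕ → ℕ → ℝ}
    (h : HasConcentratingMoments P ν c v) (hv : ∀ k, Tendsto (v k) atTop (𝓝 0)) (f : ℝ →ᵇ ℝ) :
    TendstoInMeasure P (fun n ω => ∫ x, f x ∂(ν n ω)) atTop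
      (fun _ => ∫ x, f x ∂semicircleDistribution) := by
  rw [tendstoInMeasure_iff_dist]
  intro ε hε
  obtain ⟨N, δ, hδ, H⟩ := exists_moments_close f hε
  have h0 : Tendsto (fun n => ∑ k ∈ Finset.range N,
      P {ω | δ / 2 ≤ |∫ x, x ^ k ∂(ν n ω) - c k n|}) atTop (𝓝 0) := by
    simpa using tendsto_finsetSum (Finset.range N) fun k _ => tendsto_measure_le_abs
      (h.aemeasurable k) (h.lintegral_le k) (hv k) (half_pos hδ)
  refine tendsto_of_tendsto_of_tendsto_of_le_of_le' tendsto_const_nhds h0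
    (Eventually.of_forall fun n => zero_le) ?_
  have h1 : ∀ᶠ n in atTop, ∀ k ∈ Finset.range N, |c k n - semicircleMoment k| < δ / 2 :=
    (Finset.eventually_all _).2 fun k _ => by
      simpa [Real.dist_eq] using Metric.tendsto_nhds.1 (h.tendsto k) _ (half_pos hδ)
  filter_upwards [eventually_ge_atTop 1, h1] with n hn h1
  -- A deviation of the integral of `f` forces one of the first `N` moments to deviate by `δ / 2`
  -- from its centre `c k n`; then a union bound.
  refine (measure_mono fun ω hω => ?_).trans (measure_biUnion_finset_le _ _)
  by_contra hne
  simp only [Set.mem_iUnion, Set.mem_ofPred_eq, not_exists, not_le] at hne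
  refine absurd (H (ν n ω) (h.prob n hn ω) (h.integrable n ω) fun k hk => ?_) (not_lt.2 hω)
  have := abs_sub_le (∫ x, x ^ k ∂(ν n ω)) (c k n) (semicircleMoment k)
  linarith [hne k hk, h1 k hk]

theorem HasConcentratingMoments.ae_tendsto {ν : ℕ → Ω → Measure ℝ} {c v : ℕ → ℕ → ℝ}
    (h : HasConcentratingMoments P ν c v) (hv : ∀ k, Summable (v k)) (f : ℝ →ᵇ ℝ) :
    ∀ᵐ ω ∂P, Tendsto (fun n => ∫ x, f x ∂(ν n ω)) atTop
      (𝓝 (∫ x, f x ∂semicircleDistribution)) := by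
  -- There are countably many moments, so one null set serves all of them, and hence every `ε`.
  have h0 : ∀ᵐ ω ∂P, ∀ k, Tendsto (fun n => ∫ x, x ^ k ∂(ν n ω) - c k n) atTop (𝓝 0) :=
    ae_all_iff.2 fun k => ae_tendsto_zero_of_summable (h.aemeasurable k) (h.lintegral_le k) (hv k)
  filter_upwards [h0] with ω hω
  rw [Metric.tendsto_nhds]
  intro ε hε
  obtain ⟨N, δ, hδ, H⟩ := exists_moments_close f hε
  have h1 : ∀ᶠ n in atTop, ∀ k ∈ Finset.range N, |∫ x, x ^ k ∂(ν n ω) - semicircleMoment k| < δ :=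
    (Finset.eventually_all _).2 fun k _ => by
      have h2 := (hω k).add (h.tendsto k)
      simp only [sub_add_cancel, zero_add] at h2
      exact Metric.tendsto_nhds.1 h2 _ hδ
  filter_upwards [eventually_ge_atTop 1, h1] with n hn h1
  exact H (ν n ω) (h.prob n hn ω) (h.integrable n ω) h1

theorem integrable_empiricalSpectralDistribution {n : ℕ} {A : Matrix (Fin n) (Fin n) ℝ}
    (hA : A.IsHermitian) (f : ℝ → ℝ) : Integrable f (empiricalSpectralDistribution hA) := by
  rcases n with _ | n
  · simp [empiricalSpectralDistribution]
  · refine (integrable_finsetSum_measure.2 fun i _ => integrable_dirac enorm_lt_top).smul_measure ?_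
    simp

theorem integral_pow_empiricalSpectralDistribution {n : ℕ} {A : Matrix (Fin n) (Fin n) ℝ}
    (hA : A.IsHermitian) (k : ℕ) :
    ∫ x, x ^ k ∂(empiricalSpectralDistribution hA) = (A ^ k).trace / n := by
  rw [empiricalSpectralDistribution, integral_smul_measure,
    integral_finsetSum_measure fun i _ => integrable_dirac enorm_lt_top, trace_pow_eq_sum hA]
  simp [div_eq_inv_mul]

theorem isProbabilityMeasure_empiricalSpectralDistribution {n : ℕ} (hn : 1 ≤ n)
    {A : Matrix (Fin n) (Fin n) ℝ} (hA : A.IsHermitian) :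
    IsProbabilityMeasure (empiricalSpectralDistribution hA) := by
  constructor
  simp only [empiricalSpectralDistribution, Measure.smul_apply, Measure.finsetSum_apply,
    measure_univ, Finset.sum_const, Finset.card_univ, Fintype.card_fin, smul_eq_mul, nsmul_eq_mul,
    mul_one]
  exact ENNReal.inv_mul_cancel (by exact_mod_cast (by omega : n ≠ 0)) (ENNReal.natCast_ne_top n)

theorem one_le_of_isBandwidth {n b : ℕ} (hn : 1 ≤ n) (hb : IsBandwidth n b) : 1 ≤ b ∧ b ≤ n := by
  rcases hb with ⟨h, h'⟩ | rfl
  · exact ⟨h.pos, h'.le⟩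
  · exact ⟨hn, le_rfl⟩

/-- Each of the two summands is at most `2 / n`. -/
theorem tendsto_variance_rate {α : ℝ} (hα : 1 / 2 ≤ α) {b : ℕ → ℕ}
    (hb : ∀ n, 1 ≤ n → IsBandwidth n (b n)) :
    Tendsto (fun n : ℕ => 2 / ((n : ℝ) * b n) + 1 / (triangleCard n : ℝ) ^ α) atTop (𝓝 0) := by
  refine squeeze_zero' (Eventually.of_forall fun n => by positivity) ?_
    (tendsto_const_div_atTop_nhds_zero_nat 4)
  filter_upwards [eventually_ge_atTop 1] with n hn
  have hn0 : (0 : ℝ) < n := by exact_mod_cast hn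
  have hb1 : (1 : ℝ) ≤ b n := by exact_mod_cast (one_le_of_isBandwidth hn (hb n hn)).1
  have h1 : 2 / ((n : ℝ) * b n) ≤ 2 / n :=
    div_le_div_of_nonneg_left zero_le_two hn0 (le_mul_of_one_le_right hn0.le hb1)
  have h2 := (le_div_iff₀ hn0).2 (one_div_triangleCard_rpow_mul_le hα hn)
  have h3 : (4 : ℝ) / n = 2 / n + 2 / n := by ring
  linarith

/-- From `b n ≤ n`, the first summand is at most `2 / b n ^ 2`; the second is compared with `n ^
(-2α)`, where `2α > 1`. -/
theorem summable_variance_rate {α : ℝ} (hα : 1 / 2 < α) {b : ℕ → ℕ}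
    (hb : ∀ n, 1 ≤ n → IsBandwidth n (b n)) (hs : Summable fun n => 1 / (b n : ℝ) ^ 2) :
    Summable fun n : ℕ => 2 / ((n : ℝ) * b n) + 1 / (triangleCard n : ℝ) ^ α := by
  refine Summable.of_nonneg_of_le (fun n => by positivity) (fun n => ?_)
    ((hs.mul_left 2).add ((Real.summable_one_div_nat_rpow.2
      (by linarith : 1 < 2 * α)).mul_left (2 ^ α)))
  -- At `n = 0` both denominators are zero, and division by zero gives 0.
  rcases Nat.eq_zero_or_pos n with rfl | hn
  · have h0 : ((triangleCard 0 : ℕ) : ℝ) ^ α = 0 := by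
      simp [triangleCard, Real.zero_rpow (by linarith : α ≠ 0)]
    rw [h0]
    simp only [Nat.cast_zero, zero_mul, div_zero, add_zero]
    positivity
  · refine add_le_add ?_ (one_div_triangleCard_rpow_le (by linarith) hn)
    obtain ⟨h1, h2⟩ := one_le_of_isBandwidth hn (hb n hn)
    have h1' : (0 : ℝ) < b n := by exact_mod_cast h1
    have h2' : (b n : ℝ) ≤ n := by exact_mod_cast h2
    rw [mul_one_div, sq]
    gcongr

theorem tendsto_meanMoment {α : ℝ} (hα : 1 / 2 ≤ α)
    {S : ∀ n : ℕ, Matrix (Fin n) (Fin n) ℝ} (hS : IsCovMatSeq α S)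
    {φ : ∀ n : ℕ, Fin n × Fin n → Fin (triangleCard n)} (hφ : ∀ n, IsTriangleEnumeration (φ n))
    {b : ℕ → ℕ} (hb : ∀ n, 1 ≤ n → IsBandwidth n (b n)) (hb_top : Tendsto b atTop atTop) (k : ℕ) :
    Tendsto (fun n => meanMoment (bandAdjacency n (b n)) (b n)
      (entryExpectation (hφ n) (S (triangleCard n))) k) atTop (𝓝 (semicircleMoment k)) := by
  obtain ⟨K, -, hK⟩ := WeaklyCorrelatedBand.exists_abs_meanMoment_sub_le 2 semicircleMoment_zero
    semicircleMoment_one semicircleMoment_recursion k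
  rw [tendsto_iff_dist_tendsto_zero]
  have h0 : Tendsto (fun n => K / √(b n : ℝ)) atTop (𝓝 0) :=
    Tendsto.div_atTop tendsto_const_nhds
      (Real.tendsto_sqrt_atTop.comp (tendsto_natCast_atTop_atTop.comp hb_top))
  refine squeeze_zero' (Eventually.of_forall fun n => dist_nonneg) ?_ h0
  filter_upwards [eventually_ge_atTop 1] with n hn
  have : NeZero n := ⟨by omega⟩
  exact hK (weaklyCorrelatedBand_entryExpectation hα hS (hφ n) (hb n hn))

theorem hasConcentratingMoments_empiricalSpectralDistribution [IsProbabilityMeasure P] {α : ℝ}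
    (hα : 1 / 2 ≤ α) {S : ∀ n : ℕ, Matrix (Fin n) (Fin n) ℝ} (hS : IsCovMatSeq α S)
    {Y : ∀ n : ℕ, Ω → EuclideanSpace ℝ (Fin (triangleCard n))}
    (hY : ∀ n, HasLaw (Y n) (multivariateGaussian 0 (S (triangleCard n))) P)
    {φ : ∀ n : ℕ, Fin n × Fin n → Fin (triangleCard n)} (hφ : ∀ n, IsTriangleEnumeration (φ n))
    {b : ℕ → ℕ} (hb : ∀ n, 1 ≤ n → IsBandwidth n (b n)) (hb_top : Tendsto b atTop atTop)
    {X : ∀ n : ℕ, Ω → Matrix (Fin n) (Fin n) ℝ}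
    (hX : ∀ n ω, X n ω = periodicBandMatrix (b n) (filledMatrix (φ n) (Y n ω)))
    (hX_symm : ∀ n ω, (X n ω).IsHermitian) :
    HasConcentratingMoments P (fun n ω => empiricalSpectralDistribution (hX_symm n ω))
      (fun k n => meanMoment (bandAdjacency n (b n)) (b n)
        (entryExpectation (hφ n) (S (triangleCard n))) k)
      (fun k n => k ^ 2 * momentBound 2 (k - 1) *
        (2 / ((n : ℝ) * b n) + 1 / (triangleCard n : ℝ) ^ α)) where
  prob n hn ω := isProbabilityMeasure_empiricalSpectralDistribution hn _
  integrable n ω k := integrable_empiricalSpectralDistribution _ _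
  aemeasurable k n hn := by
    have h := (integrable_eval_of_hasLaw (hφ n) (hY n)
      (bandPoly (bandAdjacency n (b n)) (b n) ^ k).trace).1.aemeasurable
    simp_rw [eval_trace_bandPoly_pow, ← periodicBandMatrix_eq_bandEval (hφ n), ← hX] at h
    simp_rw [integral_pow_empiricalSpectralDistribution]
    exact (h.div_const _).sub_const _
  lintegral_le k n hn := by
    have : NeZero n := ⟨by omega⟩
    simp_rw [integral_pow_empiricalSpectralDistribution, hX]
    exact lintegral_sq_trace_sub_meanMoment_le hα hS (hφ n) (hb n hn) (hY n) k
  tendsto k := tendsto_meanMoment hα hS hφ hb hb_top k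

end Convergence

theorem theorem3p9 {Ω : Type*} [MeasurableSpace Ω] (P : Measure Ω) [IsProbabilityMeasure P]
    (α : ℝ) (hα : 0 < α)
    (S : ∀ n : ℕ, Matrix (Fin n) (Fin n) ℝ) (hS : IsCovMatSeq α S)
    (Y : ∀ n : ℕ, Ω → EuclideanSpace ℝ (Fin (triangleCard n)))
    (hY : ∀ n, HasLaw (Y n) (multivariateGaussian 0 (S (triangleCard n))) P)
    (φ : ∀ n : ℕ, Fin n × Fin n → Fin (triangleCard n)) (hφ : ∀ n, IsTriangleEnumeration (φ n))
    (b : ℕ → ℕ) (hb : ∀ n, 1 ≤ n → IsBandwidth n (b n)) (hb_top : Tendsto b atTop atTop)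
    (X : ∀ n : ℕ, Ω → Matrix (Fin n) (Fin n) ℝ)
    (hX : ∀ n ω, X n ω = periodicBandMatrix (b n) (filledMatrix (φ n) (Y n ω))) :
    let hX_symm : ∀ n ω, (X n ω).IsHermitian := fun n ω =>
      (hX n ω).symm ▸ periodicBandMatrix_isHermitian (b n) (filledMatrix_isHermitian (hφ n) (Y n ω))
    (1 / 2 ≤ α → SemicircleLawInProbability P hX_symm) ∧
    (1 / 2 < α → Summable (fun n => 1 / (b n : ℝ) ^ 2) → SemicircleLawAlmostSurely P hX_symm) ∧
    (1 / 2 < α → (∀ n, 1 ≤ n → b n = n) → SemicircleLawAlmostSurely P hX_symm) := by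
  intro hX_symm
  have key := fun h : 1 / 2 ≤ α => hasConcentratingMoments_empiricalSpectralDistribution h hS hY hφ
    hb hb_top hX hX_symm
  have almostSurely : 1 / 2 < α → Summable (fun n => 1 / (b n : ℝ) ^ 2) →
      SemicircleLawAlmostSurely P hX_symm := fun h hs f =>
    (key h.le).ae_tendsto (fun k => (summable_variance_rate h hb hs).mul_left _) f
  refine ⟨fun h f => (key h).tendstoInMeasure (fun k => ?_) f, almostSurely,
    fun h hbn => almostSurely h ?_⟩
  · simpa using (tendsto_variance_rate h hb).const_mul ((k : ℝ) ^ 2 * momentBound 2 (k - 1))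
  -- The bandwidth at index 0 is unconstrained, so summability is checked from index 1 on.
  · rw [← summable_nat_add_iff 1]
    refine ((summable_nat_add_iff 1).2
      (Real.summable_one_div_nat_pow.2 one_lt_two)).congr fun n => ?_
    rw [hbn (n + 1) (by omega)]
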